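/- Let $1\le k\le n-1$. On $\mathbb R^{n+1}$ put $[x,y]=-x_1y_1-\dots-x_ny_n+x_{n+1}y_{n+1}$, and let $\mathbb H^n=\{x\in\mathbb R^{n+1}:[x,x]=1,\ x_{n+1}>0\}$ be the hyperbolic space, with origin $x_0=(0,\dots,0,1)$ and Riemannian measure $dx$, given in polar coordinates $x=\zeta\sinh\omega+e_{n+1}\cosh\omega$ ($\zeta\in S^{n-1}$, $\omega\ge 0$) by $dx=\sinh^{n-1}\omega\,d\omega\,d\sigma(\zeta)$. Let $\Xi$ be the set of all $k$-geodesics of $\mathbb H^n$, that is, of all ($k$-dimensional, complete, connected) totally geodesic submanifolds; these are the nonempty sections of $\mathbb H^n$ by $(k+1)$-dimensional linear subspaces of $\mathbb R^{n+1}$. The group $G=SO_0(n,1)$ acts transitively on $\Xi$, and "almost all $\xi\in\Xi$" refers to the $G$-invariant measure on $\Xi$. Let $(Rf)(\xi)=\int_\xi f(x)\,d_\xi x$ be the totally geodesic Radon transform of $f$, where $d_\xi x$ is the Riemannian measure on $\xi\in\Xi$. Let $f$ be a locally integrable function on $\mathbb H^n\setminus\{x_0\}$. (i) If $$\int_{x_{n+1}>2}\frac{|f(x)|}{x_{n+1}^{\,n-k}}\,dx<\infty,\qquad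 (*)$$ then $(Rf)(\xi)$ is finite (the integral converges absolutely) for almost all $\xi\in\Xi$. (ii) If $f$ is nonnegative and zonal (that is, $f(x)=f_0(x_{n+1})$ for some function $f_0$), and $(*)$ fails, then $(Rf)(\xi)=\infty$ for every $\xi\in\Xi$. -/

import Mathlib

open MeasureTheory Set
open scoped ENNReal

noncomputable section

namespace HypSpace

/-! ### The hyperboloid model -/

/-- The Lorentz inner product `[x, y] = -x₁y₁ - ⋯ - xₙyₙ + xₙ₊₁yₙ₊₁` on `ℝⁿ⁺¹`. -/
def lor {n : ℕ} (x y : Fin (n + 1) → ℝ) : ℝ :=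
  x (Fin.last n) * y (Fin.last n) - ∑ i : Fin n, x i.castSucc * y i.castSucc

/-- The hyperbolic space `ℍⁿ`: the upper sheet of the hyperboloid `[x, x] = 1`, with the topology
and the Borel `σ`-algebra induced from `ℝⁿ⁺¹`. -/
abbrev HSpace (n : ℕ) : Type := {x : Fin (n + 1) → ℝ // lor x x = 1 ∧ 0 < x (Fin.last n)}

/-- The last coordinate `xₙ₊₁` of a point `x ∈ ℍⁿ`. -/
def height {n : ℕ} (x : HSpace n) : ℝ := x.1 (Fin.last n)

/-- The origin `x₀ = (0, …, 0, 1)` of `ℍⁿ`. -/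
def x0 (n : ℕ) : HSpace n :=
  ⟨Fin.snoc (0 : Fin n → ℝ) (1 : ℝ), by simp [lor], by simp⟩

/-- Hyperbolic polar coordinates `(ζ, ω) ↦ ζ sinh ω + eₙ₊₁ cosh ω`. -/
def polar {n : ℕ} (p : Metric.sphere (0 : EuclideanSpace ℝ (Fin n)) 1 × ℝ) : HSpace n :=
  ⟨Fin.snoc (fun i : Fin n => p.1.1 i * Real.sinh p.2) (Real.cosh p.2), by
    have h : ∑ i, p.1.1 i * p.1.1 i = 1 := by
      have h1 := EuclideanSpace.real_norm_sq_eq p.1.1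
      rw [norm_eq_of_mem_sphere p.1] at h1
      simpa [pow_two] using h1.symm
    have h2 : ∑ i, p.1.1 i * Real.sinh p.2 * (p.1.1 i * Real.sinh p.2) = Real.sinh p.2 ^ 2 := by
      have : ∀ i, p.1.1 i * Real.sinh p.2 * (p.1.1 i * Real.sinh p.2)
          = (p.1.1 i * p.1.1 i) * Real.sinh p.2 ^ 2 := fun i => by ring
      simp_rw [this, ← Finset.sum_mul, h, one_mul]
    simp only [lor, Fin.snoc_last, Fin.snoc_castSucc, h2]
    nlinarith [Real.cosh_sq p.2], by simpa using Real.cosh_pos p.2⟩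

theorem continuous_polar {n : ℕ} : Continuous (polar (n := n)) := by
  refine Continuous.subtype_mk (continuous_pi fun i => ?_) _
  induction i using Fin.lastCases with
  | last => simp only [Fin.snoc_last]; fun_prop
  | cast i => simp only [Fin.snoc_castSucc]; fun_prop

/-- The Riemannian measure `dx = sinhⁿ⁻¹ω dω dσ(ζ)` of `ℍⁿ` (`n ≥ 1`), where `dσ` is the surface
measure of the unit sphere of `ℝⁿ`. -/
def hypVolume (n : ℕ) : Measure (HSpace n) :=
  Measure.map polar
    ((volume : Measure (EuclideanSpace ℝ (Fin n))).toSphere.prod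
      ((volume.restrict (Ioi (0 : ℝ))).withDensity
        fun ω => ENNReal.ofReal (Real.sinh ω ^ (n - 1))))

/-! ### The group `G = SO₀(n, 1)` -/

section lorLemmas
variable {n : ℕ}

theorem lor_comm (x y : Fin (n + 1) → ℝ) : lor x y = lor y x := by
  simp [lor, mul_comm]

theorem lor_add_left (x y z : Fin (n + 1) → ℝ) : lor (x + y) z = lor x z + lor y z := by
  simp only [lor, Pi.add_apply, add_mul, Finset.sum_add_distrib]; ring

theorem lor_smul_left (c : ℝ) (x z : Fin (n + 1) → ℝ) : lor (c • x) z = c * lor x z := by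
  simp only [lor, Pi.smul_apply, smul_eq_mul, mul_assoc, ← Finset.mul_sum]; ring

theorem lor_pos {x y : Fin (n + 1) → ℝ} (hx : lor x x = 1 ∧ 0 < x (Fin.last n))
    (hy : lor y y = 1 ∧ 0 < y (Fin.last n)) : 0 < lor x y := by
  obtain ⟨hx1, hx2⟩ := hx
  obtain ⟨hy1, hy2⟩ := hy
  have hcs := Finset.sum_mul_sq_le_sq_mul_sq Finset.univ
    (fun i : Fin n => x i.castSucc) (fun i => y i.castSucc)
  simp only [lor, ← pow_two] at hx1 hy1
  have ha : ∑ i : Fin n, x i.castSucc ^ 2 = x (Fin.last n) ^ 2 - 1 := by linarith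
  have hb : ∑ i : Fin n, y i.castSucc ^ 2 = y (Fin.last n) ^ 2 - 1 := by linarith
  have ha0 : 0 ≤ x (Fin.last n) ^ 2 - 1 := ha ▸ Finset.sum_nonneg fun i _ => sq_nonneg _
  have hb0 : 0 ≤ y (Fin.last n) ^ 2 - 1 := hb ▸ Finset.sum_nonneg fun i _ => sq_nonneg _
  rw [ha, hb] at hcs
  have : (∑ i : Fin n, x i.castSucc * y i.castSucc) ^ 2
      < (x (Fin.last n) * y (Fin.last n)) ^ 2 := by nlinarith
  have := lt_of_pow_lt_pow_left₀ 2 (by positivity) this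
  simp only [lor]; linarith

/-- A form-preserving linear map that sends one point of the upper sheet to the upper sheet
preserves the upper sheet. -/
theorem maps_sheet (A : (Fin (n + 1) → ℝ) →ₗ[ℝ] (Fin (n + 1) → ℝ))
    (hA : ∀ x y, lor (A x) (A y) = lor x y) {p : Fin (n + 1) → ℝ}
    (hp : lor p p = 1 ∧ 0 < p (Fin.last n)) (hAp : 0 < A p (Fin.last n))
    {x : Fin (n + 1) → ℝ} (hx : lor x x = 1 ∧ 0 < x (Fin.last n)) : 0 < A x (Fin.last n) := by
  by_contra hneg
  have h1 : lor (A x) (A x) = 1 := by rw [hA, hx.1]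
  have hne : A x (Fin.last n) ≠ 0 := by
    intro h0
    rw [lor, h0] at h1
    have := Finset.sum_nonneg (s := Finset.univ)
      fun (i : Fin n) _ => mul_self_nonneg (A x i.castSucc)
    linarith
  have hlt : A x (Fin.last n) < 0 := lt_of_le_of_ne (not_lt.mp hneg) hne
  have h2 : lor ((-1 : ℝ) • A x) ((-1 : ℝ) • A x) = 1 := by
    rw [lor_smul_left, lor_comm, lor_smul_left, h1]; ring
  have h3 := lor_pos (x := (-1 : ℝ) • A x) (y := A p) ⟨h2, by simpa using hlt⟩
    ⟨by rw [hA, hp.1], hAp⟩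
  rw [lor_smul_left, hA] at h3
  linarith [lor_pos hx hp]

end lorLemmas

/-- `SO₀(n, 1)`: the matrices of determinant one that preserve the Lorentz inner product and
the upper sheet of the hyperboloid. -/
def G (n : ℕ) : Subgroup (Matrix.SpecialLinearGroup (Fin (n + 1)) ℝ) where
  carrier := {A | (∀ x y : Fin (n + 1) → ℝ, lor (A • x) (A • y) = lor x y) ∧
    ∀ x : HSpace n, 0 < (A • x.1) (Fin.last n)}
  one_mem' := ⟨fun x y => by simp, fun x => by simpa using x.2.2⟩
  mul_mem' := by
    rintro A B ⟨hA, hA'⟩ ⟨hB, hB'⟩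
    refine ⟨fun x y => by rw [mul_smul, mul_smul, hA, hB], fun x => ?_⟩
    rw [mul_smul]
    exact hA' ⟨B • x.1, by rw [hB, x.2.1], hB' x⟩
  inv_mem' := by
    rintro A ⟨hA, hA'⟩
    have hi : ∀ x y : Fin (n + 1) → ℝ, lor (A⁻¹ • x) (A⁻¹ • y) = lor x y := fun x y => by
      rw [← hA, smul_inv_smul, smul_inv_smul]
    refine ⟨hi, fun x => ?_⟩
    have hp := hA' (x0 n)
    refine maps_sheet (Matrix.SpecialLinearGroup.toLin' A⁻¹).toLinearMap hi
      (p := A • (x0 n).1) ⟨by rw [hA, (x0 n).2.1], hp⟩ ?_ x.2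
    change 0 < (A⁻¹ • A • (x0 n).1) (Fin.last n)
    rw [inv_smul_smul]
    exact (x0 n).2.2

/-- The action of `SO₀(n, 1)` on `ℍⁿ`. -/
instance (n : ℕ) : MulAction (G n) (HSpace n) where
  smul g x := ⟨g.1 • x.1, by rw [g.2.1, x.2.1], g.2.2 x⟩
  one_smul x := Subtype.ext (one_smul _ x.1)
  mul_smul g h x := Subtype.ext (mul_smul g.1 h.1 x.1)

theorem smul_val {n : ℕ} (g : G n) (x : HSpace n) : (g • x).1 = g.1 • x.1 := rfl

theorem continuous_smul_left {n : ℕ} (x : Fin (n + 1) → ℝ) :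
    Continuous fun A : Matrix.SpecialLinearGroup (Fin (n + 1)) ℝ => A • x := by
  change Continuous fun A : Matrix.SpecialLinearGroup (Fin (n + 1)) ℝ => A.1.mulVec x
  exact Continuous.matrix_mulVec continuous_subtype_val continuous_const

theorem continuous_lor {n : ℕ} {α : Type*} [TopologicalSpace α] {f g : α → Fin (n + 1) → ℝ}
    (hf : Continuous f) (hg : Continuous g) : Continuous fun a => lor (f a) (g a) := by
  unfold lor; fun_prop

theorem isClosed_G (n : ℕ) : IsClosed (G n : Set (Matrix.SpecialLinearGroup (Fin (n + 1)) ℝ)) := by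
  have : (G n : Set (Matrix.SpecialLinearGroup (Fin (n + 1)) ℝ)) =
      {A | ∀ x y : Fin (n + 1) → ℝ, lor (A • x) (A • y) = lor x y} ∩
        {A | ∀ x : HSpace n, 0 ≤ (A • x.1) (Fin.last n)} := by
    ext A
    refine ⟨fun h => ⟨h.1, fun x => (h.2 x).le⟩, fun h => ⟨h.1, fun x => ?_⟩⟩
    refine lt_of_le_of_ne (h.2 x) fun h0 => ?_
    have h1 := h.1 x.1 x.1
    rw [x.2.1, lor, ← h0] at h1
    have := Finset.sum_nonneg (s := Finset.univ)
      fun (i : Fin n) _ => mul_self_nonneg ((A • x.1) i.castSucc)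
    linarith
  rw [this]
  refine IsClosed.inter ?_ ?_
  · simp only [ofPred_forall]
    exact isClosed_iInter fun x => isClosed_iInter fun y => isClosed_eq
      (continuous_lor (continuous_smul_left x) (continuous_smul_left y)) continuous_const
  · simp only [ofPred_forall]
    exact isClosed_iInter fun x => isClosed_le continuous_const
      ((continuous_apply _).comp (continuous_smul_left x.1))

instance (n : ℕ) : LocallyCompactSpace (G n) := by
  have : LocallyCompactSpace (Matrix (Fin (n + 1)) (Fin (n + 1)) ℝ) :=
    inferInstanceAs (LocallyCompactSpace (Fin (n + 1) → Fin (n + 1) → ℝ))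
  have : LocallyCompactSpace (Matrix.SpecialLinearGroup (Fin (n + 1)) ℝ) :=
    Matrix.SpecialLinearGroup.isClosedEmbedding_val.locallyCompactSpace
  exact (isClosed_G n).isClosedEmbedding_subtypeVal.locallyCompactSpace

instance (n : ℕ) : MeasurableSpace (G n) := borel _

instance (n : ℕ) : BorelSpace (G n) := ⟨rfl⟩

/-! ### `k`-geodesics -/

/-- The embedding of `E^{k,1} = ℝᵏ⁺¹` into `ℝⁿ⁺¹` as the span of the last `k + 1` coordinate
vectors. -/
def embLin (n k : ℕ) : (Fin (k + 1) → ℝ) →ₗ[ℝ] (Fin (n + 1) → ℝ) where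
  toFun y i := if n - k ≤ i.1 then y ⟨i.1 - (n - k), by omega⟩ else 0
  map_add' x y := by ext i; dsimp; split_ifs <;> simp
  map_smul' c x := by ext i; dsimp; split_ifs <;> simp

theorem embLin_last {n k : ℕ} (hk : k < n) (y : Fin (k + 1) → ℝ) :
    embLin n k y (Fin.last n) = y (Fin.last k) := by
  simp only [embLin, LinearMap.coe_mk, AddHom.coe_mk, Fin.val_last, Nat.sub_le, if_true]
  congr 1
  ext
  simp only [Fin.val_last]
  omega

theorem lor_embLin {n k : ℕ} (hk : k < n) (x y : Fin (k + 1) → ℝ) :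
    lor (embLin n k x) (embLin n k y) = lor x y := by
  unfold lor
  rw [embLin_last hk, embLin_last hk]
  congr 1
  obtain ⟨m, rfl⟩ : ∃ m, n = m + k := ⟨n - k, by omega⟩
  rw [Fin.sum_univ_add]
  have h1 : ∀ i : Fin m, embLin (m + k) k x (Fin.castAdd k i).castSucc = 0 := fun i => by
    simp [embLin]
  have h2 : ∀ (z : Fin (k + 1) → ℝ) (i : Fin k),
      embLin (m + k) k z (Fin.natAdd m i).castSucc = z i.castSucc := fun z i => by
    simp only [embLin, LinearMap.coe_mk, AddHom.coe_mk, Fin.val_castSucc, Fin.val_natAdd,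
      add_tsub_cancel_right]
    rw [if_pos (by omega)]
    congr 1
    ext
    simp
  simp only [h1, h2, zero_mul, Finset.sum_const_zero, zero_add]

/-- The embedding `ℍᵏ → ℍⁿ`. -/
def emb {n k : ℕ} (hk : k < n) (y : HSpace k) : HSpace n :=
  ⟨embLin n k y.1, by rw [lor_embLin hk, y.2.1], by rw [embLin_last hk]; exact y.2.2⟩

/-- A `k`-dimensional totally geodesic submanifold (`k`-geodesic) of `ℍⁿ`: a nonempty intersection
of `ℍⁿ` with a linear subspace of dimension `k + 1` of `ℝⁿ⁺¹`. -/
def IsGeod {n : ℕ} (k : ℕ) (ξ : Set (HSpace n)) : Prop :=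
  ξ.Nonempty ∧ ∃ V : Submodule ℝ (Fin (n + 1) → ℝ),
    Module.finrank ℝ V = k + 1 ∧ ξ = {x : HSpace n | x.1 ∈ V}

/-- The set `Ξ` of all `k`-geodesics of `ℍⁿ`. -/
def Geod (n k : ℕ) : Type := {ξ : Set (HSpace n) // IsGeod k ξ}

theorem embLin_injective {n k : ℕ} (hk : k < n) : Function.Injective (embLin n k) := by
  intro x y h
  ext i
  have := congrFun h ⟨i.1 + (n - k), by omega⟩
  simp only [embLin, LinearMap.coe_mk, AddHom.coe_mk] at this
  rw [if_pos (by omega), if_pos (by omega)] at this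
  simpa using this

theorem finrank_range_embLin {n k : ℕ} (hk : k < n) :
    Module.finrank ℝ (LinearMap.range (embLin n k)) = k + 1 := by
  rw [LinearMap.finrank_range_of_inj (embLin_injective hk)]; simp

/-- The origin `ξ₀ = ℍⁿ ∩ E^{k,1}` of `Ξ`. -/
def xi0 {n k : ℕ} (hk : k < n) : Geod n k :=
  ⟨{x | x.1 ∈ LinearMap.range (embLin n k)},
    ⟨emb hk (x0 k), ⟨(x0 k).1, rfl⟩⟩, _, finrank_range_embLin hk, rfl⟩

/-- The action of `SO₀(n, 1)` on `k`-geodesics, `ξ ↦ gξ`. -/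
def move {n k : ℕ} (g : G n) (ξ : Geod n k) : Geod n k :=
  ⟨(fun x => g • x) '' ξ.1, ξ.2.1.image _, by
    obtain ⟨-, V, hV, hξ⟩ := ξ.2
    refine ⟨V.map (Matrix.SpecialLinearGroup.toLin' g.1).toLinearMap, ?_, ?_⟩
    · rw [← hV]
      exact LinearEquiv.finrank_map_eq (Matrix.SpecialLinearGroup.toLin' g.1) V
    · rw [hξ]
      ext x
      constructor
      · rintro ⟨y, hy, rfl⟩
        exact ⟨y.1, hy, rfl⟩
      · rintro ⟨y, hy, hyx⟩
        refine ⟨g⁻¹ • x, ?_, smul_inv_smul g x⟩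
        have : (g⁻¹ • x).1 = y := by
          rw [smul_val, ← hyx]
          exact inv_smul_smul g.1 y
        rw [mem_ofPred_eq, this]
        exact hy⟩

/-- The reflection `v ↦ 2[v, u]/[u, u] u - v`, for `u = x + x₀`, which exchanges `x₀` and `x`. -/
def flip {n : ℕ} (x : HSpace n) : (Fin (n + 1) → ℝ) →ₗ[ℝ] (Fin (n + 1) → ℝ) where
  toFun v := (lor v (x.1 + (x0 n).1) / (1 + lor x.1 (x0 n).1)) • (x.1 + (x0 n).1) - v
  map_add' v w := by
    rw [lor_add_left, add_div, add_smul]; abel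
  map_smul' c v := by
    rw [lor_smul_left, mul_div_assoc, mul_smul, RingHom.id_apply, smul_sub]

theorem lor_flip {n : ℕ} (x : HSpace n) (v w : Fin (n + 1) → ℝ) :
    lor (flip x v) (flip x w) = lor v w := by
  have hc := lor_pos x.2 (x0 n).2
  have hu : lor (x.1 + (x0 n).1) (x.1 + (x0 n).1) = 2 * (1 + lor x.1 (x0 n).1) := by
    rw [lor_add_left, lor_comm x.1, lor_comm (x0 n).1 (x.1 + _), lor_add_left, lor_add_left,
      x.2.1, (x0 n).2.1, lor_comm (x0 n).1 x.1]; ring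
  have hne : 1 + lor x.1 (x0 n).1 ≠ 0 := by positivity
  simp only [flip, LinearMap.coe_mk, AddHom.coe_mk]
  generalize 1 + lor x.1 (x0 n).1 = c at *
  generalize x.1 + (x0 n).1 = u at *
  have e : ∀ (a b : ℝ), lor (a • u - v) (b • u - w)
      = a * b * lor u u - a * lor w u - b * lor v u + lor v w := by
    intro a b
    rw [sub_eq_add_neg, sub_eq_add_neg, ← neg_one_smul ℝ v, ← neg_one_smul ℝ w, lor_add_left,
      lor_smul_left, lor_smul_left, lor_comm u, lor_comm v, lor_add_left, lor_add_left,
      lor_smul_left, lor_smul_left, lor_smul_left, lor_smul_left, lor_comm u v, lor_comm w v]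
    ring
  rw [e, hu]
  field_simp
  ring

theorem flip_x0 {n : ℕ} (x : HSpace n) : flip x (x0 n).1 = x.1 := by
  have hc := lor_pos x.2 (x0 n).2
  have hne : 1 + lor x.1 (x0 n).1 ≠ 0 := by positivity
  simp only [flip, LinearMap.coe_mk, AddHom.coe_mk]
  rw [lor_comm, lor_add_left, (x0 n).2.1, add_comm (lor _ _), div_self hne, one_smul,
    add_sub_cancel_right]

theorem flip_flip {n : ℕ} (x : HSpace n) (v : Fin (n + 1) → ℝ) : flip x (flip x v) = v := by
  have hc := lor_pos x.2 (x0 n).2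
  have hu : lor (x.1 + (x0 n).1) (x.1 + (x0 n).1) = 2 * (1 + lor x.1 (x0 n).1) := by
    rw [lor_add_left, lor_comm x.1, lor_comm (x0 n).1 (x.1 + _), lor_add_left, lor_add_left,
      x.2.1, (x0 n).2.1, lor_comm (x0 n).1 x.1]; ring
  have hne : 1 + lor x.1 (x0 n).1 ≠ 0 := by positivity
  simp only [flip, LinearMap.coe_mk, AddHom.coe_mk]
  generalize 1 + lor x.1 (x0 n).1 = c at *
  generalize x.1 + (x0 n).1 = u at *
  rw [sub_eq_add_neg (_ • u) v, ← neg_one_smul ℝ v, lor_add_left, lor_smul_left, lor_smul_left, hu]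
  ext i
  simp only [Pi.sub_apply, Pi.add_apply, Pi.smul_apply, smul_eq_mul]
  field_simp
  ring

/-- The embedding of `ℝⁿ` into `ℝⁿ⁺¹` as the hyperplane `xₙ₊₁ = 0`. -/
def horiz (n : ℕ) : EuclideanSpace ℝ (Fin n) →ₗ[ℝ] (Fin (n + 1) → ℝ) where
  toFun v := Fin.snoc (fun i => v i) (0 : ℝ)
  map_add' v w := by
    ext i
    induction i using Fin.lastCases <;> simp
  map_smul' c v := by
    ext i
    induction i using Fin.lastCases <;> simp

theorem lor_horiz {n : ℕ} (v w : EuclideanSpace ℝ (Fin n)) :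
    lor (horiz n v) (horiz n w) = -inner ℝ v w := by
  simp [lor, horiz, PiLp.inner_apply, mul_comm]

theorem lor_horiz_x0 {n : ℕ} (v : EuclideanSpace ℝ (Fin n)) :
    lor (horiz n v) (x0 n).1 = 0 := by
  simp [lor, horiz, x0]

/-- A subspace of dimension `k + 1` through `x₀` has a pseudo-orthonormal frame. -/
theorem exists_frame {n k : ℕ} (hk : k < n) (W : Submodule ℝ (Fin (n + 1) → ℝ))
    (hW : Module.finrank ℝ W = k + 1) (h0 : (x0 n).1 ∈ W) :
    ∃ b : OrthonormalBasis (Fin n) ℝ (EuclideanSpace ℝ (Fin n)),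
      ∀ i : Fin n, n - k ≤ i.1 → horiz n (b i) ∈ W := by
  have hinj : Function.Injective (horiz n) := by
    intro v w h
    ext i
    simpa [horiz] using congrFun h i.castSucc
  have hfin : Module.finrank ℝ (W.comap (horiz n)) = k := by
    let L : W →ₗ[ℝ] ℝ := (LinearMap.proj (Fin.last n)).comp W.subtype
    have hL : LinearMap.range L = ⊤ := by
      rw [LinearMap.range_eq_top]
      intro c
      refine ⟨c • ⟨_, h0⟩, ?_⟩
      simp [L, x0]
    have h1 := LinearMap.finrank_range_add_finrank_ker L
    rw [hL, finrank_top, Module.finrank_self, hW] at h1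
    have h2 : Module.finrank ℝ ((W.comap (horiz n)).map (horiz n)) = k := by
      have : (W.comap (horiz n)).map (horiz n) = (LinearMap.ker L).map W.subtype := by
        ext v
        constructor
        · rintro ⟨w, hw, rfl⟩
          exact ⟨⟨_, hw⟩, by simp [L, horiz], rfl⟩
        · rintro ⟨w, hw, rfl⟩
          have hw' : w.1 (Fin.last n) = 0 := hw
          have : horiz n (WithLp.toLp 2 fun i => w.1 i.castSucc) = w.1 := by
            ext i
            induction i using Fin.lastCases <;> simp [horiz, hw']
          refine ⟨WithLp.toLp 2 fun i => w.1 i.castSucc, ?_, this⟩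
          rw [SetLike.mem_coe, Submodule.mem_comap, this]
          exact w.2
      rw [this, (Submodule.equivMapOfInjective _ W.subtype_injective _).finrank_eq.symm]
      omega
    rwa [(Submodule.equivMapOfInjective _ hinj _).finrank_eq.symm] at h2
  let c := (stdOrthonormalBasis ℝ (W.comap (horiz n))).reindex (finCongr hfin)
  let v : Fin n → EuclideanSpace ℝ (Fin n) := fun i =>
    if h : n - k ≤ i.1 then (c ⟨i.1 - (n - k), by omega⟩).1 else 0
  have hv : Orthonormal ℝ (({i : Fin n | n - k ≤ i.1} : Set (Fin n)).domRestrict v) := by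
    have hc : Orthonormal ℝ (fun i => (c i).1) :=
      c.orthonormal.comp_linearIsometry (W.comap (horiz n)).subtypeₗᵢ
    have := hc.comp (fun i : ({i : Fin n | n - k ≤ i.1} : Set (Fin n)) =>
      (⟨i.1.1 - (n - k), by have h : n - k ≤ i.1.1 := i.2; have := i.1.2; omega⟩ : Fin k)) (by
        rintro ⟨i, hi⟩ ⟨j, hj⟩ h
        simp only [mem_ofPred_eq, Fin.mk.injEq] at h hi hj
        ext
        dsimp only
        omega)
    convert this using 1
    ext1 ⟨i, hi⟩
    simp only [domRestrict_apply, v, Function.comp]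
    exact dif_pos hi
  obtain ⟨b, hb⟩ := hv.exists_orthonormalBasis_extension_of_card_eq (by simp)
  refine ⟨b, fun i hi => ?_⟩
  rw [hb i hi]
  simp only [v, dif_pos hi]
  exact (c _).2

/-- The linear map with a given pseudo-orthonormal frame as columns. -/
def frameMap {n : ℕ} (x : HSpace n) (b : Fin n → EuclideanSpace ℝ (Fin n)) :
    (Fin (n + 1) → ℝ) →ₗ[ℝ] (Fin (n + 1) → ℝ) where
  toFun v := flip x (horiz n (∑ i, v i.castSucc • b i) + v (Fin.last n) • (x0 n).1)
  map_add' v w := by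
    rw [← map_add]; congr 1
    simp only [Pi.add_apply, add_smul, Finset.sum_add_distrib, map_add]; abel
  map_smul' c v := by
    rw [← map_smul]; congr 1
    simp only [Pi.smul_apply, smul_eq_mul, mul_smul, ← Finset.smul_sum, map_smul, smul_add,
      RingHom.id_apply]

theorem lor_frameMap {n : ℕ} (x : HSpace n) {b : Fin n → EuclideanSpace ℝ (Fin n)}
    (hb : Orthonormal ℝ b) (v w : Fin (n + 1) → ℝ) :
    lor (frameMap x b v) (frameMap x b w) = lor v w := by
  simp only [frameMap, LinearMap.coe_mk, AddHom.coe_mk, lor_flip]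
  have e : ∀ (p q : EuclideanSpace ℝ (Fin n)) (s t : ℝ),
      lor (horiz n p + s • (x0 n).1) (horiz n q + t • (x0 n).1) = s * t - inner ℝ p q := by
    intro p q s t
    rw [lor_add_left, lor_comm (horiz n p), lor_add_left, lor_smul_left, lor_smul_left,
      lor_comm (x0 n).1 (_ + _), lor_add_left, lor_smul_left, lor_horiz, lor_horiz_x0,
      lor_comm (x0 n).1, lor_horiz_x0, (x0 n).2.1, real_inner_comm]
    ring
  rw [e, hb.inner_sum]
  simp [lor]

theorem det_frameMap {n : ℕ} (x : HSpace n) {b : Fin n → EuclideanSpace ℝ (Fin n)}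
    (hb : Orthonormal ℝ b) :
    (LinearMap.toMatrix' (frameMap x b)).det * (LinearMap.toMatrix' (frameMap x b)).det = 1 := by
  set M := LinearMap.toMatrix' (frameMap x b) with hM
  let J : Matrix (Fin (n + 1)) (Fin (n + 1)) ℝ :=
    Matrix.diagonal (Fin.snoc (fun _ : Fin n => (-1 : ℝ)) (1 : ℝ) : Fin (n + 1) → ℝ)
  have hJ : ∀ v w : Fin (n + 1) → ℝ, v ⬝ᵥ J.mulVec w = lor v w := fun v w => by
    simp only [dotProduct, J, Matrix.mulVec_diagonal, Fin.sum_univ_castSucc, Fin.snoc_castSucc,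
      Fin.snoc_last, lor]
    simp only [neg_mul, mul_neg, Finset.sum_neg_distrib, one_mul]
    ring
  have hMv : ∀ v, M.mulVec v = frameMap x b v := fun v => by
    rw [hM, ← Matrix.toLin'_apply, Matrix.toLin'_toMatrix']
  have h : M.transpose * J * M = J := by
    have h1 : ∀ v w : Fin (n + 1) → ℝ, v ⬝ᵥ (M.transpose * J * M).mulVec w = v ⬝ᵥ J.mulVec w := by
      intro v w
      rw [hJ, ← Matrix.mulVec_mulVec, ← Matrix.mulVec_mulVec, Matrix.dotProduct_mulVec,
        Matrix.vecMul_transpose, hJ, hMv, hMv, lor_frameMap x hb]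
    ext i j
    simpa using h1 (Pi.single i 1) (Pi.single j 1)
  have hJ0 : J.det ≠ 0 := by
    simp [J, Matrix.det_diagonal, Fin.prod_univ_castSucc]
  have h2 := congrArg Matrix.det h
  rw [Matrix.det_mul, Matrix.det_mul, Matrix.det_transpose] at h2
  apply mul_right_cancel₀ hJ0
  linarith

/-- `G` acts transitively on `Ξ`. -/
theorem exists_move_eq {n k : ℕ} (hk : k < n) (ξ : Geod n k) :
    ∃ g : G n, move g (xi0 hk) = ξ := by
  obtain ⟨⟨x, hx⟩, V, hV, hξ⟩ := ξ.2
  rw [hξ] at hx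
  have hx : x.1 ∈ V := hx
  have hflipinj : Function.Injective (flip x) := fun v w h => by
    rw [← flip_flip x v, h, flip_flip]
  obtain ⟨b, hb⟩ := exists_frame hk (V.map (flip x))
    (by rw [(Submodule.equivMapOfInjective _ hflipinj _).finrank_eq.symm, hV])
    ⟨x.1, hx, by rw [← flip_x0, flip_flip]⟩
  have hbV : ∀ i : Fin n, n - k ≤ i.1 → flip x (horiz n (b i)) ∈ V := fun i hi => by
    obtain ⟨v, hv, hvi⟩ := hb i hi
    rw [← hvi, flip_flip]; exact hv
  -- choose the sign of the first vector so that the determinant is one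
  have key : ∃ c : Fin n → EuclideanSpace ℝ (Fin n), Orthonormal ℝ c ∧
      (∀ i : Fin n, n - k ≤ i.1 → c i = b i) ∧
      (LinearMap.toMatrix' (frameMap x c)).det = 1 := by
    rcases mul_self_eq_one_iff.mp (det_frameMap x b.orthonormal) with h | h
    · exact ⟨b, b.orthonormal, fun _ _ => rfl, h⟩
    let o : Fin n := ⟨0, by omega⟩
    let ε : Fin n → ℝ := Function.update 1 o (-1)
    have hε : ∀ i, ε i = 1 ∨ ε i = -1 := fun i => by
      by_cases hi : i = o
      · right; simp [ε, hi]
      · left; simp [ε, hi]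
    refine ⟨fun i => ε i • b i, ?_, ?_, ?_⟩
    · refine ⟨fun i => ?_, fun i j hij => ?_⟩
      · rw [norm_smul, b.orthonormal.1 i]
        rcases hε i with h | h <;> simp [h]
      · simp only [inner_smul_left, inner_smul_right]
        rw [b.orthonormal.2 hij]; simp
    · intro i hi
      have : i ≠ o := by
        rintro rfl
        simp only [o] at hi
        omega
      simp [ε, this]
    · have hcomp : frameMap x (fun i => ε i • b i) = (frameMap x b).comp
          (Matrix.toLin' (Matrix.diagonal (Fin.snoc ε (1 : ℝ) : Fin (n + 1) → ℝ))) := by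
        ext1 i
        ext1
        simp only [frameMap, LinearMap.comp_apply, LinearMap.coe_mk, AddHom.coe_mk,
          Matrix.toLin'_apply, Matrix.mulVec_diagonal, Fin.snoc_castSucc, Fin.snoc_last, one_mul,
          smul_smul, mul_comm]
      rw [hcomp, LinearMap.toMatrix'_comp, Matrix.det_mul, h, LinearMap.toMatrix'_toLin',
        Matrix.det_diagonal, Fin.prod_univ_castSucc]
      simp [ε, Finset.prod_update_of_mem]
  obtain ⟨c, hc, hcb, hdet⟩ := key
  let A : Matrix.SpecialLinearGroup (Fin (n + 1)) ℝ := ⟨_, hdet⟩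
  have hA : ∀ v, A • v = frameMap x c v := fun v => by
    change (LinearMap.toMatrix' (frameMap x c)).mulVec v = _
    rw [← Matrix.toLin'_apply, Matrix.toLin'_toMatrix']
  have hAx : frameMap x c (x0 n).1 = x.1 := by
    rw [← flip_x0 x]
    simp [frameMap, x0]
  let g : G n := ⟨A, fun v w => by rw [hA, hA, lor_frameMap x hc], fun y => by
    rw [hA]
    exact maps_sheet _ (lor_frameMap x hc) (x0 n).2 (by rw [hAx]; exact x.2.2) y.2⟩
  have hle : (LinearMap.range (embLin n k)).map (frameMap x c) ≤ V := by
    rintro _ ⟨_, ⟨y, rfl⟩, rfl⟩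
    simp only [frameMap, LinearMap.coe_mk, AddHom.coe_mk, map_add, map_sum, map_smul, flip_x0]
    refine V.add_mem (V.sum_mem fun i _ => ?_) (V.smul_mem _ hx)
    by_cases hi : n - k ≤ i.1
    · rw [hcb i hi]; exact V.smul_mem _ (hbV i hi)
    · have : embLin n k y i.castSucc = 0 := if_neg hi
      rw [this, zero_smul]
      exact V.zero_mem
  have hAinj : Function.Injective (frameMap x c) := fun v w h => by
    rw [← hA, ← hA] at h
    exact MulAction.injective A h
  have heq : (LinearMap.range (embLin n k)).map (frameMap x c) = V :=
    Submodule.eq_of_le_of_finrank_eq hle (by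
      rw [(Submodule.equivMapOfInjective _ hAinj _).finrank_eq.symm, finrank_range_embLin hk, hV])
  refine ⟨g, Subtype.ext ?_⟩
  rw [hξ, ← heq]
  ext y
  constructor
  · rintro ⟨z, hz, rfl⟩
    exact ⟨z.1, hz, (hA z.1).symm⟩
  · rintro ⟨z, hz, hzy⟩
    refine ⟨g⁻¹ • y, ?_, smul_inv_smul g y⟩
    have : (g⁻¹ • y).1 = z := by
      rw [smul_val, ← hzy, ← hA]
      exact inv_smul_smul A z
    change (g⁻¹ • y).1 ∈ LinearMap.range (embLin n k)
    rw [this]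
    exact hz

/-! ### The Radon transform -/

/-- A hyperbolic rotation `r_ξ ∈ G` with `r_ξ ξ₀ = ξ`. -/
def rot {n k : ℕ} (hk : k < n) (ξ : Geod n k) : G n := (exists_move_eq hk ξ).choose

theorem continuous_emb {n k : ℕ} (hk : k < n) : Continuous (emb hk) :=
  ((embLin n k).continuous_of_finiteDimensional.comp continuous_subtype_val).subtype_mk _

theorem continuous_smul_right {n : ℕ} (g : G n) : Continuous fun x : HSpace n => g • x := by
  refine Continuous.subtype_mk (f := fun x : HSpace n => g.1 • x.1) ?_ _
  exact (Matrix.SpecialLinearGroup.toLin' g.1).toLinearMap.continuous_of_finiteDimensional.comp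
    continuous_subtype_val

/-- The Riemannian measure `d_ξ x` of the `k`-geodesic `ξ`, as a measure on `ℍⁿ`: the image of the
Riemannian measure of `ℍᵏ ≅ ξ₀` under the isometry `r_ξ : ξ₀ → ξ`. -/
def geodVolume {n k : ℕ} (hk : k < n) (ξ : Geod n k) : Measure (HSpace n) :=
  Measure.map (fun y : HSpace k => rot hk ξ • emb hk y) (hypVolume k)

/-- The totally geodesic Radon transform `(Rf)(ξ) = ∫_ξ f(x) d_ξ x ∈ [0, ∞]` of a nonnegative
function. -/
def radon {n k : ℕ} (hk : k < n) (f : HSpace n → ℝ≥0∞) (ξ : Geod n k) : ℝ≥0∞ :=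
  ∫⁻ x, f x ∂geodVolume hk ξ

/-- `P` holds for almost all `ξ ∈ Ξ = G / H`, with respect to the `G`-invariant measure class of the
homogeneous space: the set of all `g ∈ G` for which `P` fails at `gξ₀` is a null set of the Haar
measure. -/
def ForAlmostAll {n k : ℕ} (hk : k < n) (P : Geod n k → Prop) : Prop :=
  ∀ᵐ g ∂(Measure.haar : Measure (G n)), P (move g (xi0 hk))

/-- The integral of `|f(x)| / xₙ₊₁ⁿ⁻ᵏ` over the region `xₙ₊₁ > 2`. -/
def tailIntegral {n : ℕ} (k : ℕ) (f : HSpace n → ℂ) : ℝ≥0∞ :=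
  ∫⁻ x in {x : HSpace n | 2 < height x}, ENNReal.ofReal (‖f x‖ / height x ^ (n - k)) ∂hypVolume n

/-- `f` is zonal: `f(x) = f₀(xₙ₊₁)` for some function `f₀`. -/
def IsZonal {n : ℕ} {β : Type*} (f : HSpace n → β) : Prop :=
  ∃ f₀ : ℝ → β, ∀ x, f x = f₀ (height x)

end HypSpace
end

/-!
# Existence of the totally geodesic Radon transform on hyperbolic space

The integral of a zonal function over a `k`-geodesic `ξ` depends only on `c = cosh dist(x₀, ξ)`.
If `ξ = gξ₀` and `z = g⁻¹x₀`, then the height of `gy` is `[y, z]`, and on `ξ₀ ≅ ℍᵏ` this is `c`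
times the height of `y` as seen from another origin; hence the Radon transform of `h(xₙ₊₁)` at `ξ`
is, up to the area of a sphere, `∫ h(c cosh ω) sinhᵏ⁻¹ω dω` (`lintegral_emb_lor`).

*Divergence.* The substitutions `t = cosh ω` and `t = c cosh ω` compare both the weighted integral
of `f` and its Radon transform with `∫ tᵏ⁻² h(t) dt` at infinity (`lintegral_cosh_eq_top`). A
zonal `f` need not come from a measurable profile, so a measurable minorant is used
(`exists_measurable_profile`); local integrability discards the bounded part `2 < xₙ₊₁ ≤ 2c`, on
which the two integrals cannot be compared.

*Convergence.* Let `F = |f|`. Against a weight `φ(g⁻¹x₀)` on the group, which is invariant under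
rotations about the origin, only the rotation average of `F` contributes to the integral of the
Radon transform. Inverting `g` turns the group integral into an integral over `z = g⁻¹x₀ ∈ ℍⁿ` of
the one-dimensional integral above (`exists_lintegral_haar_radon`). For `φ` take the indicator of
a bounded region that stays away from a hyperplane through `ξ₀`. There `c` ranges over an interval
`[a, R]` with `a > 1`, the distribution of `c` is bounded by Lebesgue measure, and for each `t`
the `ω` with `t / cosh ω ∈ [a, R]` lie in an interval of bounded length; so the integral is at
most a constant times `∫ tᵏ⁻² h(t) dt` over `t > a` (`lintegral_shell_lt_top`), which is finite by
hypothesis. Countably many such regions cover almost all of the group. Applied to `∞ · 1_N` with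
`N` a null set, the same argument shows that almost every geodesic meets `N` in a null set, which
passes from a Borel representative to `f` itself (`forAlmostAll_integrable`).

Two facts about `G = SO₀(n, 1)` are needed. The Riemannian measure is invariant, because it is the
cone measure: the measure of `A` is proportional to the Lebesgue measure of
`{t x : x ∈ A, 0 < t < 1}` (`lintegral_hypVolume_cone`). And `G` is unimodular, because `g`
and `g⁻¹` move the origin by the same distance, so that `g⁻¹ = κ g κ'` with rotations `κ`, `κ'` (`modularCharacterFun_eq_one`);
hence the Haar measure is invariant under inversion, and its image under `g ↦ gx₀` is a multiple
of the Riemannian measure (`exists_map_haar_eq`).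
-/

noncomputable section

namespace HypSpace

/-! ### Polar coordinates -/

theorem lintegral_euclidean_polar {n : ℕ} [NeZero n] {Φ : EuclideanSpace ℝ (Fin n) → ℝ≥0∞}
    (hΦ : Measurable Φ) :
    ∫⁻ x, Φ x = ∫⁻ ζ : Metric.sphere (0 : EuclideanSpace ℝ (Fin n)) 1,
      (∫⁻ r in Ioi (0 : ℝ), ENNReal.ofReal (r ^ (n - 1)) * Φ (r • ζ.1))
        ∂(volume : Measure (EuclideanSpace ℝ (Fin n))).toSphere := by
  have h1 : ∫⁻ x, Φ x = ∫⁻ x in ({0}ᶜ : Set (EuclideanSpace ℝ (Fin n))), Φ x := by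
    rw [restrict_compl_singleton]
  have h2 :=
    (volume : Measure (EuclideanSpace ℝ (Fin n))).measurePreserving_homeomorphUnitSphereProd
  have hdim : Module.finrank ℝ (EuclideanSpace ℝ (Fin n)) = n := by simp
  rw [hdim] at h2
  rw [h1, ← lintegral_subtype_comap (measurableSet_singleton _).compl]
  have h3 := (h2.symm (homeomorphUnitSphereProd _).toMeasurableEquiv).lintegral_comp_emb
    (MeasurableEquiv.measurableEmbedding _) (fun x => Φ x.1)
  rw [← h3]
  have hm : Measurable fun p : Metric.sphere (0 : EuclideanSpace ℝ (Fin n)) 1 × Ioi (0 : ℝ) =>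
      Φ (p.2.1 • p.1.1) := hΦ.comp (by fun_prop)
  have h4 : ∀ p : Metric.sphere (0 : EuclideanSpace ℝ (Fin n)) 1 × Ioi (0 : ℝ),
    Φ ((homeomorphUnitSphereProd (EuclideanSpace ℝ (Fin n))).toMeasurableEquiv.symm p).1
      = Φ (p.2.1 • p.1.1) := fun p => rfl
  simp_rw [h4]
  rw [lintegral_prod _ hm.aemeasurable]
  refine lintegral_congr fun ζ => ?_
  have hm' : Measurable fun r : Ioi (0 : ℝ) => Φ (r.1 • ζ.1) := hΦ.comp (by fun_prop)
  rw [Measure.volumeIoiPow, lintegral_withDensity_eq_lintegral_mul _ (by fun_prop) hm']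
  exact lintegral_subtype_comap measurableSet_Ioi
    (fun r => ENNReal.ofReal (r ^ (n - 1)) * Φ (r • ζ.1))

theorem lintegral_hypVolume {n : ℕ} {F : HSpace n → ℝ≥0∞} (hF : Measurable F) :
    ∫⁻ x, F x ∂hypVolume n = ∫⁻ ζ : Metric.sphere (0 : EuclideanSpace ℝ (Fin n)) 1,
      (∫⁻ ω in Ioi (0 : ℝ), ENNReal.ofReal (Real.sinh ω ^ (n - 1)) * F (polar (ζ, ω)))
        ∂(volume : Measure (EuclideanSpace ℝ (Fin n))).toSphere := by
  have hm : Measurable fun p : Metric.sphere (0 : EuclideanSpace ℝ (Fin n)) 1 × ℝ =>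
      F (polar p) := hF.comp continuous_polar.measurable
  rw [hypVolume, lintegral_map hF continuous_polar.measurable, lintegral_prod _ hm.aemeasurable]
  refine lintegral_congr fun ζ => ?_
  have hm' : Measurable fun ω => F (polar (ζ, ω)) := hm.comp measurable_prodMk_left
  rw [lintegral_withDensity_eq_lintegral_mul _ (by fun_prop) hm']
  rfl

theorem height_polar {n : ℕ} (p : Metric.sphere (0 : EuclideanSpace ℝ (Fin n)) 1 × ℝ) :
    height (polar p) = Real.cosh p.2 := by
  simp [height, polar]

theorem continuous_height {n : ℕ} : Continuous (height (n := n)) :=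
  (continuous_apply _).comp continuous_subtype_val

/-- The total mass of the unit sphere of `ℝⁿ`. -/
def sphereMass (n : ℕ) : ℝ≥0∞ := (volume : Measure (EuclideanSpace ℝ (Fin n))).toSphere univ

theorem sphereMass_ne_top (n : ℕ) : sphereMass n ≠ ∞ := measure_ne_top _ _

theorem sphereMass_ne_zero (n : ℕ) [NeZero n] : sphereMass n ≠ 0 := by
  rw [sphereMass, Ne, Measure.measure_univ_eq_zero]
  exact Measure.toSphere_ne_zero _

theorem lintegral_zonal {n : ℕ} {h : ℝ → ℝ≥0∞} (hh : Measurable h) :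
    ∫⁻ x, h (height x) ∂hypVolume n = sphereMass n *
      ∫⁻ ω in Ioi (0 : ℝ), ENNReal.ofReal (Real.sinh ω ^ (n - 1)) * h (Real.cosh ω) := by
  rw [lintegral_hypVolume (F := fun x => h (height x)) (hh.comp continuous_height.measurable)]
  simp only [height_polar, lintegral_const, sphereMass]
  rw [mul_comm]

/-! ### The graph and the Klein model -/

/-- The parametrization of `ℍⁿ` as a graph over `ℝⁿ`. -/
def graphPt {n : ℕ} (x : EuclideanSpace ℝ (Fin n)) : HSpace n :=
  ⟨Fin.snoc (fun i => x i) (Real.sqrt (1 + ‖x‖ ^ 2)), by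
    have h : ∑ i, x i * x i = ‖x‖ ^ 2 := by
      rw [EuclideanSpace.real_norm_sq_eq]; simp only [pow_two]
    simp only [lor, Fin.snoc_last, Fin.snoc_castSucc, h]
    rw [Real.mul_self_sqrt (by positivity)]; ring, by
    simp only [Fin.snoc_last]; positivity⟩

theorem continuous_graphPt {n : ℕ} : Continuous (graphPt (n := n)) := by
  refine Continuous.subtype_mk (continuous_pi fun i => ?_) _
  induction i using Fin.lastCases with
  | last => simp only [Fin.snoc_last]; fun_prop
  | cast i => simp only [Fin.snoc_castSucc]; fun_prop

theorem graphPt_sinh {n : ℕ} (ζ : Metric.sphere (0 : EuclideanSpace ℝ (Fin n)) 1) (ω : ℝ) :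
    graphPt (Real.sinh ω • ζ.1) = polar (ζ, ω) := by
  refine Subtype.ext (funext fun i => ?_)
  induction i using Fin.lastCases with
  | last =>
    simp only [graphPt, polar, Fin.snoc_last, norm_smul, norm_eq_of_mem_sphere, mul_one,
      Real.norm_eq_abs, sq_abs]
    rw [add_comm, ← Real.cosh_sq, Real.sqrt_sq (Real.cosh_pos _).le]
  | cast i => simp [graphPt, polar, mul_comm]

theorem image_sinh_Ioi : Real.sinh '' Ioi 0 = Ioi 0 := by
  ext r
  constructor
  · rintro ⟨ω, hω, rfl⟩; exact Real.sinh_pos_iff.2 hω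
  · intro hr
    exact ⟨Real.arsinh r, Real.arsinh_pos_iff.2 hr, Real.sinh_arsinh r⟩

/-- The Riemannian measure has density `1 / xₙ₊₁ ≤ 1` in the graph coordinates. -/
theorem lintegral_hypVolume_le_graph {n : ℕ} [NeZero n] {F : HSpace n → ℝ≥0∞} (hF : Measurable F) :
    ∫⁻ x, F x ∂hypVolume n ≤ ∫⁻ x, F (graphPt x) := by
  rw [lintegral_euclidean_polar (Φ := fun x => F (graphPt x))
    (hF.comp continuous_graphPt.measurable), lintegral_hypVolume hF]
  refine lintegral_mono fun ζ => ?_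
  have h := lintegral_image_eq_lintegral_abs_deriv_mul measurableSet_Ioi
    (fun ω _ => (Real.hasDerivAt_sinh ω).hasDerivWithinAt) Real.sinh_injective.injOn
    (s := Ioi 0) (fun r => ENNReal.ofReal (r ^ (n - 1)) * F (graphPt (r • ζ.1)))
  rw [image_sinh_Ioi] at h
  rw [h]
  refine lintegral_mono fun ω => ?_
  rw [graphPt_sinh]
  refine le_mul_of_one_le_left zero_le ?_
  rw [ENNReal.one_le_ofReal]
  exact (Real.one_le_cosh ω).trans (le_abs_self _)

/-- The parametrization of `ℍⁿ` by the points of the unit ball of `ℝⁿ` (Klein model). -/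
def kleinPt {n : ℕ} (p : EuclideanSpace ℝ (Fin n)) : HSpace n :=
  graphPt ((Real.sqrt (1 - ‖p‖ ^ 2))⁻¹ • p)

theorem measurable_kleinPt {n : ℕ} : Measurable (kleinPt (n := n)) :=
  continuous_graphPt.measurable.comp (by fun_prop)

theorem one_sub_tanh_sq (ω : ℝ) : 1 - Real.tanh ω ^ 2 = (Real.cosh ω)⁻¹ ^ 2 := by
  have := Real.cosh_pos ω
  rw [Real.tanh_eq_sinh_div_cosh]
  field_simp
  linarith [Real.cosh_sq ω]

theorem kleinPt_tanh {n : ℕ} (ζ : Metric.sphere (0 : EuclideanSpace ℝ (Fin n)) 1) (ω : ℝ) :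
    kleinPt (Real.tanh ω • ζ.1) = polar (ζ, ω) := by
  have := Real.cosh_pos ω
  rw [kleinPt, norm_smul, norm_eq_of_mem_sphere, mul_one, Real.norm_eq_abs, sq_abs,
    one_sub_tanh_sq, Real.sqrt_sq (by positivity), inv_inv, smul_smul,
    Real.tanh_eq_sinh_div_cosh, mul_div_cancel₀ _ this.ne', graphPt_sinh]

theorem image_tanh_Ioi : Real.tanh '' Ioi 0 = Ioo 0 1 := by
  ext r
  constructor
  · rintro ⟨ω, hω, rfl⟩
    have h := Real.sinh_pos_iff.2 hω
    rw [Real.tanh_eq_sinh_div_cosh]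
    exact ⟨div_pos h (Real.cosh_pos _), (div_lt_one (Real.cosh_pos _)).2 (Real.sinh_lt_cosh ω)⟩
  · intro hr
    exact ⟨Real.artanh r, Real.artanh_pos hr, Real.tanh_artanh ⟨by linarith [hr.1], hr.2⟩⟩

theorem hasDerivAt_tanh (ω : ℝ) : HasDerivAt Real.tanh ((Real.cosh ω)⁻¹ ^ 2) ω := by
  have h := (Real.hasDerivAt_sinh ω).div (Real.hasDerivAt_cosh ω) (Real.cosh_pos ω).ne'
  have h1 : Real.tanh = fun x => Real.sinh x / Real.cosh x :=
    funext Real.tanh_eq_sinh_div_cosh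
  rw [h1]
  convert! h using 1
  have := Real.cosh_pos ω
  field_simp
  linarith [Real.cosh_sq ω]

/-- The Riemannian measure in the Klein model, by the substitution `r = tanh ω`. -/
theorem lintegral_hypVolume_klein {n : ℕ} [NeZero n] {F : HSpace n → ℝ≥0∞} (hF : Measurable F) :
    ∫⁻ x, F x ∂hypVolume n = ∫⁻ p in Metric.ball (0 : EuclideanSpace ℝ (Fin n)) 1,
      ENNReal.ofReal ((Real.sqrt (1 - ‖p‖ ^ 2))⁻¹ ^ (n + 1)) * F (kleinPt p) := by
  have hm : Measurable fun p : EuclideanSpace ℝ (Fin n) =>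
      ENNReal.ofReal ((Real.sqrt (1 - ‖p‖ ^ 2))⁻¹ ^ (n + 1)) * F (kleinPt p) :=
    Measurable.mul (by fun_prop) (hF.comp measurable_kleinPt)
  rw [← lintegral_indicator Metric.isOpen_ball.measurableSet,
    lintegral_euclidean_polar (hm.indicator Metric.isOpen_ball.measurableSet),
    lintegral_hypVolume hF]
  refine lintegral_congr fun ζ => ?_
  have h1 : ∀ r ∈ Ioi (0 : ℝ), ENNReal.ofReal (r ^ (n - 1)) *
      (Metric.ball (0 : EuclideanSpace ℝ (Fin n)) 1).indicator (fun p =>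
      ENNReal.ofReal ((Real.sqrt (1 - ‖p‖ ^ 2))⁻¹ ^ (n + 1)) * F (kleinPt p)) (r • ζ.1)
      = (Ioo (0 : ℝ) 1).indicator (fun r => ENNReal.ofReal (r ^ (n - 1)) *
        (ENNReal.ofReal ((Real.sqrt (1 - r ^ 2))⁻¹ ^ (n + 1)) * F (kleinPt (r • ζ.1)))) r := by
    intro r hr
    have hr0 : 0 < r := hr
    have hn : ‖r • ζ.1‖ = r := by
      rw [norm_smul, norm_eq_of_mem_sphere, mul_one, Real.norm_of_nonneg hr0.le]
    by_cases h : r < 1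
    · rw [indicator_of_mem (by simpa [hn] using h), indicator_of_mem (mem_Ioo.2 ⟨hr0, h⟩), hn]
    · rw [indicator_of_notMem (by simpa [hn] using h), indicator_of_notMem (fun h' => h h'.2),
        mul_zero]
  rw [setLIntegral_congr_fun measurableSet_Ioi h1, setLIntegral_indicator measurableSet_Ioo,
    inter_eq_left.2 (Ioo_subset_Ioi_self : Ioo (0 : ℝ) 1 ⊆ Ioi 0), ← image_tanh_Ioi,
    lintegral_image_eq_lintegral_abs_deriv_mul measurableSet_Ioi
    (fun ω _ => (hasDerivAt_tanh ω).hasDerivWithinAt) Real.tanh_injective.injOn]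
  refine setLIntegral_congr_fun measurableSet_Ioi fun ω hω => ?_
  have hc := Real.cosh_pos ω
  have hs := Real.sinh_pos_iff.2 hω
  rw [kleinPt_tanh, ← mul_assoc, ← mul_assoc, one_sub_tanh_sq, Real.sqrt_sq (by positivity),
    inv_inv, abs_of_pos (by positivity), ← ENNReal.ofReal_mul (by positivity),
    ← ENNReal.ofReal_mul (by rw [Real.tanh_eq_sinh_div_cosh]; positivity)]
  congr 2
  obtain ⟨m, rfl⟩ : ∃ m, n = m + 1 := ⟨n - 1, by have := NeZero.ne n; omega⟩
  rw [Real.tanh_eq_sinh_div_cosh, Nat.add_sub_cancel, div_pow]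
  field_simp
  ring

/-! ### Invariance of the Riemannian measure -/

theorem lintegral_fin_snoc {n : ℕ} {Φ : (Fin (n + 1) → ℝ) → ℝ≥0∞} (hΦ : Measurable Φ) :
    ∫⁻ v, Φ v = ∫⁻ z : ℝ, ∫⁻ x : EuclideanSpace ℝ (Fin n), Φ (Fin.snoc (fun i => x i) z) := by
  have h1 := (volume_preserving_piFinSuccAbove (fun _ : Fin (n + 1) => ℝ) (Fin.last n)).symm
  have hm : Measurable fun q : ℝ × (Fin n → ℝ) =>
      Φ ((MeasurableEquiv.piFinSuccAbove (fun _ : Fin (n + 1) => ℝ) (Fin.last n)).symm q) :=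
    hΦ.comp (MeasurableEquiv.measurable _)
  rw [← h1.lintegral_comp_emb (MeasurableEquiv.measurableEmbedding _),
    Measure.volume_eq_prod, lintegral_prod _ hm.aemeasurable]
  refine lintegral_congr fun z => ?_
  rw [← (PiLp.volume_preserving_ofLp (Fin n)).lintegral_comp_emb
    (MeasurableEquiv.toLp 2 (Fin n → ℝ)).symm.measurableEmbedding]
  refine lintegral_congr fun x => ?_
  congr 1
  exact Fin.insertNth_last' _ _

/-- The part of the solid future cone below the hyperboloid: `{t x : x ∈ ℍⁿ, 0 < t < 1}`. -/
def solidCone (n : ℕ) : Set (Fin (n + 1) → ℝ) :=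
  {v | 0 < lor v v ∧ lor v v < 1 ∧ 0 < v (Fin.last n)}

/-- The radial projection of the solid future cone onto `ℍⁿ` (with irrelevant values elsewhere). -/
def normalize {n : ℕ} (v : Fin (n + 1) → ℝ) : HSpace n :=
  graphPt ((Real.sqrt (lor v v))⁻¹ • WithLp.toLp 2 fun i : Fin n => v i.castSucc)

theorem measurable_lor_self {n : ℕ} : Measurable fun v : Fin (n + 1) → ℝ => lor v v :=
  (continuous_lor continuous_id continuous_id).measurable

theorem measurable_normalize {n : ℕ} : Measurable (normalize (n := n)) := by
  refine continuous_graphPt.measurable.comp ?_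
  refine Measurable.smul measurable_lor_self.sqrt.inv ?_
  exact (PiLp.continuous_toLp 2 _).measurable.comp (by fun_prop)

theorem measurableSet_solidCone (n : ℕ) : MeasurableSet (solidCone n) :=
  (measurableSet_lt measurable_const measurable_lor_self).inter
    ((measurableSet_lt measurable_lor_self measurable_const).inter
      (measurableSet_lt measurable_const (measurable_pi_apply _)))

theorem lor_smul_smul {n : ℕ} (c : ℝ) (v : Fin (n + 1) → ℝ) :
    lor (c • v) (c • v) = c ^ 2 * lor v v := by
  rw [lor_smul_left, lor_comm, lor_smul_left]; ring

theorem normalize_val {n : ℕ} {v : Fin (n + 1) → ℝ} (h : 0 < lor v v) (hv : 0 < v (Fin.last n)) :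
    (normalize v).1 = (Real.sqrt (lor v v))⁻¹ • v := by
  have hs := Real.sqrt_pos.2 h
  ext i
  induction i using Fin.lastCases with
  | last =>
    have h1 : ‖(WithLp.toLp 2 fun i : Fin n => v i.castSucc : EuclideanSpace ℝ (Fin n))‖ ^ 2
        = v (Fin.last n) ^ 2 - lor v v := by
      rw [EuclideanSpace.real_norm_sq_eq]; simp only [lor, pow_two]; ring
    simp only [normalize, graphPt, Fin.snoc_last, norm_smul, mul_pow, h1, Pi.smul_apply,
      smul_eq_mul, norm_inv, inv_pow, Real.norm_eq_abs, sq_abs, Real.sq_sqrt h.le]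
    have h2 : 1 + (lor v v)⁻¹ * (v (Fin.last n) ^ 2 - lor v v)
        = ((Real.sqrt (lor v v))⁻¹ * v (Fin.last n)) ^ 2 := by
      rw [mul_pow, inv_pow, Real.sq_sqrt h.le]; field_simp; ring
    rw [h2, Real.sqrt_sq (by positivity)]
  | cast i => simp [normalize, graphPt]

theorem lor_snoc {n : ℕ} (x : EuclideanSpace ℝ (Fin n)) (z : ℝ) :
    lor (Fin.snoc (fun i => x i) z : Fin (n + 1) → ℝ) (Fin.snoc (fun i => x i) z : Fin (n + 1) → ℝ)
      = z ^ 2 - ‖x‖ ^ 2 := by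
  rw [EuclideanSpace.real_norm_sq_eq]; simp [lor, pow_two]

theorem normalize_snoc_smul {n : ℕ} (p : EuclideanSpace ℝ (Fin n)) {z : ℝ} (hz : 0 < z) :
    normalize (Fin.snoc (fun i => (z • p) i) z : Fin (n + 1) → ℝ) = kleinPt p := by
  have h : z ^ 2 - ‖z • p‖ ^ 2 = z ^ 2 * (1 - ‖p‖ ^ 2) := by
    rw [norm_smul, mul_pow, Real.norm_eq_abs, sq_abs]; ring
  rw [normalize, lor_snoc, h, Real.sqrt_mul (by positivity), Real.sqrt_sq hz.le, kleinPt]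
  have h1 : (WithLp.toLp 2 fun i : Fin n =>
      (Fin.snoc (fun i => (z • p) i) z : Fin (n + 1) → ℝ) i.castSucc)
      = z • p := by ext i; simp
  rw [h1, smul_smul, mul_inv, mul_right_comm, inv_mul_cancel₀ hz.ne', one_mul]

theorem lintegral_pow_Ioo (n : ℕ) {c : ℝ} (hc : 0 ≤ c) :
    ∫⁻ z in Ioo 0 c, ENNReal.ofReal (z ^ n) = ENNReal.ofReal (c ^ (n + 1) / (n + 1)) := by
  rw [restrict_Ioo_eq_restrict_Ioc, ← ofReal_integral_eq_lintegral_ofReal,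
    ← intervalIntegral.integral_of_le hc, integral_pow]
  · simp
  · exact (continuous_pow n).integrableOn_Ioc
  · filter_upwards [ae_restrict_mem measurableSet_Ioc] with z hz using pow_nonneg hz.1.le n

/-- The Riemannian measure as a cone measure: up to the factor `n + 1`, the measure of `A ⊆ ℍⁿ` is
the Lebesgue measure of `{t x : x ∈ A, 0 < t < 1}`. -/
theorem lintegral_hypVolume_cone {n : ℕ} [NeZero n] {F : HSpace n → ℝ≥0∞} (hF : Measurable F) :
    ∫⁻ v in solidCone n, F (normalize v) =
      ENNReal.ofReal (1 / (n + 1)) * ∫⁻ x, F x ∂hypVolume n := by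
  have hm : Measurable fun v : Fin (n + 1) → ℝ => F (normalize v) := hF.comp measurable_normalize
  rw [← lintegral_indicator (measurableSet_solidCone n),
    lintegral_fin_snoc (hm.indicator (measurableSet_solidCone n))]
  -- for a fixed last coordinate `z > 0` substitute `x = z p`
  have h1 : ∀ z : ℝ, ∫⁻ x : EuclideanSpace ℝ (Fin n),
      (solidCone n).indicator (fun v => F (normalize v)) (Fin.snoc (fun i => x i) z)
      = ∫⁻ p in Metric.ball (0 : EuclideanSpace ℝ (Fin n)) 1,
        (Ioo 0 (Real.sqrt (1 - ‖p‖ ^ 2))⁻¹).indicator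
        (fun z => ENNReal.ofReal (z ^ n)) z * F (kleinPt p) := by
    intro z
    by_cases hz : 0 < z
    · have h2 := (Measure.map_addHaar_smul (volume : Measure (EuclideanSpace ℝ (Fin n)))
        (r := z) hz.ne')
      have hm2 : Measurable fun x : EuclideanSpace ℝ (Fin n) =>
          (solidCone n).indicator (fun v => F (normalize v)) (Fin.snoc (fun i => x i) z) := by
        refine (hm.indicator (measurableSet_solidCone n)).comp (measurable_pi_lambda _ fun i => ?_)
        induction i using Fin.lastCases with
        | last => simp only [Fin.snoc_last]; fun_prop
        | cast i => simp only [Fin.snoc_castSucc]; fun_prop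
      have h3 : (volume : Measure (EuclideanSpace ℝ (Fin n))) = ENNReal.ofReal (z ^ n) •
          Measure.map (z • ·) (volume : Measure (EuclideanSpace ℝ (Fin n))) := by
        rw [h2, smul_smul, finrank_euclideanSpace_fin, abs_of_pos (by positivity),
          ← ENNReal.ofReal_mul (by positivity), mul_inv_cancel₀ (by positivity), ENNReal.ofReal_one,
          one_smul]
      rw [h3, lintegral_smul_measure, lintegral_map hm2 (by fun_prop), ← h3, smul_eq_mul,
        ← lintegral_const_mul' _ _ ENNReal.ofReal_ne_top,
        ← lintegral_indicator Metric.isOpen_ball.measurableSet]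
      refine lintegral_congr fun p => ?_
      have hl : lor (Fin.snoc (fun i => (z • p) i) z : Fin (n + 1) → ℝ)
          (Fin.snoc (fun i => (z • p) i) z : Fin (n + 1) → ℝ) = z ^ 2 * (1 - ‖p‖ ^ 2) := by
        rw [lor_snoc, norm_smul, mul_pow, Real.norm_eq_abs, sq_abs]; ring
      have hz2 : 0 < z ^ 2 := by positivity
      by_cases hp : p ∈ Metric.ball (0 : EuclideanSpace ℝ (Fin n)) 1
      · rw [indicator_of_mem hp]
        have hp1 : 0 < 1 - ‖p‖ ^ 2 := by
          have : ‖p‖ < 1 := by simpa using hp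
          nlinarith [norm_nonneg p]
        have hsq := Real.sqrt_pos.2 hp1
        by_cases hzp : z < (Real.sqrt (1 - ‖p‖ ^ 2))⁻¹
        · have hin : (Fin.snoc (fun i => (z • p) i) z : Fin (n + 1) → ℝ) ∈ solidCone n := by
            refine ⟨by rw [hl]; positivity, ?_, by simpa using hz⟩
            rw [hl]
            have : z * Real.sqrt (1 - ‖p‖ ^ 2) < 1 := by
              rwa [lt_inv_comm₀ hz hsq, inv_eq_one_div, lt_div_iff₀ hz, mul_comm] at hzp
            calc z ^ 2 * (1 - ‖p‖ ^ 2) = (z * Real.sqrt (1 - ‖p‖ ^ 2)) ^ 2 := by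
                  rw [mul_pow, Real.sq_sqrt hp1.le]
              _ < 1 := pow_lt_one₀ (by positivity) this two_ne_zero
          rw [indicator_of_mem hin, indicator_of_mem (mem_Ioo.2 ⟨hz, hzp⟩),
            normalize_snoc_smul p hz]
        · have hin : (Fin.snoc (fun i => (z • p) i) z : Fin (n + 1) → ℝ) ∉ solidCone n := by
            rintro ⟨-, h, -⟩
            rw [hl] at h
            have : 1 ≤ z * Real.sqrt (1 - ‖p‖ ^ 2) := by
              rwa [not_lt, inv_eq_one_div, div_le_iff₀ hsq] at hzp
            have h4 : z ^ 2 * (1 - ‖p‖ ^ 2) = (z * Real.sqrt (1 - ‖p‖ ^ 2)) ^ 2 := by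
                  rw [mul_pow, Real.sq_sqrt hp1.le]
            nlinarith
          rw [indicator_of_notMem hin, indicator_of_notMem (fun h => hzp h.2), mul_zero, zero_mul]
      · have hin : (Fin.snoc (fun i => (z • p) i) z : Fin (n + 1) → ℝ) ∉ solidCone n := by
          rintro ⟨h, -, -⟩
          rw [hl] at h
          apply hp
          have h5 := pos_of_mul_pos_right h hz2.le
          simp only [mem_ball_zero_iff]
          nlinarith [norm_nonneg p]
        rw [indicator_of_notMem hp, indicator_of_notMem hin, mul_zero]
    · have h2 : ∀ x : EuclideanSpace ℝ (Fin n), (solidCone n).indicator (fun v => F (normalize v))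
          (Fin.snoc (fun i => x i) z : Fin (n + 1) → ℝ) = 0 := fun x =>
        indicator_of_notMem (fun h => hz (by simpa using h.2.2)) _
      have h3 : ∀ p : EuclideanSpace ℝ (Fin n), (Ioo 0 (Real.sqrt (1 - ‖p‖ ^ 2))⁻¹).indicator
          (fun z => ENNReal.ofReal (z ^ n)) z = 0 := fun p =>
        indicator_of_notMem (fun h => hz h.1) _
      simp [h2, h3]
  simp_rw [h1]
  rw [lintegral_lintegral_swap, lintegral_hypVolume_klein hF,
    ← lintegral_const_mul' _ _ ENNReal.ofReal_ne_top]
  · refine setLIntegral_congr_fun Metric.isOpen_ball.measurableSet fun p hp => ?_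
    have hi : Measurable ((Ioo 0 (Real.sqrt (1 - ‖p‖ ^ 2))⁻¹).indicator
        fun z => ENNReal.ofReal (z ^ n)) := Measurable.indicator (by fun_prop) measurableSet_Ioo
    rw [lintegral_mul_const _ hi, lintegral_indicator measurableSet_Ioo, ← mul_assoc,
      ← ENNReal.ofReal_mul (by positivity), lintegral_pow_Ioo _ (by positivity)]
    congr 2
    ring
  · refine Measurable.aemeasurable (Measurable.mul ?_ ?_)
    · have hS : MeasurableSet {q : ℝ × EuclideanSpace ℝ (Fin n) |
          0 < q.1 ∧ q.1 < (Real.sqrt (1 - ‖q.2‖ ^ 2))⁻¹} :=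
        (measurableSet_lt measurable_const measurable_fst).inter (measurableSet_lt measurable_fst
          (by fun_prop : Measurable fun q : ℝ × EuclideanSpace ℝ (Fin n) =>
            (Real.sqrt (1 - ‖q.2‖ ^ 2))⁻¹))
      exact Measurable.indicator (f := fun q : ℝ × EuclideanSpace ℝ (Fin n) =>
        ENNReal.ofReal (q.1 ^ n)) (by fun_prop) hS
    · exact hF.comp (measurable_kleinPt.comp measurable_snd)

theorem exists_signature_matrix (n : ℕ) : ∃ J : Matrix (Fin (n + 1)) (Fin (n + 1)) ℝ, J.det ≠ 0 ∧
    ∀ v w : Fin (n + 1) → ℝ, v ⬝ᵥ J.mulVec w = lor v w := by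
  refine ⟨Matrix.diagonal (Fin.snoc (fun _ : Fin n => (-1 : ℝ)) (1 : ℝ) : Fin (n + 1) → ℝ), ?_,
    fun v w => ?_⟩
  · simp [Matrix.det_diagonal, Fin.prod_univ_castSucc]
  · simp only [dotProduct, Matrix.mulVec_diagonal, Fin.sum_univ_castSucc, Fin.snoc_castSucc,
      Fin.snoc_last, lor]
    simp only [neg_mul, mul_neg, Finset.sum_neg_distrib, one_mul]
    ring

theorem abs_det_of_lor {n : ℕ} (A : (Fin (n + 1) → ℝ) →ₗ[ℝ] (Fin (n + 1) → ℝ))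
    (hA : ∀ x y, lor (A x) (A y) = lor x y) : |LinearMap.det A| = 1 := by
  obtain ⟨J, hJ0, hJ⟩ := exists_signature_matrix n
  set M := LinearMap.toMatrix' A with hM
  have hMv : ∀ v, M.mulVec v = A v := fun v => by
    rw [hM, ← Matrix.toLin'_apply, Matrix.toLin'_toMatrix']
  have h : M.transpose * J * M = J := by
    have h1 : ∀ v w : Fin (n + 1) → ℝ, v ⬝ᵥ (M.transpose * J * M).mulVec w = v ⬝ᵥ J.mulVec w := by
      intro v w
      rw [hJ, ← Matrix.mulVec_mulVec, ← Matrix.mulVec_mulVec, Matrix.dotProduct_mulVec,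
        Matrix.vecMul_transpose, hJ, hMv, hMv, hA]
    ext i j
    simpa using h1 (Pi.single i 1) (Pi.single j 1)
  have h2 := congrArg Matrix.det h
  rw [Matrix.det_mul, Matrix.det_mul, Matrix.det_transpose] at h2
  have h3 : LinearMap.det A * LinearMap.det A = 1 := by
    rw [← LinearMap.det_toMatrix', ← hM]
    apply mul_right_cancel₀ hJ0
    linarith
  rcases mul_self_eq_one_iff.mp h3 with h | h <;> simp [h]

/-- The Riemannian measure is invariant under the linear isometries of `ℍⁿ`: these have determinant
`±1` and preserve the solid cone. -/
theorem lintegral_hypVolume_comp {n : ℕ} [NeZero n] (A : (Fin (n + 1) → ℝ) →ₗ[ℝ] (Fin (n + 1) → ℝ))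
    (hA : ∀ x y, lor (A x) (A y) = lor x y) {α : HSpace n → HSpace n}
    (hα : ∀ x, (α x).1 = A x.1) {F : HSpace n → ℝ≥0∞} (hF : Measurable F) :
    ∫⁻ x, F (α x) ∂hypVolume n = ∫⁻ x, F x ∂hypVolume n := by
  have hdet := abs_det_of_lor A hA
  have hdet0 : LinearMap.det A ≠ 0 := by
    intro h
    rw [h] at hdet
    simp at hdet
  have hAc : Continuous A := A.continuous_of_finiteDimensional
  have hαm : Measurable α := by
      have h1 : Measurable fun x => (α x).1 := by
        simp_rw [hα]
        exact hAc.measurable.comp measurable_subtype_coe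
      exact h1.subtype_mk (h := fun x => (α x).2)
  have hα0 : 0 < A (x0 n).1 (Fin.last n) := by rw [← hα]; exact (α _).2.2
  have hlast : ∀ v : Fin (n + 1) → ℝ, 0 < lor v v →
      (0 < A v (Fin.last n) ↔ 0 < v (Fin.last n)) := by
    have key : ∀ v : Fin (n + 1) → ℝ, 0 < lor v v → 0 < v (Fin.last n) → 0 < A v (Fin.last n) := by
      intro v hv hl
      have h1 := (α (normalize v)).2.2
      rw [hα, normalize_val hv hl, map_smul] at h1
      exact pos_of_mul_pos_right h1 (by positivity)
    intro v hv
    refine ⟨fun h => ?_, key v hv⟩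
    by_contra hneg
    have hne : v (Fin.last n) ≠ 0 := by
      intro h0
      rw [lor, h0] at hv
      have := Finset.sum_nonneg (s := Finset.univ)
        fun (i : Fin n) _ => mul_self_nonneg (v i.castSucc)
      linarith
    have hlt : v (Fin.last n) < 0 := lt_of_le_of_ne (not_lt.mp hneg) hne
    have h3 := key ((-1 : ℝ) • v) (by rw [lor_smul_smul]; simpa using hv) (by simpa using hlt)
    rw [map_smul] at h3
    simp at h3
    linarith
  have hmem : ∀ v, A v ∈ solidCone n ↔ v ∈ solidCone n := by
    intro v
    simp only [solidCone, mem_ofPred_eq, hA]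
    constructor
    · rintro ⟨h1, h2, h3⟩; exact ⟨h1, h2, (hlast v h1).1 h3⟩
    · rintro ⟨h1, h2, h3⟩; exact ⟨h1, h2, (hlast v h1).2 h3⟩
  have hN : ∀ v ∈ solidCone n, normalize (A v) = α (normalize v) := by
    rintro v ⟨h1, h2, h3⟩
    apply Subtype.ext
    rw [hα, normalize_val h1 h3, normalize_val (by rwa [hA]) ((hlast v h1).2 h3), hA, map_smul]
  have h0 : ENNReal.ofReal (1 / (n + 1)) ≠ 0 := by
    rw [Ne, ENNReal.ofReal_eq_zero, not_le]; positivity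
  rw [← ENNReal.mul_right_inj h0 ENNReal.ofReal_ne_top, ← lintegral_hypVolume_cone hF,
    ← lintegral_hypVolume_cone (F := fun x => F (α x)) (hF.comp hαm)]
  have hmap : Measure.map A (volume : Measure (Fin (n + 1) → ℝ)) = volume := by
    rw [Measure.map_linearMap_addHaar_eq_smul_addHaar _ hdet0, abs_inv, hdet]; simp
  have hm : Measurable fun v : Fin (n + 1) → ℝ => F (normalize v) := hF.comp measurable_normalize
  rw [← lintegral_indicator (measurableSet_solidCone n),
    ← lintegral_indicator (measurableSet_solidCone n)]
  conv_rhs => rw [← hmap, lintegral_map (hm.indicator (measurableSet_solidCone n)) hAc.measurable]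
  refine lintegral_congr fun v => ?_
  by_cases hv : v ∈ solidCone n
  · rw [indicator_of_mem hv, indicator_of_mem ((hmem v).2 hv), hN v hv]
  · rw [indicator_of_notMem hv, indicator_of_notMem (fun h => hv ((hmem v).1 h))]

/-! ### Zonal functions on `k`-geodesics -/

theorem lor_x0_right {n : ℕ} (v : Fin (n + 1) → ℝ) : lor v (x0 n).1 = v (Fin.last n) := by
  simp [lor, x0]

/-- The coordinates of a vector in `E^{k,1}`. -/
def coordProj {n k : ℕ} (hk : k < n) : (Fin (n + 1) → ℝ) →ₗ[ℝ] (Fin (k + 1) → ℝ) where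
  toFun v j := v ⟨j.1 + (n - k), by omega⟩
  map_add' v w := rfl
  map_smul' c v := rfl

theorem coordProj_embLin {n k : ℕ} (hk : k < n) (y : Fin (k + 1) → ℝ) :
    coordProj hk (embLin n k y) = y := by
  ext j
  simp only [coordProj, embLin, LinearMap.coe_mk, AddHom.coe_mk]
  rw [if_pos (by omega)]
  congr 1
  ext
  simp

theorem coordProj_last {n k : ℕ} (hk : k < n) (v : Fin (n + 1) → ℝ) :
    coordProj hk v (Fin.last k) = v (Fin.last n) := by
  simp only [coordProj, LinearMap.coe_mk, AddHom.coe_mk]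
  congr 1
  ext
  simp only [Fin.val_last]
  omega

/-- The squared Euclidean norm of the component of `v` orthogonal to `E^{k,1}`. -/
def normalSq {n : ℕ} (k : ℕ) (v : Fin (n + 1) → ℝ) : ℝ :=
  ∑ i : Fin n, if i.1 < n - k then v i.castSucc ^ 2 else 0

theorem normalSq_nonneg {n : ℕ} (k : ℕ) (v : Fin (n + 1) → ℝ) : 0 ≤ normalSq k v :=
  Finset.sum_nonneg fun i _ => by split_ifs <;> positivity

theorem lor_embLin_left {n k : ℕ} (hk : k < n) (y : Fin (k + 1) → ℝ) (v : Fin (n + 1) → ℝ) :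
    lor (embLin n k y) v = lor y (coordProj hk v) := by
  unfold lor
  rw [embLin_last hk, coordProj_last]
  congr 1
  obtain ⟨m, rfl⟩ : ∃ m, n = m + k := ⟨n - k, by omega⟩
  rw [Fin.sum_univ_add]
  have h1 : ∀ i : Fin m, embLin (m + k) k y (Fin.castAdd k i).castSucc = 0 := fun i => by
    simp [embLin]
  have h2 : ∀ i : Fin k, embLin (m + k) k y (Fin.natAdd m i).castSucc
      * v (Fin.natAdd m i).castSucc = y i.castSucc * coordProj hk v i.castSucc := fun i => by
    simp only [embLin, coordProj, LinearMap.coe_mk, AddHom.coe_mk, Fin.val_castSucc, Fin.val_natAdd,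
      add_tsub_cancel_right]
    rw [if_pos (by omega)]
    congr 2 <;> ext <;> simp [add_comm]
  simp only [h1, h2, zero_mul, Finset.sum_const_zero, zero_add]

theorem lor_coordProj {n k : ℕ} (hk : k < n) (v : Fin (n + 1) → ℝ) :
    lor (coordProj hk v) (coordProj hk v) = lor v v + normalSq k v := by
  unfold lor normalSq
  rw [coordProj_last]
  obtain ⟨m, rfl⟩ : ∃ m, n = m + k := ⟨n - k, by omega⟩
  rw [Fin.sum_univ_add, Fin.sum_univ_add]
  have h2 : ∀ i : Fin k, coordProj hk v i.castSucc = v (Fin.natAdd m i).castSucc := fun i => by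
    simp only [coordProj, LinearMap.coe_mk, AddHom.coe_mk]
    congr 1; ext; simp [add_comm]
  simp [h2, pow_two]
  ring

/-- The hyperbolic cosine of the distance from `z ∈ ℍⁿ` to `ξ₀`. -/
def coshDist {n : ℕ} (k : ℕ) (z : HSpace n) : ℝ := Real.sqrt (1 + normalSq k z.1)

theorem one_le_coshDist {n : ℕ} (k : ℕ) (z : HSpace n) : 1 ≤ coshDist k z := by
  rw [coshDist, Real.one_le_sqrt]
  linarith [normalSq_nonneg k z.1]

theorem coshDist_le_height {n k : ℕ} (hk : k < n) (z : HSpace n) : coshDist k z ≤ height z := by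
  rw [coshDist, height, Real.sqrt_le_left z.2.2.le]
  have h := lor_coordProj hk z.1
  rw [z.2.1, lor, coordProj_last] at h
  have := Finset.sum_nonneg (s := Finset.univ)
    fun (i : Fin k) _ => mul_self_nonneg (coordProj hk z.1 i.castSucc)
  rw [pow_two]
  linarith

/-- On `ξ₀ ≅ ℍᵏ` the function `y ↦ [y, z]` only sees the component of `z` in `E^{k,1}`, which is
`coshDist k z` times a point of `ℍᵏ`. -/
theorem exists_lor_emb {n k : ℕ} (hk : k < n) (z : HSpace n) :
    ∃ w : HSpace k, ∀ y : HSpace k, lor (emb hk y).1 z.1 = coshDist k z * lor y.1 w.1 := by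
  have hl := lor_coordProj hk z.1
  rw [z.2.1] at hl
  have hpos : 0 < lor (coordProj hk z.1) (coordProj hk z.1) := by
    rw [hl]; linarith [normalSq_nonneg k z.1]
  refine ⟨normalize (coordProj hk z.1), fun y => ?_⟩
  have hs := Real.sqrt_pos.2 hpos
  rw [normalize_val hpos (by rw [coordProj_last]; exact z.2.2), lor_comm y.1, lor_smul_left,
    ← mul_assoc, coshDist, ← hl, mul_inv_cancel₀ hs.ne', one_mul, lor_comm _ y.1]
  exact lor_embLin_left hk y.1 z.1

/-- The isometry `flip w` moves `w` to the origin. -/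
theorem lintegral_lor {n : ℕ} [NeZero n] {h : ℝ → ℝ≥0∞} (hh : Measurable h) (w : HSpace n) :
    ∫⁻ y : HSpace n, h (lor y.1 w.1) ∂hypVolume n = ∫⁻ y, h (height y) ∂hypVolume n := by
  have hpos : ∀ y : HSpace n, 0 < flip w y.1 (Fin.last n) := fun y =>
    maps_sheet (flip w) (lor_flip w) (x0 n).2 (by rw [flip_x0]; exact w.2.2) y.2
  have hm : Measurable fun y : HSpace n => h (lor y.1 w.1) :=
    hh.comp (continuous_lor continuous_subtype_val continuous_const).measurable
  rw [← lintegral_hypVolume_comp (flip w) (lor_flip w)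
    (α := fun y => ⟨flip w y.1, by rw [lor_flip]; exact y.2.1, hpos y⟩) (fun y => rfl) hm]
  refine lintegral_congr fun y => ?_
  conv_lhs => rw [← flip_x0 w]
  rw [lor_flip, lor_x0_right]
  rfl

/-- The Radon transform of a zonal function, transported to `ξ₀`: if `z = g⁻¹x₀`, then `[y, z]` is
the height of `gy`. -/
theorem lintegral_emb_lor {n k : ℕ} [NeZero k] (hk : k < n) {h : ℝ → ℝ≥0∞} (hh : Measurable h)
    (z : HSpace n) :
    ∫⁻ y, h (lor (emb hk y).1 z.1) ∂hypVolume k = sphereMass k *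
      ∫⁻ ω in Ioi (0 : ℝ), ENNReal.ofReal (Real.sinh ω ^ (k - 1)) *
        h (coshDist k z * Real.cosh ω) := by
  obtain ⟨w, hw⟩ := exists_lor_emb hk z
  have hm : Measurable fun t => h (coshDist k z * t) := hh.comp (by fun_prop)
  simp_rw [hw]
  rw [lintegral_lor hm w, lintegral_zonal hm]

/-- The points of `ℍᵏ` span `ℝᵏ⁺¹`. -/
theorem submodule_eq_top_of_hSpace {k : ℕ} (S : Submodule ℝ (Fin (k + 1) → ℝ))
    (hS : ∀ y : HSpace k, y.1 ∈ S) : S = ⊤ := by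
  refine eq_top_iff.2 fun y _ => ?_
  set q := ∑ i : Fin k, y i.castSucc * y i.castSucc with hq
  have hq0 : 0 ≤ q := Finset.sum_nonneg fun i _ => mul_self_nonneg _
  set N := |y (Fin.last k)| + q + 1 with hN
  set v := y + N • (x0 k).1 with hv
  have hvl : v (Fin.last k) = y (Fin.last k) + N := by simp [hv, x0]
  have hl : q + 1 ≤ v (Fin.last k) := by rw [hvl, hN]; linarith [neg_abs_le (y (Fin.last k))]
  have hvv : 0 < lor v v := by
    have : ∀ i : Fin k, v i.castSucc = y i.castSucc := fun i => by simp [hv, x0]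
    simp only [lor, this, ← hq]
    nlinarith
  have h1 : v = Real.sqrt (lor v v) • (normalize v).1 := by
    rw [normalize_val hvv (by linarith), smul_smul, mul_inv_cancel₀ (Real.sqrt_pos.2 hvv).ne',
      one_smul]
  have h2 : y = v - N • (x0 k).1 := by simp [hv]
  rw [h2, h1]
  exact S.sub_mem (S.smul_mem _ (hS _)) (S.smul_mem _ (hS _))

/-- The measure on a `k`-geodesic `gξ₀` may be computed with any `g`, not just with the chosen
representative: two choices differ by an isometry of `ℍᵏ`. -/
theorem lintegral_geodVolume_move {n k : ℕ} [NeZero k] (hk : k < n) (g : G n)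
    {F : HSpace n → ℝ≥0∞} (hF : Measurable F) :
    ∫⁻ x, F x ∂geodVolume hk (move g (xi0 hk)) = ∫⁻ y, F (g • emb hk y) ∂hypVolume k := by
  set r := rot hk (move g (xi0 hk)) with hr
  have hrg : move r (xi0 hk) = move g (xi0 hk) := (exists_move_eq hk _).choose_spec
  have hm : ∀ g : G n, Measurable fun y : HSpace k => g • emb hk y := fun g =>
    ((continuous_smul_right g).comp (continuous_emb hk)).measurable
  rw [geodVolume, lintegral_map hF (hm _), ← hr]
  set L := (Matrix.SpecialLinearGroup.toLin' (g⁻¹ * r).1).toLinearMap with hL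
  have hLx : ∀ x : HSpace n, L x.1 = ((g⁻¹ * r) • x).1 := fun x => rfl
  have hLlor : ∀ v w, lor (L v) (L w) = lor v w := fun v w => (g⁻¹ * r).2.1 v w
  have hLr : ∀ y, L (embLin n k y) ∈ LinearMap.range (embLin n k) := by
    have h1 := submodule_eq_top_of_hSpace ((LinearMap.range (embLin n k)).comap (L ∘ₗ embLin n k))
      (fun y => by
        have h2 : r • emb hk y ∈ (move r (xi0 hk)).1 := ⟨emb hk y, ⟨y.1, rfl⟩, rfl⟩
        rw [hrg] at h2
        obtain ⟨x, hx, hxy⟩ := h2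
        have h3 : (g⁻¹ * r) • emb hk y = x := by
          rw [mul_smul, ← hxy]; exact inv_smul_smul g x
        change L (emb hk y).1 ∈ LinearMap.range (embLin n k)
        rw [hLx, h3]
        exact hx)
    intro y
    have : y ∈ (LinearMap.range (embLin n k)).comap (L ∘ₗ embLin n k) := by rw [h1]; trivial
    exact this
  have hA : ∀ y, embLin n k (coordProj hk (L (embLin n k y))) = L (embLin n k y) := by
    intro y
    obtain ⟨w, hw⟩ := hLr y
    rw [← hw, coordProj_embLin]
  set A := coordProj hk ∘ₗ L ∘ₗ embLin n k with hAdef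
  have hA' : ∀ y, embLin n k (A y) = L (embLin n k y) := hA
  have hAlor : ∀ v w, lor (A v) (A w) = lor v w := fun v w => by
    rw [← lor_embLin hk, hA', hA', hLlor, lor_embLin hk]
  let α : HSpace k → HSpace k := fun y => ⟨A y.1, by rw [hAlor]; exact y.2.1, by
    rw [← embLin_last hk (A y.1), hA']; exact ((g⁻¹ * r) • emb hk y).2.2⟩
  have hα : ∀ y, g • emb hk (α y) = r • emb hk y := by
    intro y
    have h1 : emb hk (α y) = (g⁻¹ * r) • emb hk y := Subtype.ext (hA' y.1)
    rw [h1, mul_smul, smul_inv_smul]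
  have hm2 : Measurable fun y => F (g • emb hk y) := hF.comp (hm g)
  rw [← lintegral_hypVolume_comp A hAlor (α := α) (fun y => rfl) hm2]
  simp_rw [hα]

/-! ### The group action -/

theorem isClosedEmbedding_coe (n : ℕ) :
    Topology.IsClosedEmbedding fun g : G n => (g.1.1 : Matrix (Fin (n + 1)) (Fin (n + 1)) ℝ) :=
  Matrix.SpecialLinearGroup.isClosedEmbedding_val.comp (isClosed_G n).isClosedEmbedding_subtypeVal

instance (n : ℕ) : ContinuousSMul (G n) (HSpace n) where
  continuous_smul := by
    refine Continuous.subtype_mk (f := fun p : G n × HSpace n => p.1.1.1.mulVec p.2.1) ?_ _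
    refine Continuous.matrix_mulVec ?_ (continuous_subtype_val.comp continuous_snd)
    exact (isClosedEmbedding_coe n).continuous.comp continuous_fst

instance (n : ℕ) : SecondCountableTopology (G n) := by
  have : SecondCountableTopology (Matrix (Fin (n + 1)) (Fin (n + 1)) ℝ) :=
    inferInstanceAs (SecondCountableTopology (Fin (n + 1) → Fin (n + 1) → ℝ))
  exact (isClosedEmbedding_coe n).isInducing.secondCountableTopology

theorem lor_smul_smul_group {n : ℕ} (g : G n) (x y : HSpace n) :
    lor (g • x).1 (g • y).1 = lor x.1 y.1 := g.2.1 x.1 y.1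

theorem lor_smul_eq_lor_inv {n : ℕ} (g : G n) (x y : HSpace n) :
    lor (g • x).1 y.1 = lor x.1 (g⁻¹ • y).1 := by
  rw [← lor_smul_smul_group g x, smul_inv_smul]

theorem height_eq_lor {n : ℕ} (x : HSpace n) : height x = lor x.1 (x0 n).1 :=
  (lor_x0_right x.1).symm

theorem height_inv_smul_x0 {n : ℕ} (g : G n) : height (g⁻¹ • x0 n) = height (g • x0 n) := by
  rw [height_eq_lor, height_eq_lor, lor_smul_eq_lor_inv, inv_inv, lor_comm]

theorem sum_sq_eq {n : ℕ} (v : Fin (n + 1) → ℝ) :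
    ∑ i : Fin n, v i.castSucc ^ 2 = v (Fin.last n) ^ 2 - lor v v := by
  simp only [lor, pow_two]; ring

theorem one_le_height {n : ℕ} (x : HSpace n) : 1 ≤ height x := by
  have h := sum_sq_eq x.1
  rw [x.2.1] at h
  have h0 := Finset.sum_nonneg (s := Finset.univ) fun (i : Fin n) _ => sq_nonneg (x.1 i.castSucc)
  have := x.2.2
  rw [height]
  nlinarith

theorem sq_coord_le {n : ℕ} (x : HSpace n) (i : Fin n) :
    x.1 i.castSucc ^ 2 ≤ height x ^ 2 - 1 := by
  have h := sum_sq_eq x.1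
  rw [x.2.1] at h
  rw [height, ← h]
  exact Finset.single_le_sum (f := fun i : Fin n => x.1 i.castSucc ^ 2) (fun i _ => sq_nonneg _)
    (Finset.mem_univ i)

theorem abs_coord_le {n : ℕ} (x : HSpace n) (i : Fin (n + 1)) : |x.1 i| ≤ height x := by
  induction i using Fin.lastCases with
  | last => rw [abs_of_pos x.2.2]; rfl
  | cast i =>
    have := sq_coord_le x i
    exact abs_le_of_sq_le_sq (by linarith) x.2.2.le

theorem lor_single_self {n : ℕ} (j : Fin (n + 1)) :
    -1 ≤ lor (Pi.single j 1 : Fin (n + 1) → ℝ) (Pi.single j 1) := by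
  induction j using Fin.lastCases with
  | last => simp [lor]
  | cast j => simp [lor, Pi.single_apply]

theorem abs_lor_single_le {n : ℕ} (j : Fin (n + 1)) (x : HSpace n) :
    |lor (Pi.single j 1 : Fin (n + 1) → ℝ) x.1| ≤ height x := by
  refine le_trans (le_of_eq ?_) (abs_coord_le x j)
  induction j using Fin.lastCases with
  | last => simp [lor]
  | cast j => simp [lor, Pi.single_apply]

theorem abs_entry_le {n : ℕ} (g : G n) (i j : Fin (n + 1)) :
    |g.1.1 i j| ≤ 1 + height (g • x0 n) := by
  set v := g.1 • (Pi.single j 1 : Fin (n + 1) → ℝ) with hv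
  have hvi : ∀ i, v i = g.1.1 i j := fun i => by
    rw [hv]
    change (g.1.1.mulVec (Pi.single j 1)) i = _
    simp
  have hR := one_le_height (g • x0 n)
  have h1 : |v (Fin.last n)| ≤ height (g • x0 n) := by
    rw [← lor_x0_right v, ← height_inv_smul_x0]
    have : lor v (x0 n).1 = lor (Pi.single j 1 : Fin (n + 1) → ℝ) (g⁻¹ • x0 n).1 := by
      rw [hv, ← g.2.1 _ (g⁻¹ • x0 n).1, ← smul_val, smul_inv_smul]
    rw [this]
    exact abs_lor_single_le j _
  have h2 : -1 ≤ lor v v := by rw [hv, g.2.1]; exact lor_single_self j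
  rw [← hvi]
  induction i using Fin.lastCases with
  | last => linarith
  | cast i =>
    have h3 := sum_sq_eq v
    have h4 : v i.castSucc ^ 2 ≤ ∑ i : Fin n, v i.castSucc ^ 2 :=
      Finset.single_le_sum (f := fun i : Fin n => v i.castSucc ^ 2) (fun i _ => sq_nonneg _)
        (Finset.mem_univ i)
    refine abs_le_of_sq_le_sq ?_ (by linarith)
    have h5 := sq_le_sq' (by linarith [abs_le.1 h1]) (abs_le.1 h1).2
    nlinarith

/-- The action of `G` on `ℍⁿ` is proper. -/
theorem isCompact_height_smul_le {n : ℕ} (R : ℝ) : IsCompact {g : G n | height (g • x0 n) ≤ R} := by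
  have hK : IsCompact (Set.pi univ fun _ : Fin (n + 1) => Set.pi univ fun _ : Fin (n + 1) =>
      Icc (-(1 + R)) (1 + R)) := isCompact_univ_pi fun _ => isCompact_univ_pi fun _ => isCompact_Icc
  refine ((isClosedEmbedding_coe n).isCompact_preimage hK).of_isClosed_subset ?_ ?_
  · exact isClosed_le (continuous_height.comp (continuous_id.smul continuous_const))
      continuous_const
  · intro g hg i _ j _
    exact abs_le.1 ((abs_entry_le g i j).trans (by simpa using hg))

/-- The group of rotations about the origin. -/
abbrev K (n : ℕ) : Subgroup (G n) := MulAction.stabilizer (G n) (x0 n)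

theorem smul_x0_of_mem {n : ℕ} {g : G n} (hg : g ∈ K n) : g • x0 n = x0 n := hg

instance (n : ℕ) : CompactSpace (K n) := by
  refine isCompact_iff_compactSpace.1
    ((isCompact_height_smul_le (n := n) 1).of_isClosed_subset ?_ ?_)
  · exact isClosed_eq (f := fun g : G n => g • x0 n) (continuous_id.smul continuous_const)
      continuous_const
  · intro g hg
    have : g • x0 n = x0 n := hg
    simp only [mem_ofPred_eq, this]
    simp [height, x0]

theorem height_smul_of_mem {n : ℕ} {g : G n} (hg : g ∈ K n) (x : HSpace n) :
    height (g • x) = height x := by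
  conv_lhs => rw [height_eq_lor, ← smul_x0_of_mem hg, lor_smul_smul_group, ← height_eq_lor]

/-- There is an element of `G` with a prescribed image of the origin and prescribed images of all
but one of the horizontal coordinate vectors. -/
theorem exists_smul_frame {n : ℕ} (hn : 1 ≤ n) (x : HSpace n)
    {b : Fin n → EuclideanSpace ℝ (Fin n)} (hb : Orthonormal ℝ b) :
    ∃ g : G n, g • x0 n = x ∧ ∀ i : Fin n, i.1 ≠ 0 →
      g.1 • (Pi.single i.castSucc 1 : Fin (n + 1) → ℝ) = flip x (horiz n (b i)) := by
  have key : ∃ c : Fin n → EuclideanSpace ℝ (Fin n), Orthonormal ℝ c ∧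
      (∀ i : Fin n, i.1 ≠ 0 → c i = b i) ∧ (LinearMap.toMatrix' (frameMap x c)).det = 1 := by
    rcases mul_self_eq_one_iff.mp (det_frameMap x hb) with h | h
    · exact ⟨b, hb, fun _ _ => rfl, h⟩
    let o : Fin n := ⟨0, by omega⟩
    let ε : Fin n → ℝ := Function.update 1 o (-1)
    have hε : ∀ i, ε i = 1 ∨ ε i = -1 := fun i => by
      by_cases hi : i = o
      · right; simp [ε, hi]
      · left; simp [ε, hi]
    refine ⟨fun i => ε i • b i, ⟨fun i => ?_, fun i j hij => ?_⟩, ?_, ?_⟩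
    · rw [norm_smul, hb.1 i]
      rcases hε i with h | h <;> simp [h]
    · simp only [inner_smul_left, inner_smul_right]
      rw [hb.2 hij]; simp
    · intro i hi
      have : i ≠ o := by
        rintro rfl
        simp [o] at hi
      simp [ε, this]
    · have hcomp : frameMap x (fun i => ε i • b i) = (frameMap x b).comp
          (Matrix.toLin' (Matrix.diagonal (Fin.snoc ε (1 : ℝ) : Fin (n + 1) → ℝ))) := by
        ext1 i
        ext1
        simp only [frameMap, LinearMap.comp_apply, LinearMap.coe_mk, AddHom.coe_mk,
          Matrix.toLin'_apply, Matrix.mulVec_diagonal, Fin.snoc_castSucc, Fin.snoc_last, one_mul,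
          smul_smul, mul_comm]
      rw [hcomp, LinearMap.toMatrix'_comp, Matrix.det_mul, h, LinearMap.toMatrix'_toLin',
        Matrix.det_diagonal, Fin.prod_univ_castSucc]
      simp [ε, Finset.prod_update_of_mem]
  obtain ⟨c, hc, hcb, hdet⟩ := key
  let A : Matrix.SpecialLinearGroup (Fin (n + 1)) ℝ := ⟨_, hdet⟩
  have hA : ∀ v, A • v = frameMap x c v := fun v => by
    change (LinearMap.toMatrix' (frameMap x c)).mulVec v = _
    rw [← Matrix.toLin'_apply, Matrix.toLin'_toMatrix']
  have hAx : frameMap x c (x0 n).1 = x.1 := by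
    rw [← flip_x0 x]
    simp [frameMap, x0]
  let g : G n := ⟨A, fun v w => by rw [hA, hA, lor_frameMap x hc], fun y => by
    rw [hA]
    exact maps_sheet _ (lor_frameMap x hc) (x0 n).2 (by rw [hAx]; exact x.2.2) y.2⟩
  refine ⟨g, Subtype.ext ((hA _).trans hAx), fun i hi => (hA _).trans ?_⟩
  rw [← hcb i hi]
  simp [frameMap, Pi.single_apply]

theorem exists_smul_x0_eq {n : ℕ} (hn : 1 ≤ n) (x : HSpace n) : ∃ g : G n, g • x0 n = x := by
  obtain ⟨g, hg, -⟩ := exists_smul_frame hn x (EuclideanSpace.basisFun (Fin n) ℝ).orthonormal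
  exact ⟨g, hg⟩

/-- The point of height `max t 1` over the last coordinate axis of `ℝⁿ`. -/
def axisPt {n : ℕ} (hn : 1 ≤ n) (t : ℝ) : HSpace n :=
  graphPt (Real.sqrt (t ^ 2 - 1) • EuclideanSpace.single ⟨n - 1, by omega⟩ 1)

theorem measurable_axisPt {n : ℕ} (hn : 1 ≤ n) : Measurable (axisPt hn) :=
  continuous_graphPt.measurable.comp (by fun_prop)

theorem axisPt_val {n : ℕ} (hn : 1 ≤ n) {t : ℝ} (ht : 1 ≤ t) : (axisPt hn t).1 =
    Real.sqrt (t ^ 2 - 1) • (Pi.single (⟨n - 1, by omega⟩ : Fin n).castSucc 1 : Fin (n + 1) → ℝ)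
      + t • (x0 n).1 := by
  have h0 : 0 ≤ t ^ 2 - 1 := by nlinarith
  ext i
  induction i using Fin.lastCases with
  | last =>
    simp only [axisPt, graphPt, Fin.snoc_last, norm_smul, mul_pow, PiLp.norm_single,
      Real.norm_eq_abs, sq_abs, Real.sq_sqrt h0]
    have h1 : Fin.last n ≠ (⟨n - 1, by omega⟩ : Fin n).castSucc := (Fin.castSucc_lt_last _).ne'
    rw [Pi.add_apply, Pi.smul_apply, Pi.single_eq_of_ne h1]
    simp [x0, Real.sqrt_sq (zero_le_one.trans ht)]
  | cast i =>
    have h1 : i.castSucc = (⟨n - 1, by omega⟩ : Fin n).castSucc ↔ i = ⟨n - 1, by omega⟩ :=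
      Fin.castSucc_inj
    simp only [axisPt, graphPt, x0, Pi.add_apply, Pi.smul_apply, Pi.single_apply, h1]
    simp

/-- For `n ≥ 2` the rotations about the origin act transitively on the spheres about the origin. -/
theorem exists_rotation_axisPt {n : ℕ} (hn : 2 ≤ n) (x : HSpace n) :
    ∃ g ∈ K n, g • axisPt (by omega) (height x) = x := by
  set v : EuclideanSpace ℝ (Fin n) := WithLp.toLp 2 fun i => x.1 i.castSucc with hv
  set s := Real.sqrt (height x ^ 2 - 1) with hs
  have hvs : ‖v‖ = s := by
    have h := sum_sq_eq x.1
    rw [x.2.1] at h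
    rw [hs, EuclideanSpace.norm_eq]
    congr 1
    simpa [height] using h
  have hxv : x.1 = horiz n v + height x • (x0 n).1 := by
    ext i
    induction i using Fin.lastCases <;> simp [horiz, x0, height, hv]
  let o : Fin n := ⟨n - 1, by omega⟩
  have key : ∃ b : OrthonormalBasis (Fin n) ℝ (EuclideanSpace ℝ (Fin n)), s • b o = -v := by
    by_cases h0 : v = 0
    · refine ⟨EuclideanSpace.basisFun (Fin n) ℝ, ?_⟩
      rw [← hvs, h0]; simp
    · have hn0 : ‖v‖ ≠ 0 := norm_ne_zero_iff.2 h0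
      have hu : Orthonormal ℝ (({o} : Set (Fin n)).domRestrict fun _ => -(‖v‖⁻¹ • v)) := by
        refine ⟨fun i => ?_, fun i j hij => absurd (Subsingleton.elim i j) hij⟩
        simp [norm_smul, hn0]
      obtain ⟨b, hb⟩ := hu.exists_orthonormalBasis_extension_of_card_eq (by simp)
      refine ⟨b, ?_⟩
      rw [hb o rfl, ← hvs, smul_neg, smul_smul, mul_inv_cancel₀ hn0, one_smul]
  obtain ⟨b, hb⟩ := key
  obtain ⟨g, hg, hgb⟩ := exists_smul_frame (by omega) (x0 n) b.orthonormal
  refine ⟨g, hg, Subtype.ext ?_⟩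
  have hgo := hgb o (by simp only [o]; omega)
  have hgx : g.1 • (x0 n).1 = (x0 n).1 := congrArg Subtype.val hg
  have hfl : flip (x0 n) (horiz n (b o)) = - horiz n (b o) := by
    have h1 : lor (horiz n (b o)) ((x0 n).1 + (x0 n).1) = 0 := by
      rw [lor_comm, lor_add_left, lor_comm, lor_horiz_x0, add_zero]
    simp only [flip, LinearMap.coe_mk, AddHom.coe_mk, h1]
    simp
  rw [smul_val, axisPt_val _ (one_le_height x), smul_add]
  change g.1.1.mulVec (s • (Pi.single o.castSucc 1 : Fin (n + 1) → ℝ)) +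
    g.1.1.mulVec (height x • (x0 n).1) = x.1
  have h1 : g.1.1.mulVec (Pi.single o.castSucc 1 : Fin (n + 1) → ℝ) = - horiz n (b o) := by
    rw [← hfl, ← hgo]; rfl
  have h2 : g.1.1.mulVec (x0 n).1 = (x0 n).1 := hgx
  rw [Matrix.mulVec_smul, Matrix.mulVec_smul, h1, h2, smul_neg, ← map_smul, hb, map_neg, neg_neg,
    ← hxv]

theorem exists_rotation {n : ℕ} (hn : 2 ≤ n) {x y : HSpace n} (h : height x = height y) :
    ∃ g ∈ K n, g • x = y := by
  obtain ⟨a, ha, hax⟩ := exists_rotation_axisPt hn x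
  obtain ⟨b, hb, hby⟩ := exists_rotation_axisPt hn y
  refine ⟨b * a⁻¹, (K n).mul_mem hb ((K n).inv_mem ha), ?_⟩
  rw [mul_smul, inv_smul_eq_iff.2 hax.symm, h, hby]

/-! ### Haar measure -/

/-- The elements of `G` that move the origin to a point of height at most `2`. -/
def haarBall (n : ℕ) : Set (G n) := {g | height (g • x0 n) ≤ 2}

theorem measurableSet_haarBall (n : ℕ) : MeasurableSet (haarBall n) :=
  (isCompact_height_smul_le 2).measurableSet

theorem haar_haarBall_lt_top (n : ℕ) : (Measure.haar : Measure (G n)) (haarBall n) < ∞ :=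
  (isCompact_height_smul_le 2).measure_lt_top

theorem continuous_height_smul_x0 (n : ℕ) : Continuous fun g : G n => height (g • x0 n) :=
  continuous_height.comp (continuous_id.smul continuous_const)

theorem haar_haarBall_pos (n : ℕ) : 0 < (Measure.haar : Measure (G n)) (haarBall n) := by
  have ho : IsOpen {g : G n | height (g • x0 n) < 2} :=
    isOpen_lt (continuous_height_smul_x0 n) continuous_const
  refine (ho.measure_pos _ ⟨1, ?_⟩).trans_le (measure_mono fun g hg => ?_)
  · simp only [mem_ofPred_eq, one_smul]
    simp [height, x0]
  · exact (show height (g • x0 n) < 2 from hg).le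

/-- `G` is unimodular. For a rotation `κ` the set `haarBall n` is invariant under right
multiplication by `κ`; and every `g` satisfies `g⁻¹ = κ g κ'` for suitable rotations, since `g` and
`g⁻¹` move the origin by the same distance. -/
theorem modularCharacterFun_eq_one {n : ℕ} (hn : 2 ≤ n) (g : G n) :
    Measure.modularCharacterFun g = 1 := by
  have hK : ∀ k ∈ K n, Measure.modularCharacterFun k = 1 := by
    intro k hk
    have h1 := congrArg (fun μ => μ (haarBall n))
      (Measure.map_right_mul_eq_modularCharacterFun_smul (Measure.haar : Measure (G n)) k)
    have h2 : (fun x => x * k) ⁻¹' haarBall n = haarBall n := by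
      ext x
      simp only [haarBall, mem_preimage, mem_ofPred_eq, mul_smul, smul_x0_of_mem hk]
    simp only [Measure.map_apply (measurable_mul_const k) (measurableSet_haarBall n), h2,
      Measure.smul_apply, ENNReal.smul_def, smul_eq_mul] at h1
    have h3 : ((Measure.modularCharacterFun k : NNReal) : ℝ≥0∞) = 1 := by
      rw [← ENNReal.mul_left_inj (haar_haarBall_pos n).ne' (haar_haarBall_lt_top n).ne, ← h1,
        one_mul]
    exact_mod_cast h3
  obtain ⟨k, hk, hkg⟩ := exists_rotation hn (height_inv_smul_x0 g)
  have hk' : g⁻¹ * k * g⁻¹ ∈ K n := by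
    change (g⁻¹ * k * g⁻¹) • x0 n = x0 n
    rw [mul_smul, mul_smul, hkg, inv_smul_smul]
  have h1 := hK _ hk'
  rw [Measure.modularCharacterFun_map_mul, Measure.modularCharacterFun_map_mul, hK k hk,
    mul_one] at h1
  have h2 : Measure.modularCharacterFun g⁻¹ = 1 := by
    rw [← sq] at h1
    exact (pow_eq_one_iff_of_nonneg zero_le two_ne_zero).1 h1
  have h3 := Measure.modularCharacterFun_map_mul g g⁻¹
  rw [mul_inv_cancel, Measure.modularCharacterFun_map_one, h2, mul_one] at h3
  exact h3.symm

theorem isMulRightInvariant_haar {n : ℕ} (hn : 2 ≤ n) :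
    (Measure.haar : Measure (G n)).IsMulRightInvariant where
  map_mul_right_eq_self g := by
    rw [Measure.map_right_mul_eq_modularCharacterFun_smul, modularCharacterFun_eq_one hn, one_smul]

theorem isInvInvariant_haar {n : ℕ} (hn : 2 ≤ n) :
    (Measure.haar : Measure (G n)).IsInvInvariant where
  inv_eq_self := by
    have := isMulRightInvariant_haar hn
    have h1 := Measure.isMulLeftInvariant_eq_smul_of_regular (Measure.haar : Measure (G n)).inv
      Measure.haar
    have h2 := congrArg (fun μ => μ (haarBall n)) h1
    have h3 : (haarBall n)⁻¹ = haarBall n := by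
      ext g
      simp only [haarBall, Set.mem_inv, mem_ofPred_eq, height_inv_smul_x0]
    simp only [Measure.inv_apply, h3, Measure.smul_apply, ENNReal.smul_def, smul_eq_mul] at h2
    have h4 : ((Measure.haarScalarFactor (Measure.haar : Measure (G n)).inv Measure.haar : NNReal)
        : ℝ≥0∞) = 1 := by
      rw [← ENNReal.mul_left_inj (haar_haarBall_pos n).ne' (haar_haarBall_lt_top n).ne, ← h2,
        one_mul]
    have h5 : Measure.haarScalarFactor (Measure.haar : Measure (G n)).inv Measure.haar = 1 := by
      exact_mod_cast h4
    rw [h1, h5, one_smul]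

/-! ### The Riemannian measure as a quotient of the Haar measure -/

instance (n : ℕ) : SFinite (hypVolume n) := by unfold hypVolume; infer_instance

theorem lintegral_hypVolume_smul {n : ℕ} [NeZero n] (g : G n) {F : HSpace n → ℝ≥0∞}
    (hF : Measurable F) : ∫⁻ x, F (g • x) ∂hypVolume n = ∫⁻ x, F x ∂hypVolume n :=
  lintegral_hypVolume_comp (Matrix.SpecialLinearGroup.toLin' g.1).toLinearMap g.2.1
    (fun _ => rfl) hF

theorem measurable_smul_pair {n : ℕ} : Measurable fun p : G n × HSpace n => p.1 • p.2 :=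
  continuous_smul.measurable

/-- Two `G`-invariant measures on `ℍⁿ` are proportional: evaluate
`∫_G ∫_{ℍⁿ} 1_A(x) 1_B(gx) dx dg` in two ways. -/
theorem hypVolume_mul_haar {n : ℕ} (hn : 2 ≤ n) {A B : Set (HSpace n)} (hA : MeasurableSet A)
    (hB : MeasurableSet B) :
    hypVolume n A * (Measure.haar : Measure (G n)) {g | g • x0 n ∈ B} =
      hypVolume n B * (Measure.haar : Measure (G n)) {g | g • x0 n ∈ A} := by
  have : NeZero n := ⟨by omega⟩
  have hr := isMulRightInvariant_haar hn
  have hi := isInvInvariant_haar hn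
  have hmA : Measurable (A.indicator (1 : HSpace n → ℝ≥0∞)) := measurable_one.indicator hA
  have hmB : Measurable (B.indicator (1 : HSpace n → ℝ≥0∞)) := measurable_one.indicator hB
  -- the measure of `{g | g x ∈ C}` does not depend on `x`
  have horb : ∀ {C : Set (HSpace n)}, MeasurableSet C → ∀ x : HSpace n,
      ∫⁻ g : G n, C.indicator (1 : HSpace n → ℝ≥0∞) (g • x) ∂Measure.haar
        = (Measure.haar : Measure (G n)) {g | g • x0 n ∈ C} := by
    intro C hC x
    obtain ⟨s, rfl⟩ := exists_smul_x0_eq (by omega) x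
    simp_rw [← mul_smul]
    rw [lintegral_mul_right_eq_self (fun g : G n => C.indicator (1 : HSpace n → ℝ≥0∞) (g • x0 n)) s]
    have hC' : MeasurableSet {g : G n | g • x0 n ∈ C} :=
      (continuous_id.smul continuous_const).measurable hC
    rw [← lintegral_indicator_one hC']
    rfl
  have hmul : Measurable fun p : G n × HSpace n =>
      A.indicator (1 : HSpace n → ℝ≥0∞) p.2 * B.indicator (1 : HSpace n → ℝ≥0∞) (p.1 • p.2) :=
    (hmA.comp measurable_snd).mul (hmB.comp measurable_smul_pair)
  have hmul' : Measurable fun p : G n × HSpace n =>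
      A.indicator (1 : HSpace n → ℝ≥0∞) (p.1⁻¹ • p.2) * B.indicator (1 : HSpace n → ℝ≥0∞) p.2 :=
    (hmA.comp (measurable_smul_pair.comp
      (measurable_fst.inv.prodMk measurable_snd))).mul (hmB.comp measurable_snd)
  have h1 : ∫⁻ g : G n, ∫⁻ x, A.indicator (1 : HSpace n → ℝ≥0∞) x *
      B.indicator (1 : HSpace n → ℝ≥0∞) (g • x) ∂hypVolume n ∂Measure.haar =
      hypVolume n A * (Measure.haar : Measure (G n)) {g | g • x0 n ∈ B} := by
    rw [lintegral_lintegral_swap hmul.aemeasurable]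
    have : ∀ x : HSpace n, Measurable fun g : G n => B.indicator (1 : HSpace n → ℝ≥0∞) (g • x) :=
      fun x => hmB.comp (continuous_id.smul continuous_const).measurable
    simp_rw [lintegral_const_mul _ (this _), horb hB]
    rw [lintegral_mul_const _ hmA, lintegral_indicator_one hA]
  have h2 : ∫⁻ g : G n, ∫⁻ x, A.indicator (1 : HSpace n → ℝ≥0∞) x *
      B.indicator (1 : HSpace n → ℝ≥0∞) (g • x) ∂hypVolume n ∂Measure.haar =
      ∫⁻ g : G n, ∫⁻ x, A.indicator (1 : HSpace n → ℝ≥0∞) (g⁻¹ • x) *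
      B.indicator (1 : HSpace n → ℝ≥0∞) x ∂hypVolume n ∂Measure.haar := by
    refine lintegral_congr fun g => ?_
    rw [← lintegral_hypVolume_smul g⁻¹ (F := fun x => A.indicator (1 : HSpace n → ℝ≥0∞) x *
      B.indicator (1 : HSpace n → ℝ≥0∞) (g • x)) (hmul.comp measurable_prodMk_left)]
    simp_rw [smul_inv_smul]
  rw [← h1, h2, lintegral_lintegral_swap hmul'.aemeasurable]
  have h3 : ∀ x : HSpace n, Measurable fun g : G n => A.indicator (1 : HSpace n → ℝ≥0∞) (g⁻¹ • x) :=
    fun x => hmA.comp (continuous_inv.smul continuous_const).measurable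
  simp_rw [lintegral_mul_const _ (h3 _)]
  have h4 : ∀ x : HSpace n, ∫⁻ g : G n, A.indicator (1 : HSpace n → ℝ≥0∞) (g⁻¹ • x) ∂Measure.haar
      = (Measure.haar : Measure (G n)) {g | g • x0 n ∈ A} := fun x => by
    rw [← horb hA x]
    exact lintegral_inv_eq_self (fun g : G n => A.indicator (1 : HSpace n → ℝ≥0∞) (g • x))
  simp_rw [h4]
  rw [lintegral_const_mul _ hmB, lintegral_indicator_one hB, mul_comm]

theorem le_cosh (ω : ℝ) : ω ≤ Real.cosh ω := by
  rcases le_or_gt 0 ω with h | h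
  · exact (Real.self_le_sinh_iff.2 h).trans (Real.sinh_lt_cosh ω).le
  · exact h.le.trans (Real.cosh_pos ω).le

theorem hypVolume_height_le_two {n : ℕ} [NeZero n] :
    hypVolume n {x | height x ≤ 2} ≠ 0 ∧ hypVolume n {x | height x ≤ 2} ≠ ∞ := by
  have hS : MeasurableSet {x : HSpace n | height x ≤ 2} :=
    measurableSet_le continuous_height.measurable measurable_const
  have h1 : hypVolume n {x | height x ≤ 2} = sphereMass n *
      ∫⁻ ω in Ioi (0 : ℝ), ENNReal.ofReal (Real.sinh ω ^ (n - 1)) *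
        (Iic (2 : ℝ)).indicator 1 (Real.cosh ω) := by
    rw [← lintegral_zonal (measurable_one.indicator measurableSet_Iic),
      ← lintegral_indicator_one hS]
    rfl
  have hm : Measurable fun ω : ℝ => ENNReal.ofReal (Real.sinh ω ^ (n - 1)) *
        (Iic (2 : ℝ)).indicator (1 : ℝ → ℝ≥0∞) (Real.cosh ω) :=
    Measurable.mul (by fun_prop)
      ((measurable_one.indicator measurableSet_Iic).comp Real.continuous_cosh.measurable)
  rw [h1]
  constructor
  · refine mul_ne_zero (sphereMass_ne_zero n) ?_
    rw [← pos_iff_ne_zero, setLIntegral_pos_iff hm]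
    have h2 : 0 < Real.arcosh 2 := Real.arcosh_pos (by norm_num)
    refine lt_of_lt_of_le ?_ (measure_mono (s := Ioo 0 (Real.arcosh 2)) fun ω hω => ⟨?_, hω.1⟩)
    · simp [h2]
    · have h3 : Real.cosh ω ≤ 2 := by
        rw [← Real.cosh_arcosh (show (1 : ℝ) ≤ 2 by norm_num), Real.cosh_le_cosh,
          abs_of_pos hω.1, abs_of_pos h2]
        exact hω.2.le
      have h4 := Real.sinh_pos_iff.2 hω.1
      rw [Function.mem_support, indicator_of_mem (mem_Iic.2 h3)]
      simp only [Pi.one_apply, mul_one]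
      exact (ENNReal.ofReal_pos.2 (by positivity)).ne'
  · refine ENNReal.mul_ne_top (sphereMass_ne_top n) (ne_of_lt ?_)
    calc _ ≤ ∫⁻ ω in Ioi (0 : ℝ),
            (Icc (0 : ℝ) 2).indicator (fun _ => ENNReal.ofReal (2 ^ (n - 1))) ω := by
          refine setLIntegral_mono' measurableSet_Ioi fun ω hω => ?_
          by_cases h : Real.cosh ω ≤ 2
          · rw [indicator_of_mem (mem_Iic.2 h),
              indicator_of_mem (mem_Icc.2 ⟨(mem_Ioi.1 hω).le, (le_cosh ω).trans h⟩), Pi.one_apply,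
              mul_one]
            exact ENNReal.ofReal_le_ofReal (pow_le_pow_left₀ (Real.sinh_pos_iff.2 hω).le
              ((Real.sinh_lt_cosh ω).le.trans h) _)
          · rw [indicator_of_notMem (show Real.cosh ω ∉ Iic 2 from h), mul_zero]
            exact zero_le
      _ ≤ ∫⁻ ω, (Icc (0 : ℝ) 2).indicator (fun _ => ENNReal.ofReal (2 ^ (n - 1))) ω :=
          setLIntegral_le_lintegral _ _
      _ < ∞ := by
          rw [lintegral_indicator measurableSet_Icc, setLIntegral_const]
          exact ENNReal.mul_lt_top ENNReal.ofReal_lt_top (by simp)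

/-- The image of the Haar measure under `g ↦ g x₀` is a multiple of the Riemannian measure. -/
theorem exists_map_haar_eq {n : ℕ} (hn : 2 ≤ n) : ∃ c : ℝ≥0∞, c ≠ ∞ ∧
    Measure.map (fun g : G n => g • x0 n) Measure.haar = c • hypVolume n := by
  have : NeZero n := ⟨by omega⟩
  have hS : MeasurableSet {x : HSpace n | height x ≤ 2} :=
    measurableSet_le continuous_height.measurable measurable_const
  obtain ⟨h0, htop⟩ := hypVolume_height_le_two (n := n)
  refine ⟨(Measure.haar : Measure (G n)) (haarBall n) / hypVolume n {x | height x ≤ 2},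
    (ENNReal.div_lt_top (haar_haarBall_lt_top n).ne h0).ne, ?_⟩
  ext A hA
  have hm : Measurable fun g : G n => g • x0 n := (continuous_id.smul continuous_const).measurable
  have h := hypVolume_mul_haar hn hA hS
  have hball : {g : G n | g • x0 n ∈ {x | height x ≤ 2}} = haarBall n := Set.ext fun g => Iff.rfl
  have hpre : {g : G n | g • x0 n ∈ A} = (fun g : G n => g • x0 n) ⁻¹' A := Set.ext fun g => Iff.rfl
  rw [hball, hpre] at h
  rw [Measure.map_apply hm hA, Measure.smul_apply, smul_eq_mul, ENNReal.div_eq_inv_mul, mul_assoc,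
    mul_comm ((Measure.haar : Measure (G n)) (haarBall n)), h, ← mul_assoc,
    ENNReal.inv_mul_cancel h0 htop, one_mul]

/-! ### Averaging over rotations -/

/-- The invariant probability measure on the group of rotations about the origin. -/
def rotMeasure (n : ℕ) : Measure (K n) := Measure.haarMeasure ⊤

instance (n : ℕ) : IsProbabilityMeasure (rotMeasure n) :=
  ⟨Measure.haarMeasure_self (K₀ := (⊤ : TopologicalSpace.PositiveCompacts (K n)))⟩

instance (n : ℕ) : (rotMeasure n).IsMulLeftInvariant := by unfold rotMeasure; infer_instance

/-- The average of a function over rotations about the origin. -/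
def zonalAvg {n : ℕ} (F : HSpace n → ℝ≥0∞) (x : HSpace n) : ℝ≥0∞ :=
  ∫⁻ κ : K n, F (κ.1⁻¹ • x) ∂rotMeasure n

theorem measurable_rot_smul {n : ℕ} : Measurable fun p : HSpace n × K n => p.2.1⁻¹ • p.1 :=
  ((continuous_subtype_val.comp continuous_snd).inv.smul continuous_fst).measurable

theorem measurable_rot_smul_right {n : ℕ} (x : HSpace n) : Measurable fun κ : K n => κ.1⁻¹ • x :=
  (continuous_subtype_val.inv.smul continuous_const).measurable

theorem measurable_zonalAvg {n : ℕ} {F : HSpace n → ℝ≥0∞} (hF : Measurable F) :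
    Measurable (zonalAvg F) :=
  Measurable.lintegral_prod_right' (f := fun p : HSpace n × K n => F (p.2.1⁻¹ • p.1))
    (hF.comp measurable_rot_smul)

theorem zonalAvg_smul {n : ℕ} (F : HSpace n → ℝ≥0∞) {g : G n} (hg : g ∈ K n) (x : HSpace n) :
    zonalAvg F (g • x) = zonalAvg F x := by
  unfold zonalAvg
  rw [← lintegral_mul_left_eq_self (fun κ : K n => F (κ.1⁻¹ • g • x)) ⟨g, hg⟩]
  refine lintegral_congr fun κ => ?_
  simp [mul_smul]

/-- The rotation average of `F` as a function of the height. -/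
def zonalProfile {n : ℕ} (hn : 2 ≤ n) (F : HSpace n → ℝ≥0∞) (t : ℝ) : ℝ≥0∞ :=
  zonalAvg F (axisPt (by omega) t)

theorem measurable_zonalProfile {n : ℕ} (hn : 2 ≤ n) {F : HSpace n → ℝ≥0∞} (hF : Measurable F) :
    Measurable (zonalProfile hn F) :=
  (measurable_zonalAvg hF).comp (measurable_axisPt _)

theorem zonalAvg_eq {n : ℕ} (hn : 2 ≤ n) (F : HSpace n → ℝ≥0∞) (x : HSpace n) :
    zonalAvg F x = zonalProfile hn F (height x) := by
  obtain ⟨g, hg, hgx⟩ := exists_rotation_axisPt hn x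
  conv_lhs => rw [← hgx, zonalAvg_smul F hg]
  rfl

/-- Replacing a function by its rotation average does not change its integral against a zonal
weight. -/
theorem lintegral_zonalProfile {n : ℕ} (hn : 2 ≤ n) {F : HSpace n → ℝ≥0∞} (hF : Measurable F)
    {w : ℝ → ℝ≥0∞} (hw : Measurable w) :
    ∫⁻ x, zonalProfile hn F (height x) * w (height x) ∂hypVolume n =
      ∫⁻ x, F x * w (height x) ∂hypVolume n := by
  have : NeZero n := ⟨by omega⟩
  have hwm : Measurable fun x : HSpace n => w (height x) := hw.comp continuous_height.measurable
  simp_rw [← zonalAvg_eq, zonalAvg]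
  have hm0 : Measurable fun p : HSpace n × K n => F (p.2.1⁻¹ • p.1) := hF.comp measurable_rot_smul
  have hm : ∀ x : HSpace n, Measurable fun κ : K n => F (κ.1⁻¹ • x) := fun x =>
    hF.comp (measurable_rot_smul_right x)
  simp_rw [← lintegral_mul_const _ (hm _)]
  have hm2 : Measurable fun p : HSpace n × K n => F (p.2.1⁻¹ • p.1) * w (height p.1) :=
    hm0.mul (hwm.comp measurable_fst)
  rw [lintegral_lintegral_swap hm2.aemeasurable]
  have h1 : ∀ κ : K n, ∫⁻ x, F (κ.1⁻¹ • x) * w (height x) ∂hypVolume n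
      = ∫⁻ x, F x * w (height x) ∂hypVolume n := by
    intro κ
    rw [← lintegral_hypVolume_smul κ.1⁻¹ (F := fun x => F x * w (height x)) (hF.mul hwm)]
    simp_rw [height_smul_of_mem ((K n).inv_mem κ.2)]
  simp_rw [h1]
  rw [lintegral_const, measure_univ, mul_one]

theorem measurable_inv_smul_x0 (n : ℕ) : Measurable fun g : G n => g⁻¹ • x0 n :=
  (continuous_inv.smul continuous_const).measurable

/-- The weight `φ(g⁻¹x₀)` does not change when `g` is multiplied on the left by a rotation. -/
theorem lintegral_haar_zonalAvg {n : ℕ} {F φ : HSpace n → ℝ≥0∞} (hF : Measurable F)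
    (hφ : Measurable φ) (y : HSpace n) :
    ∫⁻ g : G n, φ (g⁻¹ • x0 n) * F (g • y) ∂Measure.haar =
      ∫⁻ g : G n, φ (g⁻¹ • x0 n) * zonalAvg F (g • y) ∂Measure.haar := by
  have hφm : Measurable fun g : G n => φ (g⁻¹ • x0 n) := hφ.comp (measurable_inv_smul_x0 n)
  have hm2 : Measurable fun p : G n × K n => F (p.2.1⁻¹ • p.1 • y) :=
    hF.comp ((continuous_subtype_val.comp continuous_snd).inv.smul
      (continuous_fst.smul continuous_const)).measurable
  have h1 : ∀ κ : K n, ∫⁻ g : G n, φ (g⁻¹ • x0 n) * F (κ.1⁻¹ • g • y) ∂Measure.haar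
      = ∫⁻ g : G n, φ (g⁻¹ • x0 n) * F (g • y) ∂Measure.haar := by
    intro κ
    rw [← lintegral_mul_left_eq_self (fun g : G n => φ (g⁻¹ • x0 n) * F (g • y)) κ.1⁻¹]
    refine lintegral_congr fun g => ?_
    rw [mul_inv_rev, inv_inv, mul_smul, mul_smul, smul_x0_of_mem κ.2]
  have hm3 : ∀ g : G n, Measurable fun κ : K n => F (κ.1⁻¹ • g • y) := fun g =>
    hF.comp (measurable_rot_smul_right (g • y))
  have hm4 : Measurable fun p : G n × K n => φ (p.1⁻¹ • x0 n) * F (p.2.1⁻¹ • p.1 • y) :=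
    (hφm.comp measurable_fst).mul hm2
  unfold zonalAvg
  simp_rw [← lintegral_const_mul _ (hm3 _)]
  rw [lintegral_lintegral_swap hm4.aemeasurable]
  simp_rw [h1]
  rw [lintegral_const, measure_univ, mul_one]

/-- Duality for the Radon transform. A weight `φ(g⁻¹x₀)` on the group is invariant under rotations
of `gξ₀` about the origin, so only the rotation average of `F` matters; inverting `g` then turns the
group integral into an integral over `ℍⁿ`. -/
theorem exists_lintegral_haar_radon {n k : ℕ} (hk1 : 1 ≤ k) (hk : k < n) :
    ∃ c : ℝ≥0∞, c ≠ ∞ ∧ ∀ {F φ : HSpace n → ℝ≥0∞}, Measurable F → Measurable φ →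
    ∫⁻ g : G n, φ (g⁻¹ • x0 n) * (∫⁻ y, F (g • emb hk y) ∂hypVolume k) ∂Measure.haar =
      c * ∫⁻ z, φ z * (∫⁻ ω in Ioi (0 : ℝ), ENNReal.ofReal (Real.sinh ω ^ (k - 1)) *
        zonalProfile (by omega) F (coshDist k z * Real.cosh ω)) ∂hypVolume n := by
  have hn : 2 ≤ n := by omega
  have : NeZero k := ⟨by omega⟩
  obtain ⟨c, hc, hmap⟩ := exists_map_haar_eq hn
  refine ⟨c * sphereMass k, ENNReal.mul_ne_top hc (sphereMass_ne_top k), fun {F φ} hF hφ => ?_⟩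
  have hi := isInvInvariant_haar hn
  have hφm : Measurable fun g : G n => φ (g⁻¹ • x0 n) := hφ.comp (measurable_inv_smul_x0 n)
  have hp := measurable_zonalProfile hn hF
  have hact : Measurable fun p : G n × HSpace k => p.1 • emb hk p.2 :=
    (continuous_fst.smul ((continuous_emb hk).comp continuous_snd)).measurable
  have hm1 : Measurable fun p : G n × HSpace k => F (p.1 • emb hk p.2) := hF.comp hact
  have hlor : Measurable fun p : HSpace k × HSpace n => lor (emb hk p.1).1 p.2.1 :=
    (continuous_lor (continuous_subtype_val.comp ((continuous_emb hk).comp continuous_fst))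
      (continuous_subtype_val.comp continuous_snd)).measurable
  have hlory : ∀ y : HSpace k, Measurable fun z : HSpace n => lor (emb hk y).1 z.1 := fun y =>
    (continuous_lor continuous_const continuous_subtype_val).measurable
  have hlorz : ∀ z : HSpace n, Measurable fun y : HSpace k => lor (emb hk y).1 z.1 := fun z =>
    (continuous_lor (continuous_subtype_val.comp (continuous_emb hk)) continuous_const).measurable
  have hm2 : Measurable fun p : HSpace k × HSpace n =>
      φ p.2 * zonalProfile hn F (lor (emb hk p.1).1 p.2.1) :=
    (hφ.comp measurable_snd).mul (hp.comp hlor)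
  have hx0 : Measurable fun g : G n => g • x0 n := (continuous_id.smul continuous_const).measurable
  calc _ = ∫⁻ g : G n, ∫⁻ y, φ (g⁻¹ • x0 n) * F (g • emb hk y) ∂hypVolume k ∂Measure.haar := by
        refine lintegral_congr fun g => ?_
        have hg : Measurable fun y => F (g • emb hk y) :=
          hF.comp (continuous_smul_right g |>.comp (continuous_emb hk)).measurable
        rw [lintegral_const_mul _ hg]
    _ = ∫⁻ y, ∫⁻ g : G n, φ (g⁻¹ • x0 n) * F (g • emb hk y) ∂Measure.haar ∂hypVolume k :=
        lintegral_lintegral_swap (((hφm.comp measurable_fst).mul hm1).aemeasurable)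
    _ = ∫⁻ y, ∫⁻ g : G n, φ (g⁻¹ • x0 n) *
          zonalProfile hn F (lor (emb hk y).1 (g⁻¹ • x0 n).1) ∂Measure.haar ∂hypVolume k := by
        refine lintegral_congr fun y => ?_
        rw [lintegral_haar_zonalAvg hF hφ]
        refine lintegral_congr fun g => ?_
        rw [zonalAvg_eq hn, height_eq_lor, lor_smul_eq_lor_inv]
    _ = ∫⁻ y, ∫⁻ z, φ z * zonalProfile hn F (lor (emb hk y).1 z.1) ∂(c • hypVolume n)
          ∂hypVolume k := by
        refine lintegral_congr fun y => ?_
        rw [lintegral_inv_eq_self (fun g : G n => φ (g • x0 n) *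
          zonalProfile hn F (lor (emb hk y).1 (g • x0 n).1)), ← hmap,
          lintegral_map (f := fun z => φ z * zonalProfile hn F (lor (emb hk y).1 z.1))
            (hφ.mul (hp.comp (hlory y))) hx0]
    _ = c * ∫⁻ z, ∫⁻ y, φ z * zonalProfile hn F (lor (emb hk y).1 z.1) ∂hypVolume k
          ∂hypVolume n := by
        simp_rw [lintegral_smul_measure, smul_eq_mul]
        rw [lintegral_const_mul' _ _ hc, lintegral_lintegral_swap hm2.aemeasurable]
    _ = c * ∫⁻ z, sphereMass k * (φ z * ∫⁻ ω in Ioi (0 : ℝ),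
          ENNReal.ofReal (Real.sinh ω ^ (k - 1)) *
          zonalProfile hn F (coshDist k z * Real.cosh ω)) ∂hypVolume n := by
        congr 1
        refine lintegral_congr fun z => ?_
        have hz : Measurable fun y => zonalProfile hn F (lor (emb hk y).1 z.1) :=
          hp.comp (hlorz z)
        rw [lintegral_const_mul _ hz, lintegral_emb_lor hk hp z, mul_left_comm]
    _ = _ := by rw [lintegral_const_mul' _ _ (sphereMass_ne_top k), mul_assoc]

/-! ### One-dimensional substitutions -/

/-- The substitution `t = c cosh ω`. -/
theorem lintegral_Ioi_cosh {c : ℝ} (hc : 0 < c) (φ : ℝ → ℝ≥0∞) :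
    ∫⁻ t in Ioi c, φ t =
      ∫⁻ ω in Ioi (0 : ℝ), ENNReal.ofReal (c * Real.sinh ω) * φ (c * Real.cosh ω) := by
  have himg : (fun ω => c * Real.cosh ω) '' Ioi 0 = Ioi c := by
    ext t
    constructor
    · rintro ⟨ω, hω, rfl⟩
      have := Real.one_lt_cosh.2 (ne_of_gt hω)
      exact mem_Ioi.2 (by nlinarith)
    · intro ht
      have h1 : 1 < t / c := (one_lt_div hc).2 ht
      refine ⟨Real.arcosh (t / c), Real.arcosh_pos h1, ?_⟩
      simp only [Real.cosh_arcosh h1.le]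
      field_simp
  have hinj : InjOn (fun ω => c * Real.cosh ω) (Ioi 0) := by
    intro a ha b hb hab
    have h1 := mul_left_cancel₀ hc.ne' hab
    have h2 := congrArg Real.arcosh h1
    rwa [Real.arcosh_cosh (le_of_lt ha), Real.arcosh_cosh (le_of_lt hb)] at h2
  rw [← himg, lintegral_image_eq_lintegral_abs_deriv_mul measurableSet_Ioi
    (fun ω _ => ((Real.hasDerivAt_cosh ω).const_mul c).hasDerivWithinAt) hinj]
  refine setLIntegral_congr_fun measurableSet_Ioi fun ω hω => ?_
  have := Real.sinh_pos_iff.2 hω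
  rw [abs_of_pos (by positivity)]

theorem lintegral_comp_le_of_le_deriv {T U : Set ℝ} (hT : MeasurableSet T) {f f' : ℝ → ℝ}
    (hf : ∀ s ∈ T, HasDerivAt f (f' s) s) (hinj : InjOn f T) (hTU : MapsTo f T U) {M : ℝ}
    (hM0 : 0 ≤ M) (hM : ∀ s ∈ T, 1 ≤ M * |f' s|) (h : ℝ → ℝ≥0∞) :
    ∫⁻ s in T, h (f s) ≤ ENNReal.ofReal M * ∫⁻ t in U, h t := by
  calc ∫⁻ s in T, h (f s) ≤ ∫⁻ s in T, ENNReal.ofReal M * (ENNReal.ofReal |f' s| * h (f s)) := by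
        refine setLIntegral_mono' hT fun s hs => ?_
        rw [← mul_assoc, ← ENNReal.ofReal_mul hM0]
        exact le_mul_of_one_le_left zero_le (ENNReal.one_le_ofReal.2 (hM s hs))
    _ = ENNReal.ofReal M * ∫⁻ t in f '' T, h t := by
        rw [lintegral_const_mul' _ _ ENNReal.ofReal_ne_top,
          lintegral_image_eq_lintegral_abs_deriv_mul hT
            (fun s hs => (hf s hs).hasDerivWithinAt) hinj]
    _ ≤ _ := by gcongr; exact hTU.image_subset

/-- The substitution `t = √(B + s²) C`, away from its critical point `s = 0`. -/
theorem lintegral_sqrt_le {B C δ R : ℝ} (hB : 1 ≤ B) (hC : 0 < C) (hδ : 0 < δ) (hR : 0 < R)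
    (h : ℝ → ℝ≥0∞) :
    ∫⁻ s in {s : ℝ | δ < |s| ∧ B + s ^ 2 < R ^ 2}, h (Real.sqrt (B + s ^ 2) * C) ≤
      2 * (ENNReal.ofReal (R / (δ * C)) *
        ∫⁻ t in Ioo (Real.sqrt (1 + δ ^ 2) * C) (R * C), h t) := by
  set S := {s : ℝ | δ < |s| ∧ B + s ^ 2 < R ^ 2} with hS
  have hSm : MeasurableSet S :=
    (measurableSet_lt measurable_const (by fun_prop : Measurable fun s : ℝ => |s|)).inter
      (measurableSet_lt (by fun_prop : Measurable fun s : ℝ => B + s ^ 2) measurable_const)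
  have hderiv : ∀ s, HasDerivAt (fun s => Real.sqrt (B + s ^ 2) * C)
      (s / Real.sqrt (B + s ^ 2) * C) s := by
    intro s
    have h1 : HasDerivAt (fun s : ℝ => B + s ^ 2) (2 * s) s := by
      simpa using (hasDerivAt_pow 2 s).const_add B
    have h2 := (h1.sqrt (by positivity)).mul_const C
    convert! h2 using 1
    have : 0 < Real.sqrt (B + s ^ 2) := Real.sqrt_pos.2 (by positivity)
    field_simp
  have hmaps : MapsTo (fun s => Real.sqrt (B + s ^ 2) * C) S
      (Ioo (Real.sqrt (1 + δ ^ 2) * C) (R * C)) := by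
    rintro s ⟨h1, h2⟩
    have h3 : δ ^ 2 < s ^ 2 := by rw [← sq_abs s]; gcongr
    refine ⟨mul_lt_mul_of_pos_right (Real.sqrt_lt_sqrt (by positivity) (by linarith)) hC,
      mul_lt_mul_of_pos_right ?_ hC⟩
    rwa [Real.sqrt_lt' hR]
  have hlow : ∀ s ∈ S, 1 ≤ R / (δ * C) * |s / Real.sqrt (B + s ^ 2) * C| := by
    rintro s ⟨h1, h2⟩
    have h3 : 0 < Real.sqrt (B + s ^ 2) := Real.sqrt_pos.2 (by positivity)
    have h4 : Real.sqrt (B + s ^ 2) < R := by rwa [Real.sqrt_lt' hR]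
    rw [abs_mul, abs_div, abs_of_pos hC, abs_of_pos h3]
    have h5 : R / (δ * C) * (|s| / Real.sqrt (B + s ^ 2) * C)
        = (R / Real.sqrt (B + s ^ 2)) * (|s| / δ) := by field_simp
    rw [h5]
    exact one_le_mul_of_one_le_of_one_le ((one_le_div h3).2 h4.le) ((one_le_div hδ).2 h1.le)
  have hsq : ∀ a b : ℝ, Real.sqrt (B + a ^ 2) * C = Real.sqrt (B + b ^ 2) * C → a ^ 2 = b ^ 2 := by
    intro a b hab
    have h1 := mul_right_cancel₀ hC.ne' hab
    rw [Real.sqrt_inj (by positivity) (by positivity)] at h1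
    linarith
  have hU : S ⊆ (S ∩ Ioi 0) ∪ (S ∩ Iio 0) := by
    intro s hs
    have : s ≠ 0 := by rintro rfl; simpa using hδ.trans hs.1
    rcases lt_or_gt_of_ne this with h | h
    · exact Or.inr ⟨hs, h⟩
    · exact Or.inl ⟨hs, h⟩
  have hM0 : 0 ≤ R / (δ * C) := by positivity
  calc _ ≤ ∫⁻ s in (S ∩ Ioi 0) ∪ (S ∩ Iio 0), h (Real.sqrt (B + s ^ 2) * C) :=
        lintegral_mono_set hU
    _ ≤ _ := lintegral_union_le _ _ _
    _ ≤ _ := by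
      rw [two_mul]
      refine add_le_add ?_ ?_
      · refine lintegral_comp_le_of_le_deriv (hSm.inter measurableSet_Ioi) (fun s _ => hderiv s) ?_
          (hmaps.mono_left inter_subset_left) hM0 (fun s hs => hlow s hs.1) h
        intro a ha b hb hab
        exact (pow_left_inj₀ (le_of_lt ha.2) (le_of_lt hb.2) two_ne_zero).1 (hsq a b hab)
      · refine lintegral_comp_le_of_le_deriv (hSm.inter measurableSet_Iio) (fun s _ => hderiv s) ?_
          (hmaps.mono_left inter_subset_left) hM0 (fun s hs => hlow s hs.1) h
        intro a ha b hb hab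
        have ha2 : a < 0 := ha.2
        have hb2 : b < 0 := hb.2
        have := hsq a b hab
        have h1 := (pow_left_inj₀ (n := 2) (a := -a) (b := -b) (by linarith) (by linarith)
          two_ne_zero).1 (by rw [neg_sq, neg_sq, this])
        linarith

/-! ### The Radon transform is finite almost everywhere -/

/-- A bounded region of `ℍⁿ` that stays away from a hyperplane containing `ξ₀`. -/
def shell (n : ℕ) (δ R : ℝ) : Set (HSpace n) := {z | δ < |z.1 0| ∧ height z < R}

theorem measurableSet_shell (n : ℕ) (δ R : ℝ) : MeasurableSet (shell n δ R) :=
  (measurableSet_lt measurable_const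
    ((measurable_pi_apply (0 : Fin (n + 1))).comp measurable_subtype_coe).abs).inter
    (measurableSet_lt continuous_height.measurable measurable_const)

theorem continuous_coshDist {n : ℕ} (k : ℕ) : Continuous (coshDist (n := n) k) := by
  unfold coshDist normalSq
  refine Real.continuous_sqrt.comp (continuous_const.add (continuous_finsetSum _ fun i _ => ?_))
  split_ifs
  · exact ((continuous_apply _).comp continuous_subtype_val).pow 2
  · exact continuous_const

/-- In graph coordinates, with all coordinates but the first one fixed, `coshDist` has the form
`√(B + s²)` as a function of the first coordinate `s`. -/
theorem lintegral_shell_le {n k : ℕ} (hk : k < n) {δ R C : ℝ} (hδ : 0 < δ) (hR : 0 < R)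
    (hC : 0 < C) {h : ℝ → ℝ≥0∞} (hh : Measurable h) :
    ∫⁻ z, (shell n δ R).indicator 1 z * h (coshDist k z * C) ∂hypVolume n ≤
      ENNReal.ofReal (2 * R) ^ (n - 1) * (2 * (ENNReal.ofReal (R / (δ * C)) *
        ∫⁻ t in Ioo (Real.sqrt (1 + δ ^ 2) * C) (R * C), h t)) := by
  obtain ⟨m, rfl⟩ : ∃ m, n = m + 1 := ⟨n - 1, by omega⟩
  set Φ : HSpace (m + 1) → ℝ≥0∞ := fun z => (shell (m + 1) δ R).indicator 1 z * h (coshDist k z * C)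
    with hΦ
  have hΦm : Measurable Φ := (measurable_one.indicator (measurableSet_shell _ _ _)).mul
    (hh.comp ((continuous_coshDist k).measurable.mul_const C))
  have hΦg : Measurable fun x : EuclideanSpace ℝ (Fin (m + 1)) => Φ (graphPt x) :=
    hΦm.comp continuous_graphPt.measurable
  have hΦp : Measurable fun x : Fin (m + 1) → ℝ => Φ (graphPt (WithLp.toLp 2 x)) :=
    hΦg.comp (PiLp.continuous_toLp 2 _).measurable
  set box : Set (Fin m → ℝ) := Set.pi univ fun _ => Ioo (-R) R with hbox
  have hboxm : MeasurableSet box := MeasurableSet.univ_pi fun _ => measurableSet_Ioo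
  let q : (Fin m → ℝ) → ℝ := fun y => ∑ i : Fin m, if i.1 + 1 < m + 1 - k then y i ^ 2 else 0
  have hq : ∀ y, 0 ≤ q y := fun y => Finset.sum_nonneg fun i _ => by split_ifs <;> positivity
  have hpt : ∀ (s : ℝ) (y : Fin m → ℝ),
      Φ (graphPt (WithLp.toLp 2 (Fin.cons s y : Fin (m + 1) → ℝ))) ≤ box.indicator 1 y *
        {s : ℝ | δ < |s| ∧ (1 + q y) + s ^ 2 < R ^ 2}.indicator
          (fun s => h (Real.sqrt ((1 + q y) + s ^ 2) * C)) s := by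
    intro s y
    set x : EuclideanSpace ℝ (Fin (m + 1)) := WithLp.toLp 2 (Fin.cons s y) with hx
    by_cases hz : graphPt x ∈ shell (m + 1) δ R
    · have hx0 : (graphPt x).1 0 = s := by
        have h0 : (0 : Fin (m + 2)) = Fin.castSucc 0 := rfl
        rw [h0]
        simp only [graphPt, Fin.snoc_castSucc]
        rfl
      have hcd : coshDist k (graphPt x) = Real.sqrt ((1 + q y) + s ^ 2) := by
        have : normalSq k (graphPt x).1 = s ^ 2 + q y := by
          simp only [normalSq, graphPt, Fin.snoc_castSucc, Fin.sum_univ_succ, q]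
          congr 1
          rw [if_pos (by simp; omega)]
          rfl
        rw [coshDist, this]; congr 1; ring
      obtain ⟨h1, h2⟩ := hz
      have h3 := (one_le_coshDist k (graphPt x))
      have h4 := coshDist_le_height hk (graphPt x)
      have hs : s ∈ {s : ℝ | δ < |s| ∧ (1 + q y) + s ^ 2 < R ^ 2} := by
        refine ⟨by rwa [hx0] at h1, ?_⟩
        rw [← Real.sqrt_lt' hR, ← hcd]
        exact h4.trans_lt h2
      have hy : y ∈ box := by
        intro i _
        have h5 := (abs_coord_le (graphPt x) i.succ.castSucc).trans_lt h2
        have h6 : (graphPt x).1 i.succ.castSucc = y i := by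
          simp only [graphPt, Fin.snoc_castSucc]
          rfl
        rw [h6] at h5
        exact abs_lt.1 h5
      rw [indicator_of_mem hs, indicator_of_mem hy, hΦ]
      dsimp only
      rw [indicator_of_mem (show graphPt x ∈ shell (m + 1) δ R from ⟨h1, h2⟩), hcd]
      simp
    · rw [hΦ]
      dsimp only
      rw [indicator_of_notMem hz, zero_mul]
      exact zero_le
  have hbv : volume box = ENNReal.ofReal (2 * R) ^ m := by
    rw [hbox, volume_pi_pi]
    simp [two_mul]
  have hpres := (volume_preserving_piFinSuccAbove (fun _ : Fin (m + 1) => ℝ) 0).symm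
  have hΦq : Measurable fun p : ℝ × (Fin m → ℝ) =>
      Φ (graphPt (WithLp.toLp 2
        ((MeasurableEquiv.piFinSuccAbove (fun _ : Fin (m + 1) => ℝ) 0).symm p))) :=
    hΦp.comp (MeasurableEquiv.measurable _)
  calc ∫⁻ z, Φ z ∂hypVolume (m + 1) ≤ ∫⁻ x, Φ (graphPt x) := lintegral_hypVolume_le_graph hΦm
    _ = ∫⁻ x : Fin (m + 1) → ℝ, Φ (graphPt (WithLp.toLp 2 x)) :=
        ((PiLp.volume_preserving_toLp (Fin (m + 1))).lintegral_comp hΦg).symm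
    _ = ∫⁻ p : ℝ × (Fin m → ℝ), Φ (graphPt (WithLp.toLp 2
          ((MeasurableEquiv.piFinSuccAbove (fun _ : Fin (m + 1) => ℝ) 0).symm p))) :=
        (hpres.lintegral_comp hΦp).symm
    _ = ∫⁻ y : Fin m → ℝ, ∫⁻ s : ℝ, Φ (graphPt (WithLp.toLp 2
          ((MeasurableEquiv.piFinSuccAbove (fun _ : Fin (m + 1) => ℝ) 0).symm (s, y)))) := by
        rw [Measure.volume_eq_prod, lintegral_prod_symm _ hΦq.aemeasurable]
    _ ≤ ∫⁻ y : Fin m → ℝ, box.indicator 1 y * (2 * (ENNReal.ofReal (R / (δ * C)) *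
        ∫⁻ t in Ioo (Real.sqrt (1 + δ ^ 2) * C) (R * C), h t)) := by
        refine lintegral_mono fun y => ?_
        have hSm : MeasurableSet {s : ℝ | δ < |s| ∧ (1 + q y) + s ^ 2 < R ^ 2} :=
          (measurableSet_lt measurable_const (by fun_prop : Measurable fun s : ℝ => |s|)).inter
            (measurableSet_lt (by fun_prop : Measurable fun s : ℝ => (1 + q y) + s ^ 2)
              measurable_const)
        have hbt : box.indicator (1 : (Fin m → ℝ) → ℝ≥0∞) y ≠ ∞ := by
          by_cases hy : y ∈ box <;> simp [hy]
        calc _ ≤ ∫⁻ s, box.indicator 1 y * {s : ℝ | δ < |s| ∧ (1 + q y) + s ^ 2 < R ^ 2}.indicator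
              (fun s => h (Real.sqrt ((1 + q y) + s ^ 2) * C)) s := by
              refine lintegral_mono fun s => le_trans (le_of_eq ?_) (hpt s y)
              congr 3
              exact Fin.insertNth_zero' s y
          _ = box.indicator 1 y * ∫⁻ s in {s : ℝ | δ < |s| ∧ (1 + q y) + s ^ 2 < R ^ 2},
              h (Real.sqrt ((1 + q y) + s ^ 2) * C) := by
              rw [lintegral_const_mul' _ _ hbt, lintegral_indicator hSm]
          _ ≤ _ := by
              gcongr
              exact lintegral_sqrt_le (by linarith [hq y]) hC hδ hR h
    _ = _ := by
        rw [lintegral_mul_const _ (measurable_one.indicator hboxm), lintegral_indicator_one hboxm,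
          hbv]
        simp

/-- Weighted integrability of the profile bounds the integral of the Radon transform over a
bounded set of geodesics that avoids a neighbourhood of the origin. The reason is that
`{ω > 0 | t / R < cosh ω < t}` is an interval whose length is bounded independently of `t`. -/
theorem lintegral_shell_lt_top {n k : ℕ} (hk : k < n) {δ R : ℝ} (hδ : 0 < δ)
    (hR : 0 < R) {h : ℝ → ℝ≥0∞} (hh : Measurable h)
    (hfin : ∫⁻ t in Ioi (Real.sqrt (1 + δ ^ 2)), h t * ENNReal.ofReal (t ^ (k - 1) / t) < ∞) :
    ∫⁻ z, (shell n δ R).indicator 1 z * (∫⁻ ω in Ioi (0 : ℝ),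
      ENNReal.ofReal (Real.sinh ω ^ (k - 1)) * h (coshDist k z * Real.cosh ω))
        ∂hypVolume n < ∞ := by
  set a := Real.sqrt (1 + δ ^ 2) with ha
  have ha1 : 1 ≤ a := by rw [ha, Real.one_le_sqrt]; nlinarith
  set w : ℝ → ℝ≥0∞ := (Ioi a).indicator fun t => h t * ENNReal.ofReal (t ^ (k - 1) / t) with hw
  have hwm : Measurable w := (hh.mul (by fun_prop)).indicator measurableSet_Ioi
  set E : Set (ℝ × ℝ) := {p | Real.log (p.2 / R) ≤ p.1 ∧ p.1 ≤ Real.log (2 * p.2)} with hE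
  have hEm : MeasurableSet E :=
    (measurableSet_le (Real.measurable_log.comp (by fun_prop)) measurable_fst).inter
      (measurableSet_le measurable_fst (Real.measurable_log.comp (by fun_prop)))
  set V : ℝ≥0∞ := ENNReal.ofReal (2 * R) ^ (n - 1) with hV
  have hVt : V ≠ ∞ := ENNReal.pow_ne_top ENNReal.ofReal_ne_top
  have hind : ∀ z, (shell n δ R).indicator (1 : HSpace n → ℝ≥0∞) z ≠ ∞ := fun z => by
    by_cases hz : z ∈ shell n δ R <;> simp [hz]
  have hmain : ∀ ω t : ℝ, 0 < ω → (Ioo (a * Real.cosh ω) (R * Real.cosh ω)).indicator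
      (fun t => ENNReal.ofReal (Real.sinh ω ^ (k - 1)) *
        (ENNReal.ofReal (R / (δ * Real.cosh ω)) * h t)) t ≤
      ENNReal.ofReal (R ^ 2 / δ) * (E.indicator 1 (ω, t) * w t) := by
    intro ω t hω
    by_cases ht : t ∈ Ioo (a * Real.cosh ω) (R * Real.cosh ω)
    · have hc := Real.cosh_pos ω
      have hc1 := Real.one_le_cosh ω
      have hs := Real.sinh_pos_iff.2 hω
      have hat : a < t := (le_mul_of_one_le_right (by linarith) hc1).trans_lt ht.1
      have ht0 : 0 < t := by linarith
      have hct : Real.cosh ω < t := (le_mul_of_one_le_left hc.le ha1).trans_lt ht.1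
      have hexp : Real.cosh ω ≤ Real.exp ω := by
        rw [Real.cosh_eq]
        have : Real.exp (-ω) ≤ Real.exp ω := Real.exp_le_exp.2 (by linarith)
        linarith
      have hexp2 : Real.exp ω / 2 ≤ Real.cosh ω := by
        rw [Real.cosh_eq]
        have := Real.exp_pos (-ω)
        linarith
      have hmem : (ω, t) ∈ E := by
        constructor
        · rw [Real.log_le_iff_le_exp (by positivity), div_le_iff₀ hR, mul_comm]
          exact ht.2.le.trans (mul_le_mul_of_nonneg_left hexp hR.le)
        · rw [Real.le_log_iff_exp_le (by positivity)]
          dsimp only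
          linarith
      rw [indicator_of_mem ht, indicator_of_mem hmem, hw, indicator_of_mem (mem_Ioi.2 hat),
        Pi.one_apply, one_mul, ← mul_assoc, mul_comm (h t), ← mul_assoc,
        ← ENNReal.ofReal_mul (by positivity), ← ENNReal.ofReal_mul (by positivity)]
      gcongr ENNReal.ofReal ?_ * _
      have h1 : Real.sinh ω ^ (k - 1) ≤ t ^ (k - 1) :=
        pow_le_pow_left₀ hs.le ((Real.sinh_lt_cosh ω).le.trans hct.le) _
      have h2 : R / (δ * Real.cosh ω) ≤ R ^ 2 / δ * (1 / t) := by
        rw [div_mul_div_comm, mul_one, div_le_div_iff₀ (by positivity) (by positivity)]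
        have := ht.2.le
        calc R * (δ * t) = (R * δ) * t := by ring
          _ ≤ (R * δ) * (R * Real.cosh ω) := by gcongr
          _ = _ := by ring
      calc _ ≤ t ^ (k - 1) * (R ^ 2 / δ * (1 / t)) := by gcongr
        _ = _ := by ring
    · rw [indicator_of_notMem ht]; exact zero_le
  have hEw : Measurable fun p : ℝ × ℝ => E.indicator (1 : ℝ × ℝ → ℝ≥0∞) p * w p.2 :=
    (measurable_one.indicator hEm).mul (hwm.comp measurable_snd)
  have hjoint : Measurable fun p : HSpace n × ℝ =>
      (shell n δ R).indicator (1 : HSpace n → ℝ≥0∞) p.1 *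
      (ENNReal.ofReal (Real.sinh p.2 ^ (k - 1)) * h (coshDist k p.1 * Real.cosh p.2)) := by
    refine ((measurable_one.indicator (measurableSet_shell n δ R)).comp measurable_fst).mul
      (Measurable.mul (by fun_prop) (hh.comp ?_))
    exact ((continuous_coshDist k).measurable.comp measurable_fst).mul (by fun_prop)
  calc _ = ∫⁻ z, (∫⁻ ω in Ioi (0 : ℝ), (shell n δ R).indicator 1 z *
        (ENNReal.ofReal (Real.sinh ω ^ (k - 1)) * h (coshDist k z * Real.cosh ω)))
          ∂hypVolume n := by
        simp_rw [lintegral_const_mul' _ _ (hind _)]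
    _ = ∫⁻ ω in Ioi (0 : ℝ), ∫⁻ z, (shell n δ R).indicator 1 z *
        (ENNReal.ofReal (Real.sinh ω ^ (k - 1)) * h (coshDist k z * Real.cosh ω)) ∂hypVolume n :=
        lintegral_lintegral_swap hjoint.aemeasurable
    _ ≤ ∫⁻ ω in Ioi (0 : ℝ), V * (2 * (ENNReal.ofReal (R ^ 2 / δ) *
          ∫⁻ t, E.indicator 1 (ω, t) * w t)) := by
        refine setLIntegral_mono' measurableSet_Ioi fun ω hω => ?_
        simp_rw [mul_left_comm _ (ENNReal.ofReal (Real.sinh ω ^ (k - 1)))]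
        rw [lintegral_const_mul' _ _ ENNReal.ofReal_ne_top]
        refine (mul_le_mul_right (lintegral_shell_le hk hδ hR (Real.cosh_pos ω) hh) _).trans ?_
        rw [mul_left_comm, mul_left_comm _ (2 : ℝ≥0∞), ← hV]
        gcongr V * (2 * ?_)
        rw [← lintegral_const_mul' _ _ ENNReal.ofReal_ne_top,
          ← lintegral_const_mul' _ _ ENNReal.ofReal_ne_top, ← lintegral_indicator measurableSet_Ioo,
          ← lintegral_const_mul' _ _ ENNReal.ofReal_ne_top]
        exact lintegral_mono fun t => hmain ω t hω
    _ = V * (2 * (ENNReal.ofReal (R ^ 2 / δ) *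
          ∫⁻ ω in Ioi (0 : ℝ), ∫⁻ t, E.indicator 1 (ω, t) * w t)) := by
        rw [lintegral_const_mul' _ _ hVt, lintegral_const_mul' _ _ ENNReal.ofNat_ne_top,
          lintegral_const_mul' _ _ ENNReal.ofReal_ne_top]
    _ = V * (2 * (ENNReal.ofReal (R ^ 2 / δ) *
          ∫⁻ t, ∫⁻ ω in Ioi (0 : ℝ), E.indicator 1 (ω, t) * w t)) := by
        rw [lintegral_lintegral_swap hEw.aemeasurable]
    _ ≤ V * (2 * (ENNReal.ofReal (R ^ 2 / δ) *
          ∫⁻ t, ENNReal.ofReal (Real.log (2 * R)) * w t)) := by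
        gcongr with t
        by_cases hta : t ∈ Ioi a
        · have ht0 : 0 < t := by have : a < t := hta; linarith
          have hIcc : ∀ ω, E.indicator (1 : ℝ × ℝ → ℝ≥0∞) (ω, t) =
              (Icc (Real.log (t / R)) (Real.log (2 * t))).indicator 1 ω := fun ω => rfl
          simp_rw [hIcc]
          rw [lintegral_mul_const _ (measurable_one.indicator measurableSet_Icc)]
          gcongr
          refine (setLIntegral_le_lintegral _ _).trans ?_
          rw [lintegral_indicator_one measurableSet_Icc, Real.volume_Icc,
            Real.log_div ht0.ne' hR.ne', Real.log_mul two_ne_zero ht0.ne',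
            Real.log_mul two_ne_zero hR.ne']
          exact ENNReal.ofReal_le_ofReal (by linarith)
        · have : w t = 0 := indicator_of_notMem hta _
          simp [this]
    _ < ∞ := by
        rw [lintegral_const_mul _ hwm, hw, lintegral_indicator measurableSet_Ioi]
        exact ENNReal.mul_lt_top hVt.lt_top (ENNReal.mul_lt_top (by simp)
          (ENNReal.mul_lt_top ENNReal.ofReal_lt_top
            (ENNReal.mul_lt_top ENNReal.ofReal_lt_top hfin)))

theorem sinh_mul_cosh_pow_le {n k : ℕ} (hk1 : 1 ≤ k) (hk : k < n) {s c M : ℝ} (hs : 0 ≤ s)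
    (hc : 0 < c) (hM : c ≤ M * s) :
    s * (c ^ (k - 1) / c) ≤ M ^ (n - 2) * (s ^ (n - 1) * (1 / c ^ (n - k))) := by
  obtain ⟨p, rfl⟩ : ∃ p, n = p + 2 := ⟨n - 2, by omega⟩
  have h1 : c ^ (k - 1) * c ^ (p + 2 - k) = c ^ (p + 1) := by
    rw [← pow_add]; congr 1; omega
  have h2 : p + 2 - 1 = p + 1 := rfl
  have h3 : p + 2 - 2 = p := rfl
  rw [h2, h3, mul_one_div, mul_div_assoc', mul_div_assoc', div_le_div_iff₀ hc (by positivity),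
    mul_assoc, h1]
  calc s * c ^ (p + 1) = s * c * c ^ p := by ring
    _ ≤ s * c * (M * s) ^ p := by gcongr
    _ = _ := by ring

/-- The weighted integrability condition in terms of the profile: by `t = cosh ω` the weight
`sinhⁿ⁻¹ω / coshⁿ⁻ᵏω dω` becomes comparable with `tᵏ⁻² dt`, written `tᵏ⁻¹ / t` to allow `k = 1`. -/
theorem lintegral_zonalProfile_lt_top {n k : ℕ} (hk1 : 1 ≤ k) (hk : k < n) {F : HSpace n → ℝ≥0∞}
    (hF : Measurable F) {a : ℝ} (ha : 1 < a)
    (hfin : ∫⁻ x, F x * (Ioi a).indicator (fun t => ENNReal.ofReal (1 / t ^ (n - k))) (height x)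
      ∂hypVolume n < ∞) :
    ∫⁻ t in Ioi a, zonalProfile (by omega) F t * ENNReal.ofReal (t ^ (k - 1) / t) < ∞ := by
  have hn : 2 ≤ n := by omega
  have : NeZero n := ⟨by omega⟩
  have hp := measurable_zonalProfile hn hF
  have hw : Measurable ((Ioi a).indicator fun t : ℝ => ENNReal.ofReal (1 / t ^ (n - k))) :=
    Measurable.indicator (by fun_prop) measurableSet_Ioi
  have hpw : Measurable fun t => zonalProfile hn F t *
      (Ioi a).indicator (fun t => ENNReal.ofReal (1 / t ^ (n - k))) t := hp.mul hw
  rw [← lintegral_zonalProfile hn hF hw, lintegral_zonal hpw] at hfin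
  have hfin' := ENNReal.lt_top_of_mul_ne_top_right hfin.ne (sphereMass_ne_zero n)
  -- `cosh ω ≤ M sinh ω` as soon as `cosh ω ≥ a`
  set d := Real.sqrt (a ^ 2 - 1) with hd
  have hd0 : 0 < d := Real.sqrt_pos.2 (by nlinarith)
  have hd2 : d ^ 2 = a ^ 2 - 1 := Real.sq_sqrt (by nlinarith)
  set M := a / d with hM
  have hM0 : 0 ≤ M := by positivity
  have hbound : ∀ ω, 0 < ω → a < Real.cosh ω → Real.cosh ω ≤ M * Real.sinh ω := by
    intro ω hω h
    have hs := Real.sinh_pos_iff.2 hω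
    have hc := Real.cosh_pos ω
    refine abs_le_of_sq_le_sq' ?_ (by positivity) |>.2
    rw [mul_pow, hM, div_pow, hd2, Real.sinh_sq, div_mul_eq_mul_div, le_div_iff₀ (by nlinarith)]
    nlinarith
  rw [← inter_eq_left.2 (Ioi_subset_Ioi ha.le), ← Measure.restrict_restrict measurableSet_Ioi,
    ← lintegral_indicator measurableSet_Ioi, lintegral_Ioi_cosh one_pos]
  refine lt_of_le_of_lt ?_ (ENNReal.mul_lt_top (a := ENNReal.ofReal (M ^ (n - 2)))
    ENNReal.ofReal_lt_top hfin')
  rw [← lintegral_const_mul' _ _ ENNReal.ofReal_ne_top]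
  refine setLIntegral_mono' measurableSet_Ioi fun ω hω => ?_
  have hs := Real.sinh_pos_iff.2 hω
  have hc := Real.cosh_pos ω
  rw [one_mul, one_mul]
  by_cases h : a < Real.cosh ω
  · rw [indicator_of_mem (mem_Ioi.2 h)]
    rw [indicator_of_mem (mem_Ioi.2 h), mul_left_comm,
      mul_left_comm (ENNReal.ofReal _) (zonalProfile _ _ _), mul_left_comm (ENNReal.ofReal (M ^ _)),
      ← ENNReal.ofReal_mul hs.le, ← ENNReal.ofReal_mul (by positivity),
      ← ENNReal.ofReal_mul (by positivity)]
    gcongr _ * ENNReal.ofReal ?_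
    exact sinh_mul_cosh_pow_le hk1 hk hs.le hc (hbound ω hω h)
  · rw [indicator_of_notMem (by simpa using h), mul_zero]
    exact zero_le

/-- In graph coordinates `{x₁ = 0}` is a proper linear subspace of `ℝⁿ`. -/
theorem hypVolume_hyperplane {n : ℕ} [NeZero n] : hypVolume n {x | x.1 0 = 0} = 0 := by
  have hm : MeasurableSet {x : HSpace n | x.1 0 = 0} :=
    measurableSet_eq_fun ((measurable_pi_apply _).comp measurable_subtype_coe) measurable_const
  rw [← lintegral_indicator_one hm, ← nonpos_iff_eq_zero]
  refine (lintegral_hypVolume_le_graph (measurable_one.indicator hm)).trans (le_of_eq ?_)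
  obtain ⟨m, rfl⟩ : ∃ m, n = m + 1 := ⟨n - 1, by have := NeZero.ne n; omega⟩
  let p : EuclideanSpace ℝ (Fin (m + 1)) →ₗ[ℝ] ℝ := (EuclideanSpace.proj 0 :
    EuclideanSpace ℝ (Fin (m + 1)) →L[ℝ] ℝ).toLinearMap
  have h1 : ∀ x : EuclideanSpace ℝ (Fin (m + 1)), ({x : HSpace (m + 1) | x.1 0 = 0}.indicator
      (1 : HSpace (m + 1) → ℝ≥0∞)) (graphPt x)
      = ((LinearMap.ker p : Submodule ℝ _) :
        Set (EuclideanSpace ℝ (Fin (m + 1)))).indicator 1 x := by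
    intro x
    have h0 : (graphPt x).1 0 = x 0 := by
      have h0 : (0 : Fin (m + 2)) = Fin.castSucc 0 := rfl
      rw [h0]
      simp only [graphPt, Fin.snoc_castSucc]
    by_cases hx : x 0 = 0
    · rw [indicator_of_mem (show graphPt x ∈ _ from h0.trans hx),
        indicator_of_mem (show x ∈ (LinearMap.ker p : Set _) from hx)]
      rfl
    · rw [indicator_of_notMem (show graphPt x ∉ {x : HSpace (m + 1) | x.1 0 = 0} from
          fun h => hx (h0.symm.trans h)),
        indicator_of_notMem (show x ∉ (LinearMap.ker p : Set _) from fun h => hx h)]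
  simp_rw [h1]
  rw [lintegral_indicator_one (Submodule.closed_of_finiteDimensional _).measurableSet]
  refine Measure.addHaar_submodule _ _ fun h => ?_
  have : EuclideanSpace.single (0 : Fin (m + 1)) (1 : ℝ) ∈ LinearMap.ker p := by rw [h]; trivial
  have h2 : p (EuclideanSpace.single (0 : Fin (m + 1)) (1 : ℝ)) = 0 := this
  simp [p] at h2

theorem measurable_coord {n : ℕ} (i : Fin (n + 1)) : Measurable fun x : HSpace n => x.1 i :=
  (measurable_pi_apply i).comp measurable_subtype_coe

/-- For almost every `g` the point `g⁻¹x₀` lies off the hyperplane `{x₁ = 0}`, which contains `ξ₀`;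
in particular `gξ₀` does not pass through the origin. -/
theorem ae_inv_smul_x0_coord_ne_zero {n : ℕ} (hn : 2 ≤ n) :
    ∀ᵐ g : G n ∂Measure.haar, (g⁻¹ • x0 n).1 0 ≠ 0 := by
  have : NeZero n := ⟨by omega⟩
  obtain ⟨c, -, hmap⟩ := exists_map_haar_eq hn
  have hm : MeasurableSet {x : HSpace n | x.1 0 = 0} :=
    measurableSet_eq_fun (measurable_coord 0) measurable_const
  have hcont : Continuous fun g : G n => g • x0 n := continuous_id.smul continuous_const
  set S : Set (G n) := (fun g : G n => g • x0 n) ⁻¹' {x : HSpace n | x.1 0 = 0} with hS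
  have h1 : (Measure.haar : Measure (G n)) S = 0 := by
    rw [hS, ← Measure.map_apply hcont.measurable hm, hmap, Measure.smul_apply,
      hypVolume_hyperplane, smul_zero]
  have hi := isInvInvariant_haar hn
  have h2 : (Measure.haar : Measure (G n)) S⁻¹ = 0 := by
    rw [Measure.measure_inv, h1]
  exact measure_mono_null (fun g hg => not_not.1 hg) h2

/-- For a measurable nonnegative function with the integrability condition, the Radon transform is
finite almost everywhere: the weights `1_{shell}(g⁻¹x₀)` for a sequence of shells cover almost all
of the group. The threshold `1` is excluded, since nothing is known about `F` near the origin. -/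
theorem ae_lintegral_emb_lt_top {n k : ℕ} (hk1 : 1 ≤ k) (hk : k < n) {F : HSpace n → ℝ≥0∞}
    (hF : Measurable F)
    (hfin : ∀ a : ℝ, 1 < a → ∫⁻ x, F x * (Ioi a).indicator
      (fun t => ENNReal.ofReal (1 / t ^ (n - k))) (height x) ∂hypVolume n < ∞) :
    ∀ᵐ g : G n ∂Measure.haar, ∫⁻ y, F (g • emb hk y) ∂hypVolume k < ∞ := by
  have hn : 2 ≤ n := by omega
  obtain ⟨c, hc, hdual⟩ := exists_lintegral_haar_radon hk1 hk
  have hF' : Measurable fun g : G n => ∫⁻ y, F (g • emb hk y) ∂hypVolume k :=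
    Measurable.lintegral_prod_right' (f := fun p : G n × HSpace k => F (p.1 • emb hk p.2))
      (hF.comp (continuous_fst.smul ((continuous_emb hk).comp continuous_snd)).measurable)
  -- on the `j`-th shell `coshDist` exceeds `√(1 + (j + 1)⁻²) > 1`
  have hall : ∀ j : ℕ, ∀ᵐ g : G n ∂Measure.haar, g⁻¹ • x0 n ∈ shell n (1 / (j + 1 : ℝ)) (j + 1) →
      ∫⁻ y, F (g • emb hk y) ∂hypVolume k < ∞ := by
    intro j
    have hδ : (0 : ℝ) < 1 / (j + 1) := by positivity
    have hφ : Measurable ((shell n (1 / (j + 1 : ℝ)) (j + 1)).indicator (1 : HSpace n → ℝ≥0∞)) :=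
      measurable_one.indicator (measurableSet_shell _ _ _)
    have ha : 1 < Real.sqrt (1 + (1 / (j + 1 : ℝ)) ^ 2) := by
      rw [Real.lt_sqrt zero_le_one]
      have : 0 < (1 / (j + 1 : ℝ)) ^ 2 := by positivity
      linarith
    have h1 := lintegral_shell_lt_top hk hδ (R := j + 1) (by positivity)
      (measurable_zonalProfile hn hF)
      (lintegral_zonalProfile_lt_top hk1 hk hF ha (hfin _ ha))
    have h2 := ENNReal.mul_lt_top hc.lt_top h1
    rw [← hdual hF hφ] at h2
    filter_upwards [ae_lt_top ((hφ.comp (measurable_inv_smul_x0 n)).mul hF') h2.ne] with g hg hgs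
    change (shell n (1 / (j + 1 : ℝ)) (j + 1)).indicator (1 : HSpace n → ℝ≥0∞) (g⁻¹ • x0 n) *
      ∫⁻ y, F (g • emb hk y) ∂hypVolume k < ∞ at hg
    rwa [indicator_of_mem hgs, Pi.one_apply, one_mul] at hg
  filter_upwards [ae_all_iff.2 hall, ae_inv_smul_x0_coord_ne_zero hn] with g hg hg0
  obtain ⟨j, hj⟩ := exists_nat_gt (max (1 / |(g⁻¹ • x0 n).1 0|) (height (g⁻¹ • x0 n)))
  have hpos := abs_pos.2 hg0
  have hj1 := (le_max_left _ _).trans_lt hj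
  have hj2 := (le_max_right _ _).trans_lt hj
  refine hg j ⟨?_, by linarith⟩
  rw [one_div_lt (by positivity) hpos]
  linarith

/-! ### Locally integrable functions -/

theorem isCompact_height_le {n : ℕ} (hn : 1 ≤ n) (R : ℝ) :
    IsCompact {x : HSpace n | height x ≤ R} := by
  have h := (isCompact_height_smul_le (n := n) R).image
    (f := fun g : G n => g • x0 n) (continuous_id.smul continuous_const)
  convert! h using 1
  ext x
  constructor
  · intro hx
    obtain ⟨g, rfl⟩ := exists_smul_x0_eq hn x
    exact ⟨g, hx, rfl⟩
  · rintro ⟨g, hg, rfl⟩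
    exact hg

theorem height_x0 (n : ℕ) : height (x0 n) = 1 := by simp [height, x0]

theorem integrableOn_height_Icc {n : ℕ} (hn : 1 ≤ n) {E : Type*} [NormedAddCommGroup E]
    {f : HSpace n → E} (hf : LocallyIntegrableOn f {x0 n}ᶜ (hypVolume n)) {a : ℝ} (ha : 1 < a)
    (R : ℝ) : IntegrableOn f {x | a ≤ height x ∧ height x ≤ R} (hypVolume n) := by
  refine hf.integrableOn_compact_subset ?_ ((isCompact_height_le hn R).of_isClosed_subset
    ((isClosed_le continuous_const continuous_height).inter
      (isClosed_le continuous_height continuous_const)) fun x hx => hx.2)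
  rintro x ⟨hx, -⟩ rfl
  rw [height_x0] at hx
  linarith

theorem aestronglyMeasurable_of_locallyIntegrableOn {n : ℕ} [NeZero n] {E : Type*}
    [NormedAddCommGroup E] {f : HSpace n → E}
    (hf : LocallyIntegrableOn f {x0 n}ᶜ (hypVolume n)) :
    AEStronglyMeasurable f (hypVolume n) := by
  have h := hf.aestronglyMeasurable
  rwa [Measure.restrict_eq_self_of_ae_mem] at h
  rw [ae_iff]
  refine measure_mono_null (fun x hx => ?_) (hypVolume_hyperplane (n := n))
  have hx' : x = x0 n := by simpa using hx
  obtain ⟨m, rfl⟩ : ∃ m, n = m + 1 := ⟨n - 1, by have := NeZero.ne n; omega⟩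
  have h0 : (0 : Fin (m + 2)) = Fin.castSucc 0 := rfl
  rw [hx', mem_ofPred_eq, h0]
  simp [x0]

theorem lintegral_weight_lt_top {n k : ℕ} [NeZero n] {f : HSpace n → ℂ}
    (hf : LocallyIntegrableOn f {x0 n}ᶜ (hypVolume n)) (htail : tailIntegral k f < ∞) {a : ℝ}
    (ha : 1 < a) :
    ∫⁻ x, ‖f x‖ₑ * (Ioi a).indicator (fun t => ENNReal.ofReal (1 / t ^ (n - k))) (height x)
      ∂hypVolume n < ∞ := by
  have hS1 : MeasurableSet {x : HSpace n | a ≤ height x ∧ height x ≤ 2} :=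
    (measurableSet_le measurable_const continuous_height.measurable).inter
      (measurableSet_le continuous_height.measurable measurable_const)
  have hS2 : MeasurableSet {x : HSpace n | 2 < height x} :=
    measurableSet_lt measurable_const continuous_height.measurable
  have h1 : ∫⁻ x in {x : HSpace n | a ≤ height x ∧ height x ≤ 2}, ‖f x‖ₑ ∂hypVolume n < ∞ :=
    (integrableOn_height_Icc NeZero.one_le hf ha 2).2
  refine lt_of_le_of_lt ?_ (ENNReal.add_lt_top.2 ⟨h1, htail⟩)
  rw [tailIntegral, ← lintegral_indicator hS1, ← lintegral_indicator hS2, ← lintegral_add_left'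
    ((aestronglyMeasurable_of_locallyIntegrableOn hf).enorm.indicator hS1)]
  refine lintegral_mono fun x => ?_
  by_cases hx : a < height x
  · rw [indicator_of_mem (mem_Ioi.2 hx)]
    by_cases hx2 : height x ≤ 2
    · rw [indicator_of_mem (show x ∈ {x : HSpace n | a ≤ height x ∧ height x ≤ 2} from
        ⟨hx.le, hx2⟩)]
      refine le_add_right (mul_le_of_le_one_right zero_le ?_)
      rw [ENNReal.ofReal_le_one]
      have h2 : 1 ≤ height x ^ (n - k) := one_le_pow₀ (one_le_height x)
      exact (div_le_one (by linarith)).2 h2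
    · rw [indicator_of_mem (show x ∈ {x : HSpace n | 2 < height x} from not_le.1 hx2)]
      refine le_add_left (le_of_eq ?_)
      rw [← ofReal_norm, ← ENNReal.ofReal_mul (norm_nonneg _), mul_one_div]
  · rw [indicator_of_notMem (by simpa using hx), mul_zero]
    exact zero_le

/-- Functions satisfying the integrability condition are integrable over almost all geodesics. -/
theorem forAlmostAll_integrable {n k : ℕ} (hk1 : 1 ≤ k) (hk : k < n) {f : HSpace n → ℂ}
    (hf : LocallyIntegrableOn f {x0 n}ᶜ (hypVolume n)) (htail : tailIntegral k f < ∞) :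
    ForAlmostAll hk fun ξ : Geod n k => Integrable f (geodVolume hk ξ) := by
  have : NeZero n := ⟨by omega⟩
  have : NeZero k := ⟨by omega⟩
  have hfm := aestronglyMeasurable_of_locallyIntegrableOn hf
  set u := hfm.mk f with hu
  have hum : StronglyMeasurable u := hfm.stronglyMeasurable_mk
  obtain ⟨N, hsub, hN, hN0⟩ := exists_measurable_superset_of_null (ae_iff.1 hfm.ae_eq_mk)
  have h1 : ∀ᵐ g : G n ∂Measure.haar, ∫⁻ y, ‖u (g • emb hk y)‖ₑ ∂hypVolume k < ∞ := by
    refine ae_lintegral_emb_lt_top hk1 hk (F := fun x => ‖u x‖ₑ) hum.measurable.enorm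
      fun a ha => ?_
    refine lt_of_le_of_lt (le_of_eq ?_) (lintegral_weight_lt_top hf htail ha)
    refine lintegral_congr_ae ?_
    filter_upwards [hfm.ae_eq_mk] with x hx
    rw [hx]
  -- the same result for `∞ · 1_N`: a null set meets almost every geodesic in a null set
  have h2 : ∀ᵐ g : G n ∂Measure.haar,
      ∫⁻ y, N.indicator (fun _ => ∞) (g • emb hk y) ∂hypVolume k < ∞ := by
    refine ae_lintegral_emb_lt_top hk1 hk (measurable_const.indicator hN) fun a ha => ?_
    have h3 : ∀ᵐ x ∂hypVolume n, x ∉ N := by rw [ae_iff]; simpa using hN0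
    rw [lintegral_congr_ae (g := 0)]
    · simp
    · filter_upwards [h3] with x hx
      simp [hx]
  unfold ForAlmostAll
  filter_upwards [h1, h2] with g hg1 hg2
  have h4 : geodVolume hk (move g (xi0 hk)) N = 0 := by
    have h5 : ∫⁻ x, N.indicator (fun _ => ∞) x ∂geodVolume hk (move g (xi0 hk)) < ∞ := by
      rwa [lintegral_geodVolume_move hk g (measurable_const.indicator hN)]
    rw [lintegral_indicator_const hN] at h5
    by_contra h6
    rw [ENNReal.top_mul h6] at h5
    exact lt_irrefl _ h5
  have hae : f =ᵐ[geodVolume hk (move g (xi0 hk))] u :=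
    ae_iff.2 (measure_mono_null hsub h4)
  refine Integrable.congr ⟨hum.aestronglyMeasurable, ?_⟩ hae.symm
  rw [HasFiniteIntegral, lintegral_geodVolume_move hk g hum.measurable.enorm]
  exact hg1

/-! ### Divergence for zonal functions -/

/-- One-dimensional form of the divergence statement. Both integrals are comparable with
`∫ tᵏ⁻² h(t) dt` over `t > 2c`: the first by `t = cosh ω`, the second by `t = c cosh ω`. -/
theorem lintegral_cosh_eq_top {n k : ℕ} (hk1 : 1 ≤ k) (hk : k < n) {c : ℝ} (hc : 1 ≤ c)
    {h : ℝ → ℝ≥0∞} (hinf : ∫⁻ ω in Ioi (0 : ℝ), ENNReal.ofReal (Real.sinh ω ^ (n - 1)) *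
      (Ioi (2 * c)).indicator (fun t => ENNReal.ofReal (1 / t ^ (n - k)) * h t) (Real.cosh ω) = ∞) :
    ∫⁻ ω in Ioi (0 : ℝ), ENNReal.ofReal (Real.sinh ω ^ (k - 1)) * h (c * Real.cosh ω) = ∞ := by
  have hc0 : 0 < c := by linarith
  set φ : ℝ → ℝ≥0∞ :=
    (Ioi (2 * c)).indicator fun t => ENNReal.ofReal (t ^ (k - 1) / t) * h t with hφ
  have hsub : ∀ b, b ≤ 2 * c → ∫⁻ t in Ioi b, φ t =
      ∫⁻ t in Ioi (2 * c), ENNReal.ofReal (t ^ (k - 1) / t) * h t := by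
    intro b hb
    rw [hφ, setLIntegral_indicator measurableSet_Ioi, inter_eq_left.2 (Ioi_subset_Ioi hb)]
  have h1 : ∫⁻ t in Ioi (1 : ℝ), φ t = ∞ := by
    rw [lintegral_Ioi_cosh one_pos, ← top_le_iff, ← hinf]
    refine setLIntegral_mono' measurableSet_Ioi fun ω hω => ?_
    have hs := Real.sinh_pos_iff.2 hω
    have hch := Real.cosh_pos ω
    rw [one_mul, one_mul, hφ]
    by_cases hm : Real.cosh ω ∈ Ioi (2 * c)
    · rw [indicator_of_mem hm, indicator_of_mem hm, ← mul_assoc, ← mul_assoc,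
        ← ENNReal.ofReal_mul (by positivity), ← ENNReal.ofReal_mul (by positivity)]
      gcongr ENNReal.ofReal ?_ * _
      obtain ⟨p, rfl⟩ : ∃ p, n = p + 2 := ⟨n - 2, by omega⟩
      have e1 : Real.cosh ω ^ (k - 1) * Real.cosh ω ^ (p + 2 - k) = Real.cosh ω ^ (p + 1) := by
        rw [← pow_add]; congr 1; omega
      have e2 : p + 2 - 1 = p + 1 := rfl
      rw [e2, mul_one_div, mul_div_assoc', div_le_div_iff₀ (by positivity) hch, mul_assoc, e1]
      calc Real.sinh ω ^ (p + 1) * Real.cosh ω = Real.sinh ω * Real.cosh ω * Real.sinh ω ^ p := by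
            ring
        _ ≤ Real.sinh ω * Real.cosh ω * Real.cosh ω ^ p := by
            gcongr; exact (Real.sinh_lt_cosh ω).le
        _ = _ := by ring
    · rw [indicator_of_notMem hm, mul_zero]
      exact zero_le
  rw [hsub 1 (by linarith), ← hsub c (by linarith), lintegral_Ioi_cosh hc0] at h1
  by_contra hne
  have h2 : ENNReal.ofReal ((2 * c) ^ (k - 1)) * ∫⁻ ω in Ioi (0 : ℝ),
      ENNReal.ofReal (Real.sinh ω ^ (k - 1)) * h (c * Real.cosh ω) < ∞ :=
    ENNReal.mul_lt_top ENNReal.ofReal_lt_top (lt_top_iff_ne_top.2 hne)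
  refine absurd (le_of_eq h1.symm) (not_le.2 (lt_of_le_of_lt ?_ h2))
  rw [← lintegral_const_mul' _ _ ENNReal.ofReal_ne_top]
  refine setLIntegral_mono' measurableSet_Ioi fun ω hω => ?_
  have hs := Real.sinh_pos_iff.2 hω
  have hch := Real.cosh_pos ω
  rw [hφ]
  by_cases hm : c * Real.cosh ω ∈ Ioi (2 * c)
  · have h3 : 2 < Real.cosh ω := by
      have : 2 * c < c * Real.cosh ω := hm
      nlinarith
    have h4 : Real.cosh ω ≤ 2 * Real.sinh ω := by
      refine abs_le_of_sq_le_sq' ?_ (by positivity) |>.2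
      rw [mul_pow, Real.sinh_sq]
      nlinarith
    rw [indicator_of_mem hm, ← mul_assoc, ← mul_assoc, ← ENNReal.ofReal_mul (by positivity),
      ← ENNReal.ofReal_mul (by positivity)]
    gcongr ENNReal.ofReal ?_ * _
    calc c * Real.sinh ω * ((c * Real.cosh ω) ^ (k - 1) / (c * Real.cosh ω))
        = (Real.sinh ω / Real.cosh ω) * (c * Real.cosh ω) ^ (k - 1) := by field_simp
      _ ≤ 1 * (c * (2 * Real.sinh ω)) ^ (k - 1) := by
          gcongr
          exact (div_le_one hch).2 (Real.sinh_lt_cosh ω).le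
      _ = _ := by rw [one_mul, ← mul_pow]; ring
  · rw [indicator_of_notMem hm, mul_zero]
    exact zero_le

/-- If the profile of a zonal function on `ℍⁿ` is not integrable at infinity, then it dominates a
measurable function on the line with the same property. The function `f₀` is only known to be almost
everywhere measurable after composition with the height, so a measurable minorant `ψ` with the same
lower integral is chosen first. -/
theorem exists_measurable_profile {n k : ℕ} [NeZero n] {f : HSpace n → ℝ} {f₀ : ℝ → ℝ}
    (hfm : AEStronglyMeasurable f (hypVolume n)) (hf0 : ∀ x, f x = f₀ (height x))
    (hpos : ∀ x, 0 ≤ f x) (htail : tailIntegral k (fun x => (f x : ℂ)) = ∞) :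
    ∃ h : ℝ → ℝ≥0∞, Measurable h ∧ (∀ x : HSpace n, h (height x) ≤ ENNReal.ofReal (f x)) ∧
      ∫⁻ ω in Ioi (0 : ℝ), ENNReal.ofReal (Real.sinh ω ^ (n - 1)) *
        (Ioi 2).indicator (fun t => ENNReal.ofReal (1 / t ^ (n - k)) * h t) (Real.cosh ω) = ∞ := by
  have hS2 : MeasurableSet {x : HSpace n | 2 < height x} :=
    measurableSet_lt measurable_const continuous_height.measurable
  set ρ : Measure ℝ := (volume.restrict (Ioi (0 : ℝ))).withDensity
    fun ω => ENNReal.ofReal (Real.sinh ω ^ (n - 1)) with hρ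
  set φ : ℝ → ℝ≥0∞ := fun ω => (Ioi 2).indicator
    (fun t => ENNReal.ofReal (‖f₀ t‖ / t ^ (n - k))) (Real.cosh ω) with hφ
  have h1 : sphereMass n * ∫⁻ ω, φ ω ∂ρ = ∞ := by
    rw [← htail, tailIntegral, ← lintegral_indicator hS2]
    have hm : AEMeasurable ({x : HSpace n | 2 < height x}.indicator fun x =>
        ENNReal.ofReal (‖(f x : ℂ)‖ / height x ^ (n - k))) (hypVolume n) := by
      refine AEMeasurable.indicator ?_ hS2
      simp_rw [Complex.norm_real]
      exact (hfm.norm.aemeasurable.div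
        (continuous_height.pow (n - k)).measurable.aemeasurable).ennreal_ofReal
    rw [hypVolume] at hm ⊢
    rw [lintegral_map' hm continuous_polar.measurable.aemeasurable]
    replace hm := hm.comp_measurable continuous_polar.measurable
    dsimp only [Function.comp_def] at hm
    rw [lintegral_prod _ hm]
    have h2 : ∀ (ζ : Metric.sphere (0 : EuclideanSpace ℝ (Fin n)) 1) (ω : ℝ),
        ({x : HSpace n | 2 < height x}.indicator fun x =>
        ENNReal.ofReal (‖(f x : ℂ)‖ / height x ^ (n - k))) (polar (ζ, ω)) = φ ω := by
      intro ζ ω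
      have h3 := height_polar (ζ, ω)
      by_cases hω : 2 < Real.cosh ω
      · rw [indicator_of_mem (show polar (ζ, ω) ∈ {x : HSpace n | 2 < height x} by
          rw [mem_ofPred_eq, h3]; exact hω), hφ]
        dsimp only
        rw [indicator_of_mem (mem_Ioi.2 hω), hf0, h3, Complex.norm_real]
      · rw [indicator_of_notMem (show polar (ζ, ω) ∉ {x : HSpace n | 2 < height x} by
          rw [mem_ofPred_eq, h3]; exact hω), hφ]
        dsimp only
        rw [indicator_of_notMem (show Real.cosh ω ∉ Ioi 2 from hω)]
    simp_rw [h2]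
    rw [lintegral_const, mul_comm, sphereMass]
  have h2 : ∫⁻ ω, φ ω ∂ρ = ∞ := by
    by_contra h
    exact ENNReal.mul_ne_top (sphereMass_ne_top n) h h1
  obtain ⟨ψ, hψ, hψφ, hψint⟩ := exists_measurable_le_lintegral_eq ρ φ
  rw [h2] at hψint
  have harc : Measurable Real.arcosh := by
    unfold Real.arcosh
    exact Real.measurable_log.comp (by fun_prop)
  refine ⟨(Ioi 2).indicator fun t => ψ (Real.arcosh t) * ENNReal.ofReal (t ^ (n - k)),
    Measurable.indicator ((hψ.comp harc).mul (by fun_prop)) measurableSet_Ioi, fun x => ?_, ?_⟩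
  · by_cases hx : 2 < height x
    · rw [indicator_of_mem (mem_Ioi.2 hx)]
      refine (mul_le_mul_left (hψφ _) _).trans (le_of_eq ?_)
      have hx0 : 0 < height x := by linarith
      rw [hφ]
      dsimp only
      rw [Real.cosh_arcosh (one_le_height x), indicator_of_mem (mem_Ioi.2 hx),
        ← ENNReal.ofReal_mul (by positivity), div_mul_cancel₀ _ (by positivity), ← hf0,
        Real.norm_of_nonneg (hpos x)]
    · rw [indicator_of_notMem (show height x ∉ Ioi 2 from hx)]
      exact zero_le
  · rw [hψint, hρ, lintegral_withDensity_eq_lintegral_mul _ (by fun_prop) hψ]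
    refine setLIntegral_congr_fun measurableSet_Ioi fun ω hω => ?_
    rw [Pi.mul_apply]
    congr 1
    by_cases h : 2 < Real.cosh ω
    · have hch := Real.cosh_pos ω
      rw [indicator_of_mem (mem_Ioi.2 h), indicator_of_mem (mem_Ioi.2 h),
        Real.arcosh_cosh (le_of_lt hω), mul_left_comm, ← ENNReal.ofReal_mul (by positivity),
        one_div_mul_cancel (by positivity), ENNReal.ofReal_one, mul_one]
    · rw [indicator_of_notMem (show Real.cosh ω ∉ Ioi 2 from h)]
      refine le_antisymm zero_le ((hψφ ω).trans (le_of_eq ?_))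
      rw [hφ]
      exact indicator_of_notMem (show Real.cosh ω ∉ Ioi 2 from h) _

/-- A nonnegative zonal function violating the integrability condition has infinite integral over
every geodesic. -/
theorem radon_eq_top_of_isZonal {n k : ℕ} (hk1 : 1 ≤ k) (hk : k < n) {f : HSpace n → ℝ}
    (hf : LocallyIntegrableOn f {x0 n}ᶜ (hypVolume n)) (hpos : ∀ x, 0 ≤ f x) (hz : IsZonal f)
    (htail : tailIntegral k (fun x => (f x : ℂ)) = ∞) (ξ : Geod n k) :
    radon hk (fun x => ENNReal.ofReal (f x)) ξ = ∞ := by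
  have : NeZero n := ⟨by omega⟩
  have : NeZero k := ⟨by omega⟩
  obtain ⟨f₀, hf0⟩ := hz
  obtain ⟨h, hh, hle, hinf⟩ := exists_measurable_profile
    (aestronglyMeasurable_of_locallyIntegrableOn hf) hf0 hpos htail
  set g := rot hk ξ with hg
  set z := g⁻¹ • x0 n with hzdef
  set c := coshDist k z with hcdef
  have hc : 1 ≤ c := one_le_coshDist k z
  -- by local integrability, the part over `2 < xₙ₊₁ ≤ 2c` does not contribute
  have hloc : ∫⁻ ω in Ioi (0 : ℝ), ENNReal.ofReal (Real.sinh ω ^ (n - 1)) *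
      (Icc 2 (2 * c)).indicator h (Real.cosh ω) < ∞ := by
    have hS : MeasurableSet {x : HSpace n | 2 ≤ height x ∧ height x ≤ 2 * c} :=
      (measurableSet_le measurable_const continuous_height.measurable).inter
        (measurableSet_le continuous_height.measurable measurable_const)
    have h1 : ∫⁻ x in {x : HSpace n | 2 ≤ height x ∧ height x ≤ 2 * c}, ‖f x‖ₑ ∂hypVolume n < ∞ :=
      (integrableOn_height_Icc (by omega) hf one_lt_two (2 * c)).2
    have h2 := lintegral_zonal (n := n)
      (hh.indicator (measurableSet_Icc (a := (2 : ℝ)) (b := 2 * c)))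
    refine ENNReal.lt_top_of_mul_ne_top_right (a := sphereMass n) ?_ (sphereMass_ne_zero n)
    rw [← h2]
    refine ne_of_lt (lt_of_le_of_lt ?_ h1)
    rw [← lintegral_indicator hS]
    refine lintegral_mono fun x => ?_
    by_cases hx : height x ∈ Icc 2 (2 * c)
    · rw [indicator_of_mem hx, indicator_of_mem (show x ∈
        {x : HSpace n | 2 ≤ height x ∧ height x ≤ 2 * c} from hx)]
      refine (hle x).trans ?_
      rw [← ofReal_norm, Real.norm_of_nonneg (hpos x)]
    · rw [indicator_of_notMem hx]
      exact zero_le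
  have hinf' : ∫⁻ ω in Ioi (0 : ℝ), ENNReal.ofReal (Real.sinh ω ^ (n - 1)) *
      (Ioi (2 * c)).indicator (fun t => ENNReal.ofReal (1 / t ^ (n - k)) * h t) (Real.cosh ω)
      = ∞ := by
    by_contra hne
    refine absurd (le_of_eq hinf.symm) (not_le.2 (lt_of_le_of_lt ?_
      (ENNReal.add_lt_top.2 ⟨hloc, lt_top_iff_ne_top.2 hne⟩)))
    have hmeas : Measurable fun ω => ENNReal.ofReal (Real.sinh ω ^ (n - 1)) *
        (Icc 2 (2 * c)).indicator h (Real.cosh ω) :=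
      (by fun_prop : Measurable fun ω : ℝ => ENNReal.ofReal (Real.sinh ω ^ (n - 1))).mul
        ((hh.indicator measurableSet_Icc).comp Real.measurable_cosh)
    rw [← lintegral_add_left hmeas]
    refine lintegral_mono fun ω => ?_
    rw [← mul_add]
    gcongr
    by_cases h2 : 2 < Real.cosh ω
    · rw [indicator_of_mem (mem_Ioi.2 h2)]
      by_cases h3 : Real.cosh ω ≤ 2 * c
      · rw [indicator_of_mem (mem_Icc.2 ⟨h2.le, h3⟩)]
        refine le_add_right (mul_le_of_le_one_left zero_le ?_)
        rw [ENNReal.ofReal_le_one]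
        have h4 : 1 ≤ Real.cosh ω ^ (n - k) := one_le_pow₀ (Real.one_le_cosh ω)
        exact (div_le_one (by linarith)).2 h4
      · rw [indicator_of_mem (mem_Ioi.2 (not_le.1 h3))]
        exact le_add_self
    · rw [indicator_of_notMem (show Real.cosh ω ∉ Ioi 2 from h2)]
      exact zero_le
  have hm : Measurable fun y : HSpace k => g • emb hk y :=
    ((continuous_smul_right g).comp (continuous_emb hk)).measurable
  rw [← top_le_iff, radon]
  calc (∞ : ℝ≥0∞) = ∫⁻ y, h (lor (emb hk y).1 z.1) ∂hypVolume k := by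
        rw [lintegral_emb_lor hk hh z, lintegral_cosh_eq_top hk1 hk hc hinf',
          ENNReal.mul_top (sphereMass_ne_zero k)]
    _ = ∫⁻ x, h (height x) ∂geodVolume hk ξ := by
        have hhm : Measurable fun x : HSpace n => h (height x) :=
          hh.comp continuous_height.measurable
        rw [geodVolume, lintegral_map hhm hm]
        refine lintegral_congr fun y => ?_
        rw [height_eq_lor, lor_smul_eq_lor_inv]
    _ ≤ _ := lintegral_mono hle

end HypSpace

end

theorem theorem4 (n k : ℕ) (hk1 : 1 ≤ k) (hk : k < n) :
    (∀ f : HypSpace.HSpace n → ℂ,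
      MeasureTheory.LocallyIntegrableOn f {HypSpace.x0 n}ᶜ (HypSpace.hypVolume n) →
      HypSpace.tailIntegral k f < ∞ →
      HypSpace.ForAlmostAll hk fun ξ : HypSpace.Geod n k =>
        MeasureTheory.Integrable f (HypSpace.geodVolume hk ξ)) ∧
    (∀ f : HypSpace.HSpace n → ℝ,
      MeasureTheory.LocallyIntegrableOn f {HypSpace.x0 n}ᶜ (HypSpace.hypVolume n) →
      (∀ x, 0 ≤ f x) →
      HypSpace.IsZonal f →
      ¬ HypSpace.tailIntegral k (fun x => (f x : ℂ)) < ∞ →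
      ∀ ξ : HypSpace.Geod n k, HypSpace.radon hk (fun x => ENNReal.ofReal (f x)) ξ = ∞) :=
  ⟨fun _ hf htail => HypSpace.forAlmostAll_integrable hk1 hk hf htail,
    fun _ hf hpos hz htail ξ => HypSpace.radon_eq_top_of_isZonal hk1 hk hf hpos hz
      (not_lt_top_iff.1 htail) ξ⟩
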